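/- **Setting.** Inner products $(\cdot,\cdot)$ are linear in the second variable. For a self-adjoint operator $A$ on a complex Hilbert space $\mathcal H$ let $E_A$ be its spectral measure and $f(A)=\int f\,dE_A$ for Borel $f$. Let $\mathcal H_{\rm ac}(A)$ be the set of $\psi$ for which $\|E_A(\cdot)\psi\|^2$ is absolutely continuous with respect to Lebesgue measure, $\mathcal H_{\rm p}(A)$ the closed span of the eigenvectors, $\mathcal H_{\rm sc}(A)$ the orthogonal complement of $\mathcal H_{\rm ac}(A)\oplus\mathcal H_{\rm p}(A)$; let $A_{\rm ac},A_{\rm sc}$ be the reduced parts of $A$, and $\sigma_{\rm ac}(A)=\sigma(A_{\rm ac})$, $\sigma_{\rm sc}(A)=\sigma(A_{\rm sc})$. Let $\sigma_{\rm p}(A)$ be the set of eigenvalues and $\sigma_{\rm disc}(A)$ the set of eigenvalues of finite multiplicity that are isolated points of $\sigma(A)$. A *strong time operator* of $A$ is a symmetric (densely defined) operator $T$ such that, for all $t\in\mathbb R$, $e^{-itA}D(T)\subset D(T)$ and $Te^{-itA}\psi=e^{-itA}(T+t)\psi$ for $\psi\in D(T)$. $A$ belongs to the class $S_1(\mathcal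 H)$ if it is self-adjoint, $\sigma_{\rm sc}(A)=\emptyset$, $\sigma_{\rm ac}(A)=[0,\infty)$, $\sigma_{\rm disc}(A)=\sigma_{\rm p}(A)=\{E_n\}_{n\ge1}$ with $E_1<E_2<\cdots<0$ and $E_n\to0$, and $A_{\rm ac}$ has a strong time operator in $\mathcal H_{\rm ac}(A)$. An *ultra-weak time operator* of a self-adjoint operator $A$ is a sesquilinear form $\mathfrak t:\mathcal D_1\times\mathcal D_2\to\mathbb C$ (antilinear in the first variable; $\mathcal D_1,\mathcal D_2$ non-zero subspaces of $\mathcal H$) for which there are non-zero subspaces $\mathcal D,\mathcal E\subset\mathcal D_1\cap\mathcal D_2$ with $\mathcal E\subset D(A)\cap\mathcal D$, $\mathfrak t[\phi,\psi]^*=\mathfrak t[\psi,\phi]$ on $\mathcal D$, $A\mathcal E\subset\mathcal D_1$, and $\mathfrak t[A\phi,\psi]-\mathfrak t[A\psi,\phi]^*=-i(\phi,\psi)$ for all $\phi,\psi\in\mathcal E$. Then $\mathcal E$ is called an *ultra-weak CCR-domain*. **Theorem.** Let $d\in\mathbb N$, $m>0$, let $V:\mathbb R^d\to\mathbb R$ be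 Borel, and let $H_V=-\frac1{2m}\Delta+V$ in $L^2(\mathbb R^d)$ (operator sum of the generalized Laplacian and multiplication by $V$). Suppose that $H_V\in S_1(L^2(\mathbb R^d))$, and write $\sigma_{\rm disc}(H_V)=\{E_n\}_{n\ge1}$ as above. Let $f:\mathbb R\to\mathbb R$ be Borel measurable such that 1. there is a closed Lebesgue-null set $K\subset\mathbb R$ with $f\in C^2(\mathbb R\setminus K)$ such that $\{\lambda\in\mathbb R\setminus K: f'(\lambda)=0\}$ is Lebesgue-null; 2. $f$ is continuous at $0$; 3. $f(\sigma_{\rm disc}(H_V))$ is an infinite set, and each of its points has finite multiplicity as an eigenvalue of $f(H_V)$; 4. $f(E_n)\ne f(0)$ for all $n$, and $f(x)\ne f(0)$ for almost every $x\ge0$. Then $f(H_V)$ is self-adjoint and has an ultra-weak time operator with a dense ultra-weak CCR-domain. In particular, the same conclusion holds for (a) $e^{-\beta H_V}$ with $\beta\in\mathbb R\setminus\{0\}$; (b) $p(H_V)$ for every non-constant real polynomial $p$ with $p(E_n)\ne p(0)$ for all $n$; (c) $\sin(2\pi\beta H_V)$ with $\beta\in\mathbb R\setminus\{0\}$, $\beta\notin\{k/(2E_n):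 k\in\mathbb Z,\ n\ge1\}$. -/

import Mathlib

open MeasureTheory Filter Topology
open scoped ENNReal SchwartzMap Laplacian

noncomputable section

namespace TimeOp

section Abstract

variable {𝓗 : Type*} [NormedAddCommGroup 𝓗] [InnerProductSpace ℂ 𝓗]

/-! ### Projection-valued measures and the Borel functional calculus -/

/-- A projection-valued measure on the Borel sets of `ℝ`: every `proj B` is an orthogonal
projection, `proj ℝ = 1`, `proj (B ∩ C) = proj B ∘ proj C`, and `proj` is countably additive in the
strong operator topology. Sets that are not Borel get the value `0`. -/
structure ProjectionValuedMeasure (𝓗 : Type*) [NormedAddCommGroup 𝓗]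
    [InnerProductSpace ℂ 𝓗] where
  proj : Set ℝ → 𝓗 →L[ℂ] 𝓗
  symmetric : ∀ B, MeasurableSet B → ∀ φ ψ, inner ℂ (proj B φ) ψ = inner ℂ φ (proj B ψ)
  inter : ∀ B C, MeasurableSet B → MeasurableSet C → ∀ ψ, proj (B ∩ C) ψ = proj B (proj C ψ)
  univ : ∀ ψ, proj Set.univ ψ = ψ
  iUnion : ∀ B : ℕ → Set ℝ, (∀ n, MeasurableSet (B n)) → Pairwise (Function.onFun Disjoint B) →
    ∀ ψ, HasSum (fun n => proj (B n) ψ) (proj (⋃ n, B n) ψ)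
  notMeasurable : ∀ B, ¬ MeasurableSet B → proj B = 0

namespace ProjectionValuedMeasure

theorem norm_sq_eq (P : ProjectionValuedMeasure 𝓗) {B : Set ℝ} (hB : MeasurableSet B) (ψ : 𝓗) :
    ‖P.proj B ψ‖ ^ 2 = RCLike.re (inner ℂ ψ (P.proj B ψ)) := by
  rw [← P.symmetric B hB, ← inner_self_eq_norm_sq (𝕜 := ℂ)]
  rw [P.symmetric B hB, ← P.inter B B hB hB, Set.inter_self, P.symmetric B hB]

theorem proj_empty (P : ProjectionValuedMeasure 𝓗) (ψ : 𝓗) : P.proj ∅ ψ = 0 := by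
  have h := P.iUnion (fun _ => ∅) (fun _ => MeasurableSet.empty)
    (fun i j _ => by simp [Function.onFun]) ψ
  exact tendsto_nhds_unique tendsto_const_nhds h.summable.tendsto_atTop_zero

/-- The measure `μ_ψ(B) = ‖E(B) ψ‖²`. -/
def diagMeasure (P : ProjectionValuedMeasure 𝓗) (ψ : 𝓗) : Measure ℝ :=
  Measure.ofMeasurable (fun B _ => ENNReal.ofReal (‖P.proj B ψ‖ ^ 2))
    (by simp [P.proj_empty])
    (by
      intro B hB hd
      have hs : HasSum (fun n => ‖P.proj (B n) ψ‖ ^ 2) (‖P.proj (⋃ n, B n) ψ‖ ^ 2) := by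
        rw [P.norm_sq_eq (MeasurableSet.iUnion hB)]
        simp_rw [fun n => P.norm_sq_eq (hB n) ψ]
        exact (((P.iUnion B hB hd ψ).mapL (innerSL ℂ ψ))).mapL Complex.reCLM
      rw [← hs.tsum_eq, ENNReal.ofReal_tsum_of_nonneg (fun n => by positivity) hs.summable])

/-- `A = ∫ f(λ) dE(λ)`: the domain of `A` is `{ψ | ∫ |f|² dμ_ψ < ∞}`, and
`(ψ, A ψ) = ∫ f dμ_ψ` on it. By polarization these two clauses determine `A`. -/
def IsSpectralIntegral (P : ProjectionValuedMeasure 𝓗) (f : ℝ → ℂ) (A : 𝓗 →ₗ.[ℂ] 𝓗) : Prop :=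
  (∀ ψ : 𝓗, ψ ∈ A.domain ↔ ∫⁻ x, ‖f x‖ₑ ^ 2 ∂(P.diagMeasure ψ) < ∞) ∧
  ∀ ψ : A.domain, inner ℂ (ψ : 𝓗) (A ψ) = ∫ x, f x ∂(P.diagMeasure (ψ : 𝓗))

/-- The operator `∫ f(λ) dE(λ)`. -/
def spectralIntegral (P : ProjectionValuedMeasure 𝓗) (f : ℝ → ℂ) : 𝓗 →ₗ.[ℂ] 𝓗 :=
  Classical.epsilon (P.IsSpectralIntegral f)

open scoped Classical in
instance : Nonempty (ProjectionValuedMeasure 𝓗) :=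
  ⟨{ proj := fun B => if MeasurableSet B ∧ (0 : ℝ) ∈ B then 1 else 0
     symmetric := by intro B _ φ ψ; split_ifs <;> simp
     inter := by intro B C hB hC ψ; by_cases h : (0 : ℝ) ∈ B <;> by_cases h' : (0 : ℝ) ∈ C <;>
                  simp [hB, hC, hB.inter hC, h, h']
     univ := by simp
     iUnion := by
       intro B hB hd ψ
       by_cases h : ∃ n, (0 : ℝ) ∈ B n
       · obtain ⟨n, hn⟩ := h
         have h1 : MeasurableSet (⋃ n, B n) ∧ (0 : ℝ) ∈ ⋃ n, B n :=
           ⟨MeasurableSet.iUnion hB, Set.mem_iUnion.2 ⟨n, hn⟩⟩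
         rw [if_pos h1]
         have h2 : ∀ k, k ≠ n → (if MeasurableSet (B k) ∧ (0 : ℝ) ∈ B k then (1 : 𝓗 →L[ℂ] 𝓗)
             else 0) ψ = 0 := by
           intro k hk
           rw [if_neg (fun h => Set.disjoint_left.1 (hd hk) h.2 hn)]
           rfl
         have h3 := hasSum_single n h2
         rwa [if_pos ⟨hB n, hn⟩] at h3
       · have h1 : ¬ (MeasurableSet (⋃ n, B n) ∧ (0 : ℝ) ∈ ⋃ n, B n) :=
           fun h' => h (Set.mem_iUnion.1 h'.2)
         have h2 : ∀ k, (if MeasurableSet (B k) ∧ (0 : ℝ) ∈ B k then (1 : 𝓗 →L[ℂ] 𝓗)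
             else 0) ψ = 0 := by
           intro k
           rw [if_neg (fun h' => h ⟨k, h'.2⟩)]
           rfl
         rw [if_neg h1]
         simp only [h2]
         exact hasSum_zero
     notMeasurable := by intro B hB; simp [hB] }⟩

end ProjectionValuedMeasure

/-- The spectral measure `E_A` of a self-adjoint operator `A`: the projection-valued measure with
`A = ∫ λ dE_A(λ)`. -/
def spectralMeasure (A : 𝓗 →ₗ.[ℂ] 𝓗) : ProjectionValuedMeasure 𝓗 :=
  Classical.epsilon fun P => P.IsSpectralIntegral (fun x => (x : ℂ)) A

/-- `f(A)` for a self-adjoint operator `A` and a Borel function `f : ℝ → ℝ`. -/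
def borelCalculus (f : ℝ → ℝ) (A : 𝓗 →ₗ.[ℂ] 𝓗) : 𝓗 →ₗ.[ℂ] 𝓗 :=
  (spectralMeasure A).spectralIntegral fun x => (f x : ℂ)

/-- The unitary operator `e^{-itA} = ∫ e^{-itλ} dE_A(λ)` of a self-adjoint operator `A`. -/
def expNegI (A : 𝓗 →ₗ.[ℂ] 𝓗) (t : ℝ) : 𝓗 →L[ℂ] 𝓗 :=
  Classical.epsilon fun U : 𝓗 →L[ℂ] 𝓗 =>
    (spectralMeasure A).IsSpectralIntegral (fun x => Complex.exp (-(Complex.I * t * x)))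
      ((U : 𝓗 →ₗ[ℂ] 𝓗).toPMap ⊤)

/-! ### Spectra -/

/-- The resolvent set: `A - z` is a bijection from `D(A)` onto the space, with bounded inverse. -/
def resolventSet (A : 𝓗 →ₗ.[ℂ] 𝓗) : Set ℂ :=
  {z | ∃ R : 𝓗 →L[ℂ] 𝓗,
    (∀ ψ : 𝓗, ∃ h : R ψ ∈ A.domain, A ⟨R ψ, h⟩ - z • R ψ = ψ) ∧
    ∀ ψ : A.domain, R (A ψ - z • (ψ : 𝓗)) = ψ}

/-- The spectrum of a self-adjoint operator, as a subset of `ℝ`. -/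
def spec (A : 𝓗 →ₗ.[ℂ] 𝓗) : Set ℝ := {x | (x : ℂ) ∉ resolventSet A}

/-- `{ψ ∈ D(A) | A ψ = x ψ}`. -/
def eigenspace (A : 𝓗 →ₗ.[ℂ] 𝓗) (x : ℝ) : Submodule ℂ 𝓗 :=
  A.eqLocus (((x : ℂ) • LinearMap.id).toPMap ⊤)

/-- The set of all eigenvalues of a self-adjoint operator. -/
def pointSpectrum (A : 𝓗 →ₗ.[ℂ] 𝓗) : Set ℝ := {x | eigenspace A x ≠ ⊥}

/-- The set of all eigenvalues of finite multiplicity that are isolated points of the spectrum. -/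
def discreteSpectrum (A : 𝓗 →ₗ.[ℂ] 𝓗) : Set ℝ :=
  {x | x ∈ pointSpectrum A ∧ FiniteDimensional ℂ (eigenspace A x) ∧
    ∃ ε > 0, ∀ y ∈ spec A, |y - x| < ε → y = x}

/-- The part of `A` in a subspace `M` (for `M` reducing `A`, the reduced part of `A` to `M`). -/
def reducedPart (A : 𝓗 →ₗ.[ℂ] 𝓗) (M : Submodule ℂ 𝓗) : M →ₗ.[ℂ] M where
  domain :=
    { carrier := {ψ | ∃ h : (ψ : 𝓗) ∈ A.domain, A ⟨ψ, h⟩ ∈ M}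
      zero_mem' := ⟨A.domain.zero_mem, by
        have : (⟨((0 : M) : 𝓗), A.domain.zero_mem⟩ : A.domain) = 0 := rfl
        rw [this, A.map_zero]; exact M.zero_mem⟩
      add_mem' := by
        rintro φ ψ ⟨h, h'⟩ ⟨k, k'⟩
        refine ⟨A.domain.add_mem h k, ?_⟩
        have := A.map_add ⟨φ, h⟩ ⟨ψ, k⟩
        exact (congrArg (· ∈ M) this).mpr (M.add_mem h' k')
      smul_mem' := by
        rintro c ψ ⟨h, h'⟩
        refine ⟨A.domain.smul_mem c h, ?_⟩
        have := A.map_smul c ⟨ψ, h⟩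
        exact (congrArg (· ∈ M) this).mpr (M.smul_mem c h') }
  toFun :=
    { toFun := fun ψ => ⟨A ⟨(ψ : M), ψ.2.1⟩, ψ.2.2⟩
      map_add' := fun φ ψ => Subtype.ext (A.map_add ⟨(φ : M), φ.2.1⟩ ⟨(ψ : M), ψ.2.1⟩)
      map_smul' := fun c ψ => Subtype.ext (A.map_smul c ⟨(ψ : M), ψ.2.1⟩) }

/-- The subspace of absolute continuity `{ψ | μ_ψ ≪ Lebesgue measure}` of `A`
(recall `μ_ψ(B) = ‖E_A(B) ψ‖²`). -/
def acSubspace (A : 𝓗 →ₗ.[ℂ] 𝓗) : Submodule ℂ 𝓗 where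
  carrier := {ψ | ∀ B : Set ℝ, MeasurableSet B → volume B = 0 →
    (spectralMeasure A).proj B ψ = 0}
  zero_mem' := by intro B _ _; simp
  add_mem' := by intro φ ψ hφ hψ B hB h; simp [hφ B hB h, hψ B hB h]
  smul_mem' := by intro c ψ hψ B hB h; simp [hψ B hB h]

/-- The subspace of discontinuity of `A`: the closed span of the eigenvectors. -/
def ppSubspace (A : 𝓗 →ₗ.[ℂ] 𝓗) : Submodule ℂ 𝓗 :=
  (⨆ x : ℝ, eigenspace A x).topologicalClosure

/-- The subspace of singular continuity of `A`: the orthogonal complement of the two others. -/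
def scSubspace (A : 𝓗 →ₗ.[ℂ] 𝓗) : Submodule ℂ 𝓗 := (acSubspace A ⊔ ppSubspace A)ᗮ

/-! ### Time operators -/

/-- `T` is a strong time operator of the self-adjoint operator `A`: `T` is symmetric (in particular
densely defined), `e^{-itA} D(T) ⊆ D(T)`, and `T e^{-itA} ψ = e^{-itA} (T + t) ψ` for all
`ψ ∈ D(T)` and all real `t`. -/
structure IsStrongTimeOperator (A T : 𝓗 →ₗ.[ℂ] 𝓗) : Prop where
  dense : Dense (T.domain : Set 𝓗)
  symmetric : ∀ φ ψ : T.domain, inner ℂ (T φ) (ψ : 𝓗) = inner ℂ (φ : 𝓗) (T ψ)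
  mem : ∀ (t : ℝ) (ψ : T.domain), expNegI A t ψ ∈ T.domain
  weakWeyl : ∀ (t : ℝ) (ψ : T.domain),
    T ⟨expNegI A t ψ, mem t ψ⟩ = expNegI A t (T ψ + (t : ℂ) • (ψ : 𝓗))

/-- The sesquilinear form `t : D₁ × D₂ → ℂ` (antilinear in the first variable) is an ultra-weak
time operator of the self-adjoint operator `A`, with symmetric domain `D` and ultra-weak
CCR-domain `𝓔`: `t` is symmetric on `D`, `A 𝓔 ⊆ D₁`, and
`t[A φ, ψ] - t[A ψ, φ]* = -i (φ, ψ)` for `φ, ψ ∈ 𝓔`. -/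
structure IsUltraWeak (A : 𝓗 →ₗ.[ℂ] 𝓗) (D₁ D₂ : Submodule ℂ 𝓗)
    (t : D₁ →ₗ⋆[ℂ] D₂ →ₗ[ℂ] ℂ) (D 𝓔 : Submodule ℂ 𝓗) : Prop where
  D₁_ne : D₁ ≠ ⊥
  D₂_ne : D₂ ≠ ⊥
  D_ne : D ≠ ⊥
  𝓔_ne : 𝓔 ≠ ⊥
  D_le₁ : D ≤ D₁
  D_le₂ : D ≤ D₂
  𝓔_le : 𝓔 ≤ D
  𝓔_le_dom : 𝓔 ≤ A.domain
  symmetric : ∀ φ ψ : D,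
    star (t ⟨φ, D_le₁ φ.2⟩ ⟨ψ, D_le₂ ψ.2⟩) = t ⟨ψ, D_le₁ ψ.2⟩ ⟨φ, D_le₂ φ.2⟩
  map_mem : ∀ φ : 𝓔, A ⟨φ, 𝓔_le_dom φ.2⟩ ∈ D₁
  ccr : ∀ φ ψ : 𝓔,
    t ⟨A ⟨φ, 𝓔_le_dom φ.2⟩, map_mem φ⟩ ⟨ψ, D_le₂ (𝓔_le ψ.2)⟩
      - star (t ⟨A ⟨ψ, 𝓔_le_dom ψ.2⟩, map_mem ψ⟩ ⟨φ, D_le₂ (𝓔_le φ.2)⟩)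
      = -Complex.I * inner ℂ (φ : 𝓗) (ψ : 𝓗)

/-- `A` is a self-adjoint operator that has an ultra-weak time operator with a dense ultra-weak
CCR-domain. -/
def HasDenselyUltraWeakTimeOperator [CompleteSpace 𝓗] (A : 𝓗 →ₗ.[ℂ] 𝓗) : Prop :=
  IsSelfAdjoint A ∧
    ∃ (D₁ D₂ : Submodule ℂ 𝓗) (t : D₁ →ₗ⋆[ℂ] D₂ →ₗ[ℂ] ℂ) (D 𝓔 : Submodule ℂ 𝓗),
      IsUltraWeak A D₁ D₂ t D 𝓔 ∧ Dense (𝓔 : Set 𝓗)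

/-- The class `S₁(𝓗)` of self-adjoint operators. -/
structure ClassS₁ [CompleteSpace 𝓗] (A : 𝓗 →ₗ.[ℂ] 𝓗) : Prop where
  selfAdjoint : IsSelfAdjoint A
  sc : spec (reducedPart A (scSubspace A)) = ∅
  ac : spec (reducedPart A (acSubspace A)) = Set.Ici 0
  disc : ∃ E : ℕ → ℝ, StrictMono E ∧ (∀ n, E n < 0) ∧ Tendsto E atTop (𝓝 0) ∧
    discreteSpectrum A = Set.range E ∧ pointSpectrum A = Set.range E
  time : ∃ T : acSubspace A →ₗ.[ℂ] acSubspace A,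
    IsStrongTimeOperator (reducedPart A (acSubspace A)) T

end Abstract

/-! ### Schrödinger operators -/

/-- The Hilbert space `L²(ℝᵈ)`. -/
abbrev L2 (d : ℕ) : Type := Lp ℂ 2 (volume : Measure (EuclideanSpace ℝ (Fin d)))

/-- An `L²`-function as a tempered distribution. -/
def toDistr (d : ℕ) : L2 d →L[ℂ] 𝓢'(EuclideanSpace ℝ (Fin d), ℂ) :=
  Lp.toTemperedDistributionCLM ℂ volume 2

theorem toDistr_injective (d : ℕ) : Function.Injective (toDistr d) :=
  LinearMap.ker_eq_bot.1 Lp.ker_toTemperedDistributionCLM_eq_bot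

/-- The `ψ ∈ L²(ℝᵈ)` whose distributional Laplacian lies in `L²(ℝᵈ)`. -/
def laplacianDomain (d : ℕ) : Submodule ℂ (L2 d) where
  carrier := {ψ | ∃ η : L2 d, toDistr d η = Δ (toDistr d ψ)}
  zero_mem' := ⟨0, by simp [← TemperedDistribution.laplacianCLM_apply]⟩
  add_mem' := by
    rintro φ ψ ⟨η, hη⟩ ⟨ξ, hξ⟩
    exact ⟨η + ξ, by
      rw [← TemperedDistribution.laplacianCLM_apply] at *
      rw [map_add, map_add, map_add, hη, hξ]⟩
  smul_mem' := by
    rintro c ψ ⟨η, hη⟩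
    exact ⟨c • η, by
      rw [← TemperedDistribution.laplacianCLM_apply] at *
      rw [map_smul, map_smul, map_smul, hη]⟩

/-- The `L²`-function that represents the distributional Laplacian of `ψ`. -/
def laplacianFun {d : ℕ} (ψ : laplacianDomain d) : L2 d := Classical.choose ψ.2

theorem toDistr_laplacianFun {d : ℕ} (ψ : laplacianDomain d) :
    toDistr d (laplacianFun ψ) = LineDeriv.laplacianCLM ℂ (EuclideanSpace ℝ (Fin d))
        𝓢'(EuclideanSpace ℝ (Fin d), ℂ) (toDistr d ψ) := by
  rw [TemperedDistribution.laplacianCLM_apply]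
  exact Classical.choose_spec ψ.2

/-- The generalized Laplacian in `L²(ℝᵈ)`, on the domain of all `ψ ∈ L²(ℝᵈ)` whose distributional
Laplacian lies in `L²(ℝᵈ)`. -/
def laplacianOp (d : ℕ) : L2 d →ₗ.[ℂ] L2 d where
  domain := laplacianDomain d
  toFun :=
    { toFun := laplacianFun
      map_add' := fun φ ψ => toDistr_injective d (by
        rw [map_add, toDistr_laplacianFun, toDistr_laplacianFun, toDistr_laplacianFun,
          Submodule.coe_add, map_add, map_add])
      map_smul' := fun c ψ => toDistr_injective d (by
        rw [RingHom.id_apply, map_smul, toDistr_laplacianFun, toDistr_laplacianFun,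
          Submodule.coe_smul, map_smul, map_smul]) }

theorem mul_add_ae {d : ℕ} (V : EuclideanSpace ℝ (Fin d) → ℝ) (φ ψ : L2 d) :
    (fun x => (V x : ℂ) * (φ + ψ) x) =ᵐ[volume]
      (fun x => (V x : ℂ) * φ x) + fun x => (V x : ℂ) * ψ x := by
  filter_upwards [Lp.coeFn_add φ ψ] with x hx
  rw [hx]
  simp [mul_add]

theorem mul_smul_ae {d : ℕ} (V : EuclideanSpace ℝ (Fin d) → ℝ) (c : ℂ) (ψ : L2 d) :
    (fun x => (V x : ℂ) * (c • ψ) x) =ᵐ[volume] c • fun x => (V x : ℂ) * ψ x := by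
  filter_upwards [Lp.coeFn_smul c ψ] with x hx
  rw [hx]
  simp [mul_left_comm]

theorem mul_zero_ae {d : ℕ} (V : EuclideanSpace ℝ (Fin d) → ℝ) :
    (fun x => (V x : ℂ) * (0 : L2 d) x) =ᵐ[volume] 0 := by
  filter_upwards [Lp.coeFn_zero ℂ 2 (volume : Measure (EuclideanSpace ℝ (Fin d)))] with x hx
  rw [hx]
  simp

/-- `{ψ ∈ L² | V ψ ∈ L²}`. -/
def potentialDomain {d : ℕ} (V : EuclideanSpace ℝ (Fin d) → ℝ) : Submodule ℂ (L2 d) where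
  carrier := {ψ | MemLp (fun x => (V x : ℂ) * ψ x) 2 volume}
  zero_mem' := (memLp_congr_ae (mul_zero_ae V)).2 MemLp.zero
  add_mem' := fun {φ ψ} hφ hψ => (memLp_congr_ae (mul_add_ae V φ ψ)).2 (hφ.add hψ)
  smul_mem' := fun c ψ hψ => (memLp_congr_ae (mul_smul_ae V c ψ)).2 (hψ.const_smul c)

theorem memLp_of_mem {d : ℕ} (V : EuclideanSpace ℝ (Fin d) → ℝ) (ψ : potentialDomain V) :
    MemLp (fun x => (V x : ℂ) * (ψ : L2 d) x) 2 volume := ψ.2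

/-- Multiplication by `V` in `L²(ℝᵈ)`, with domain `{ψ ∈ L² | V ψ ∈ L²}`. -/
def potentialOp {d : ℕ} (V : EuclideanSpace ℝ (Fin d) → ℝ) : L2 d →ₗ.[ℂ] L2 d where
  domain := potentialDomain V
  toFun :=
    { toFun := fun ψ => (memLp_of_mem V ψ).toLp
      map_add' := fun φ ψ => by
        rw [← MemLp.toLp_add]
        exact MemLp.toLp_congr _ _ (mul_add_ae V φ ψ)
      map_smul' := fun c ψ => by
        rw [RingHom.id_apply, ← MemLp.toLp_const_smul]
        exact MemLp.toLp_congr _ _ (mul_smul_ae V c ψ) }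

/-- The Schrödinger operator `H_V = -(1/2m) Δ + V` in `L²(ℝᵈ)`, with domain `D(Δ) ∩ D(V)`. -/
def schrodinger {d : ℕ} (m : ℝ) (V : EuclideanSpace ℝ (Fin d) → ℝ) : L2 d →ₗ.[ℂ] L2 d :=
  (-(1 / (2 * (m : ℂ)))) • laplacianOp d + potentialOp V

end TimeOp

end

noncomputable section

/-! ### Abstract functional calculi and their extension to square-integrable functions. -/

section

namespace TimeOp

section Calculus

open scoped InnerProductSpace

variable {X 𝓗 : Type*} [MeasurableSpace X] [NormedAddCommGroup 𝓗] [InnerProductSpace ℂ 𝓗]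

/-! Let `A` be of class `S₁` with spectral measure `P`. Since the singular continuous part has empty
spectrum, its subspace is zero, and the space is the orthogonal sum of the absolutely continuous
subspace and the closed span of the eigenvectors. A form is built on each summand and the two are
added (`hasDenselyUltraWeakTimeOperator_of_sum`). Self-adjointness of `f(A)` holds for the integral
of any real Borel function (`isSelfAdjoint_operator`).

On the absolutely continuous part let `T` be the strong time operator. Fourier inversion turns the
weak Weyl relation into a weak form of `[T, h(A)] = i h'(A)` for C¹ functions `h` of compact support
(`inner_strongTimeOperator_int`). Hence `T*` acts on the vectors `h(A) χ`, with `χ ∈ D(T)` and `h`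
supported in the open set `U` where `f` is C² and `f' ≠ 0`. The complement of `U` is Lebesgue-null,
so these vectors span a dense subspace. There the symmetrisation of `(T* φ, f'(A)⁻¹ ψ)` satisfies
the commutation relation with `f(A)`: moving `f(A)` across `T*` produces `-i f'(A)`, and the weight
cancels `f'(A)` (`exists_form_of_strongTimeOperator`).

On the span of an orthonormal family of eigenvectors with eigenvalues `F a`, the matrix `i / (F a -
F b)` for `a ≠ b` satisfies the relation on finite combinations whose coefficients sum to zero,
provided the `F a` are distinct. As `f` may identify eigenvalues and eigenvalues may be degenerate,
the index set is split into infinite groups on each of which `F` is injective (`exists_grouping`),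
and the matrix is used inside each group. Combinations with vanishing sum over each group remain
dense, because by Bessel's inequality a vector cannot have a constant non-zero inner product with
infinitely many orthonormal vectors. Only a form on finite combinations is needed, so no convergence
question arises.

The operators are specified by choice, so the functional calculus is developed as well: the spectral
theorem comes from the continuous calculus of the normal operator `(A + i)⁻¹`
(`exists_isSpectralIntegral`), and uniqueness of the spectral measure (`eq_of_operator_eq`)
identifies the chosen objects. -/

theorem eLpNorm_two_sq {α E : Type*} [MeasurableSpace α] [NormedAddCommGroup E] (μ : Measure α)
    (f : α → E) : eLpNorm f 2 μ ^ 2 = ∫⁻ x, ‖f x‖ₑ ^ 2 ∂μ := by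
  have := eLpNorm_nnreal_pow_eq_lintegral (μ := μ) (f := f) (p := 2) (by norm_num)
  simp only [NNReal.coe_ofNat, ENNReal.coe_ofNat, ENNReal.rpow_ofNat] at this
  exact this

theorem eLpNorm_two_eq_iff {α β E F : Type*} [MeasurableSpace α] [MeasurableSpace β]
    [NormedAddCommGroup E] [NormedAddCommGroup F] {μ : Measure α} {ν : Measure β}
    {f : α → E} {g : β → F} :
    eLpNorm f 2 μ = eLpNorm g 2 ν ↔ ∫⁻ x, ‖f x‖ₑ ^ 2 ∂μ = ∫⁻ x, ‖g x‖ₑ ^ 2 ∂ν := by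
  rw [← eLpNorm_two_sq, ← eLpNorm_two_sq]
  exact ⟨fun h => by rw [h], fun h => ((ENNReal.pow_right_strictMono two_ne_zero).injective) h⟩

theorem memLp_two_iff_lintegral {α E : Type*} [MeasurableSpace α] [NormedAddCommGroup E]
    {μ : Measure α} {f : α → E} (hf : AEStronglyMeasurable f μ) :
    MemLp f 2 μ ↔ ∫⁻ x, ‖f x‖ₑ ^ 2 ∂μ < ∞ := by
  rw [← eLpNorm_two_sq, MemLp]
  simp [hf]

theorem memLp_two_add_measure {α E : Type*} [MeasurableSpace α] [NormedAddCommGroup E]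
    {μ ν : Measure α} {f : α → E} (h : MemLp f 2 μ) (h' : MemLp f 2 ν) : MemLp f 2 (μ + ν) := by
  have hm := h.1.add_measure h'.1
  rw [memLp_two_iff_lintegral hm, lintegral_add_measure]
  exact ENNReal.add_lt_top.2 ⟨(memLp_two_iff_lintegral h.1).1 h, (memLp_two_iff_lintegral h'.1).1 h'⟩

theorem tendsto_eLpNorm_of_tendsto_sub {α E : Type*} [MeasurableSpace α] [NormedAddCommGroup E]
    {μ : Measure α} {f : α → E} {u : ℕ → α → E} (hf : MemLp f 2 μ)
    (hu : ∀ n, AEStronglyMeasurable (u n) μ)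
    (h : Tendsto (fun n => eLpNorm (f - u n) 2 μ) atTop (𝓝 0)) :
    Tendsto (fun n => eLpNorm (u n) 2 μ) atTop (𝓝 (eLpNorm f 2 μ)) := by
  have h12 : (1 : ℝ≥0∞) ≤ 2 := by norm_num
  refine tendsto_of_tendsto_of_tendsto_of_le_of_le
    (g := fun n => eLpNorm f 2 μ - eLpNorm (f - u n) 2 μ)
    (h := fun n => eLpNorm f 2 μ + eLpNorm (f - u n) 2 μ) ?_ ?_ ?_ ?_
  · simpa using ENNReal.Tendsto.sub tendsto_const_nhds h (Or.inl hf.2.ne)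
  · simpa using tendsto_const_nhds.add h
  · intro n
    refine tsub_le_iff_right.2 ?_
    calc eLpNorm f 2 μ = eLpNorm (u n + (f - u n)) 2 μ := by congr 1; abel
      _ ≤ _ := eLpNorm_add_le (hu n) (hf.1.sub (hu n)) h12
  · intro n
    calc eLpNorm (u n) 2 μ = eLpNorm (f - (f - u n)) 2 μ := by congr 1; abel
      _ ≤ _ := eLpNorm_sub_le hf.1 (hf.1.sub (hu n)) h12

variable {rel : (X → ℂ) → (𝓗 →L[ℂ] 𝓗) → Prop} {μ : 𝓗 → Measure X}

/-- The vector `f(A) ψ`, for `f` square integrable with respect to the spectral measure of `ψ`. -/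
def calcInt (rel : (X → ℂ) → (𝓗 →L[ℂ] 𝓗) → Prop) (μ : 𝓗 → Measure X) (f : X → ℂ) (ψ : 𝓗) : 𝓗 :=
  -- When the functions `h` are dense in `L²(μ ψ)`, these distances determine `v`.
  Classical.epsilon fun v => ∀ h T, rel h T → ‖v - T ψ‖ₑ = eLpNorm (f - h) 2 (μ ψ)

theorem calcInt_congr {f g : X → ℂ} {ψ : 𝓗} (h : f =ᵐ[μ ψ] g) :
    calcInt rel μ f ψ = calcInt rel μ g ψ := by
  unfold calcInt
  congr 1
  ext v
  have : ∀ k : X → ℂ, eLpNorm (f - k) 2 (μ ψ) = eLpNorm (g - k) 2 (μ ψ) := fun k =>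
    eLpNorm_congr_ae (h.sub (ae_eq_refl k))
  simp only [this]

variable [CompleteSpace 𝓗]

/-- `rel h T` says that the bounded operator `T` is the value at the bounded function `h` of a
calculus whose spectral measures are `μ ψ`. -/
structure IsCalculus (rel : (X → ℂ) → (𝓗 →L[ℂ] 𝓗) → Prop) (μ : 𝓗 → Measure X) : Prop where
  finite : ∀ ψ, IsFiniteMeasure (μ ψ)
  meas : ∀ {h T}, rel h T → Measurable h
  bdd : ∀ {h T}, rel h T → ∃ C : ℝ, ∀ x, ‖h x‖ ≤ C
  add : ∀ {h T k S}, rel h T → rel k S → rel (h + k) (T + S)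
  smul : ∀ (c : ℂ) {h T}, rel h T → rel (c • h) (c • T)
  mul : ∀ {h T k S}, rel h T → rel k S → rel (h * k) (T * S)
  adj : ∀ {h T}, rel h T → rel (star h) (star T)
  inner : ∀ {h T}, rel h T → ∀ ψ : 𝓗, ⟪ψ, T ψ⟫_ℂ = ∫ x, h x ∂(μ ψ)
  -- Density is asked for every finite measure, so that one sequence can approximate `f` for the
  -- spectral measures of several vectors at once.
  dense : ∀ (ν : Measure X) [IsFiniteMeasure ν] (f : X → ℂ), MemLp f 2 ν → ∀ ε : ℝ≥0∞, ε ≠ 0 →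
    ∃ h T, rel h T ∧ eLpNorm (f - h) 2 ν ≤ ε

namespace IsCalculus

theorem sub (c : IsCalculus rel μ) {h k : X → ℂ} {T S : 𝓗 →L[ℂ] 𝓗} (hT : rel h T) (hS : rel k S) :
    rel (h - k) (T - S) := by
  have := c.add hT (c.smul (-1) hS)
  simpa [sub_eq_add_neg] using this

theorem exists_rel (c : IsCalculus rel μ) : ∃ h T, rel h T := by
  obtain ⟨h, T, hT, -⟩ := c.dense (0 : Measure X) 0 MemLp.zero 1 one_ne_zero
  exact ⟨h, T, hT⟩

theorem zero (c : IsCalculus rel μ) : rel 0 0 := by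
  obtain ⟨h, T, hT⟩ := c.exists_rel
  simpa using c.smul 0 hT

theorem memLp (c : IsCalculus rel μ) {h : X → ℂ} {T : 𝓗 →L[ℂ] 𝓗} (hT : rel h T) (ν : Measure X)
    [IsFiniteMeasure ν] (p : ℝ≥0∞) : MemLp h p ν := by
  obtain ⟨C, hC⟩ := c.bdd hT
  exact MemLp.of_bound (c.meas hT).aestronglyMeasurable C (ae_of_all _ hC)

/-- `T* T` is the value of the calculus at `|h|²`. -/
theorem enorm_apply (c : IsCalculus rel μ) {h : X → ℂ} {T : 𝓗 →L[ℂ] 𝓗} (hT : rel h T) (ψ : 𝓗) :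
    ‖T ψ‖ₑ = eLpNorm h 2 (μ ψ) := by
  have := c.finite ψ
  have h1 := c.inner (c.mul (c.adj hT) hT) ψ
  have h2 : ⟪ψ, (star T * T) ψ⟫_ℂ = ((‖T ψ‖ ^ 2 : ℝ) : ℂ) := by
    rw [mul_apply_eq_comp, ContinuousLinearMap.star_eq_adjoint,
      ContinuousLinearMap.adjoint_inner_right, inner_self_eq_norm_sq_to_K]
    norm_cast
  have h3 : ∫ x, (star h * h) x ∂(μ ψ) = ((∫ x, ‖h x‖ ^ 2 ∂(μ ψ) : ℝ) : ℂ) := by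
    rw [← integral_complex_ofReal]
    congr 1
    ext x
    have := RCLike.conj_mul (h x)
    simpa using this
  rw [h2, h3] at h1
  have h4 : ‖T ψ‖ ^ 2 = ∫ x, ‖h x‖ ^ 2 ∂(μ ψ) := by exact_mod_cast h1
  refine (ENNReal.pow_right_strictMono two_ne_zero).injective ?_
  rw [eLpNorm_two_sq, ← ofReal_norm, ← ENNReal.ofReal_pow (norm_nonneg _), h4,
    ofReal_integral_eq_lintegral_ofReal]
  · simp [ENNReal.ofReal_pow]
  · exact (c.memLp hT (μ ψ) 2).integrable_norm_pow two_ne_zero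
  · exact ae_of_all _ fun x => by positivity

theorem exists_seq (c : IsCalculus rel μ) (ν : Measure X) [IsFiniteMeasure ν] {f : X → ℂ}
    (hf : MemLp f 2 ν) : ∃ (h : ℕ → X → ℂ) (T : ℕ → 𝓗 →L[ℂ] 𝓗), (∀ n, rel (h n) (T n)) ∧
      Tendsto (fun n => eLpNorm (f - h n) 2 ν) atTop (𝓝 0) := by
  have : ∀ n : ℕ, ∃ h T, rel h T ∧ eLpNorm (f - h) 2 ν ≤ ((n : ℝ≥0∞) + 1)⁻¹ := fun n =>
    c.dense ν f hf _ (by simp)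
  choose h T hT hn using this
  refine ⟨h, T, hT, tendsto_of_tendsto_of_tendsto_of_le_of_le tendsto_const_nhds ?_
    (fun n => zero_le) hn⟩
  have := (tendsto_add_atTop_iff_nat 1).2 ENNReal.tendsto_inv_nat_nhds_zero
  simpa using this

/-- By `enorm_apply`, `h ↦ T ψ` is an isometry on a dense part of `L²(μ ψ)`; completeness extends
it. -/
theorem exists_calcInt (c : IsCalculus rel μ) {f : X → ℂ} {ψ : 𝓗} (hf : MemLp f 2 (μ ψ)) :
    ∃ v : 𝓗, ∀ h T, rel h T → ‖v - T ψ‖ₑ = eLpNorm (f - h) 2 (μ ψ) := by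
  have := c.finite ψ
  have h12 : (1 : ℝ≥0∞) ≤ 2 := by norm_num
  obtain ⟨h, T, hT, hn⟩ := c.exists_seq (μ ψ) hf
  have hmem := fun n => c.memLp (hT n) (μ ψ) 2
  have hC : CauchySeq fun n => T n ψ := by
    refine EMetric.cauchySeq_iff.2 fun ε hε => ?_
    have h2 : ∀ᶠ n in atTop, eLpNorm (f - h n) 2 (μ ψ) < ε / 2 :=
      hn.eventually_lt_const (ENNReal.half_pos hε.ne')
    obtain ⟨N, hN⟩ := eventually_atTop.1 h2
    refine ⟨N, fun m hm n hn => ?_⟩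
    rw [edist_eq_enorm_sub, ← sub_apply, c.enorm_apply (c.sub (hT m) (hT n))]
    calc eLpNorm (h m - h n) 2 (μ ψ) = eLpNorm ((f - h n) - (f - h m)) 2 (μ ψ) := by
          congr 1; abel
      _ ≤ eLpNorm (f - h n) 2 (μ ψ) + eLpNorm (f - h m) 2 (μ ψ) :=
          eLpNorm_sub_le (hf.sub (hmem n)).1 (hf.sub (hmem m)).1 h12
      _ < ε / 2 + ε / 2 := ENNReal.add_lt_add (hN n hn) (hN m hm)
      _ = ε := ENNReal.add_halves ε
  obtain ⟨v, hv⟩ := cauchySeq_tendsto_of_complete hC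
  refine ⟨v, fun k S hS => ?_⟩
  have l1 : Tendsto (fun n => ‖T n ψ - S ψ‖ₑ) atTop (𝓝 ‖v - S ψ‖ₑ) :=
    (hv.sub_const _).enorm
  have l2 : Tendsto (fun n => eLpNorm (h n - k) 2 (μ ψ)) atTop (𝓝 (eLpNorm (f - k) 2 (μ ψ))) := by
    refine tendsto_eLpNorm_of_tendsto_sub (hf.sub (c.memLp hS (μ ψ) 2))
      (fun n => ((hmem n).sub (c.memLp hS (μ ψ) 2)).1) ?_
    simpa using hn
  refine tendsto_nhds_unique l1 (l2.congr fun n => ?_)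
  rw [← sub_apply, c.enorm_apply (c.sub (hT n) hS)]

theorem enorm_calcInt_sub (c : IsCalculus rel μ) {f : X → ℂ} {ψ : 𝓗} (hf : MemLp f 2 (μ ψ))
    {h : X → ℂ} {T : 𝓗 →L[ℂ] 𝓗} (hT : rel h T) :
    ‖calcInt rel μ f ψ - T ψ‖ₑ = eLpNorm (f - h) 2 (μ ψ) :=
  Classical.epsilon_spec (c.exists_calcInt hf) h T hT

theorem enorm_calcInt (c : IsCalculus rel μ) {f : X → ℂ} {ψ : 𝓗} (hf : MemLp f 2 (μ ψ)) :
    ‖calcInt rel μ f ψ‖ₑ = eLpNorm f 2 (μ ψ) := by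
  simpa using c.enorm_calcInt_sub hf c.zero

theorem tendsto_calcInt (c : IsCalculus rel μ) {f : X → ℂ} {ψ : 𝓗} (hf : MemLp f 2 (μ ψ))
    {h : ℕ → X → ℂ} {T : ℕ → 𝓗 →L[ℂ] 𝓗} (hT : ∀ n, rel (h n) (T n))
    (hn : Tendsto (fun n => eLpNorm (f - h n) 2 (μ ψ)) atTop (𝓝 0)) :
    Tendsto (fun n => T n ψ) atTop (𝓝 (calcInt rel μ f ψ)) := by
  rw [tendsto_iff_edist_tendsto_0]
  refine hn.congr fun n => ?_
  rw [edist_comm, edist_eq_enorm_sub, c.enorm_calcInt_sub hf (hT n)]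

theorem calcInt_rel (c : IsCalculus rel μ) {h : X → ℂ} {T : 𝓗 →L[ℂ] 𝓗} (hT : rel h T) (ψ : 𝓗) :
    calcInt rel μ h ψ = T ψ := by
  have := c.finite ψ
  have := c.enorm_calcInt_sub (c.memLp hT (μ ψ) 2) hT
  simpa [sub_eq_zero] using this

theorem tendsto_eLpNorm_mono {f : X → ℂ} {h : ℕ → X → ℂ} {ν ν' : Measure X} (hν : ν' ≤ ν)
    (hn : Tendsto (fun n => eLpNorm (f - h n) 2 ν) atTop (𝓝 0)) :
    Tendsto (fun n => eLpNorm (f - h n) 2 ν') atTop (𝓝 0) :=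
  tendsto_of_tendsto_of_tendsto_of_le_of_le tendsto_const_nhds hn (fun _ => zero_le)
    fun _ => eLpNorm_mono_measure _ hν

theorem calcInt_add (c : IsCalculus rel μ) {f g : X → ℂ} {ψ : 𝓗} (hf : MemLp f 2 (μ ψ))
    (hg : MemLp g 2 (μ ψ)) :
    calcInt rel μ (f + g) ψ = calcInt rel μ f ψ + calcInt rel μ g ψ := by
  have := c.finite ψ
  obtain ⟨h, T, hT, hn⟩ := c.exists_seq (μ ψ) hf
  obtain ⟨k, S, hS, hm⟩ := c.exists_seq (μ ψ) hg
  have l1 := c.tendsto_calcInt hf hT hn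
  have l2 := c.tendsto_calcInt hg hS hm
  refine tendsto_nhds_unique (c.tendsto_calcInt (hf.add hg) (fun n => c.add (hT n) (hS n)) ?_)
    (l1.add l2)
  refine tendsto_of_tendsto_of_tendsto_of_le_of_le tendsto_const_nhds
    (by simpa using hn.add hm) (fun _ => zero_le) fun n => ?_
  calc eLpNorm (f + g - (h n + k n)) 2 (μ ψ) = eLpNorm ((f - h n) + (g - k n)) 2 (μ ψ) := by
        congr 1; abel
    _ ≤ _ := eLpNorm_add_le (hf.sub (c.memLp (hT n) (μ ψ) 2)).1 (hg.sub (c.memLp (hS n) (μ ψ) 2)).1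
        (by norm_num)

theorem calcInt_smul (c : IsCalculus rel μ) (a : ℂ) {f : X → ℂ} {ψ : 𝓗} (hf : MemLp f 2 (μ ψ)) :
    calcInt rel μ (a • f) ψ = a • calcInt rel μ f ψ := by
  have := c.finite ψ
  obtain ⟨h, T, hT, hn⟩ := c.exists_seq (μ ψ) hf
  refine tendsto_nhds_unique (c.tendsto_calcInt (hf.const_smul a) (fun n => c.smul a (hT n)) ?_)
    ((c.tendsto_calcInt hf hT hn).const_smul a)
  have : Tendsto (fun n => ‖a‖ₑ * eLpNorm (f - h n) 2 (μ ψ)) atTop (𝓝 0) := by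
    simpa using ENNReal.Tendsto.const_mul hn (Or.inr (by simp))
  refine this.congr fun n => ?_
  rw [← smul_sub, eLpNorm_const_smul]

theorem calcInt_sub (c : IsCalculus rel μ) {f g : X → ℂ} {ψ : 𝓗} (hf : MemLp f 2 (μ ψ))
    (hg : MemLp g 2 (μ ψ)) :
    calcInt rel μ (f - g) ψ = calcInt rel μ f ψ - calcInt rel μ g ψ := by
  have := c.calcInt_add hf (hg.const_smul (-1 : ℂ))
  rw [c.calcInt_smul _ hg] at this
  simpa [sub_eq_add_neg] using this

/-- A sequence approximating `f` in `L²` of the sum of the three spectral measures approximates it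
for each of them. -/
theorem calcInt_vadd (c : IsCalculus rel μ) {f : X → ℂ} {φ ψ : 𝓗} (hφ : MemLp f 2 (μ φ))
    (hψ : MemLp f 2 (μ ψ)) (h' : MemLp f 2 (μ (φ + ψ))) :
    calcInt rel μ f (φ + ψ) = calcInt rel μ f φ + calcInt rel μ f ψ := by
  have := c.finite ψ
  have := c.finite φ
  have := c.finite (φ + ψ)
  obtain ⟨h, T, hT, hn⟩ := c.exists_seq (μ φ + μ ψ + μ (φ + ψ))
    (memLp_two_add_measure (memLp_two_add_measure hφ hψ) h')
  have l1 := c.tendsto_calcInt hφ hT (tendsto_eLpNorm_mono (by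
    rw [add_assoc]; exact Measure.le_add_right le_rfl) hn)
  have l2 := c.tendsto_calcInt hψ hT (tendsto_eLpNorm_mono (by
    rw [add_assoc]; exact Measure.le_add_left (Measure.le_add_right le_rfl)) hn)
  have l3 := c.tendsto_calcInt h' hT (tendsto_eLpNorm_mono (Measure.le_add_left le_rfl) hn)
  refine tendsto_nhds_unique l3 ((l1.add l2).congr fun n => ?_)
  rw [map_add]

theorem calcInt_vsmul (c : IsCalculus rel μ) {f : X → ℂ} {ψ : 𝓗} (a : ℂ)
    (hψ : MemLp f 2 (μ ψ)) (h' : MemLp f 2 (μ (a • ψ))) :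
    calcInt rel μ f (a • ψ) = a • calcInt rel μ f ψ := by
  have := c.finite ψ
  have := c.finite (a • ψ)
  obtain ⟨h, T, hT, hn⟩ := c.exists_seq (μ ψ + μ (a • ψ)) (memLp_two_add_measure hψ h')
  have l2 := c.tendsto_calcInt hψ hT (tendsto_eLpNorm_mono (Measure.le_add_right le_rfl) hn)
  have l3 := c.tendsto_calcInt h' hT (tendsto_eLpNorm_mono (Measure.le_add_left le_rfl) hn)
  refine tendsto_nhds_unique l3 ((l2.const_smul a).congr fun n => ?_)
  rw [map_smul]

theorem inner_calcInt_left (c : IsCalculus rel μ) {f : X → ℂ} {φ ψ : 𝓗} (hφ : MemLp f 2 (μ φ))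
    (hψ : MemLp f 2 (μ ψ)) :
    ⟪calcInt rel μ f φ, ψ⟫_ℂ = ⟪φ, calcInt rel μ (star f) ψ⟫_ℂ := by
  have := c.finite ψ
  have := c.finite φ
  obtain ⟨h, T, hT, hn⟩ := c.exists_seq (μ φ + μ ψ) (memLp_two_add_measure hφ hψ)
  have l1 := c.tendsto_calcInt hφ hT (tendsto_eLpNorm_mono (Measure.le_add_right le_rfl) hn)
  have l2 := c.tendsto_calcInt hψ.star (fun n => c.adj (hT n)) (by
    refine (tendsto_eLpNorm_mono (ν' := μ ψ) (Measure.le_add_left le_rfl) hn).congr fun n => ?_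
    rw [← star_sub]
    exact eLpNorm_congr_norm_ae (ae_of_all _ fun x => (norm_star ((f - h n) x)).symm))
  refine tendsto_nhds_unique (l1.inner tendsto_const_nhds)
    ((tendsto_const_nhds.inner l2).congr fun n => ?_)
  rw [ContinuousLinearMap.star_eq_adjoint, ContinuousLinearMap.adjoint_inner_right]

theorem inner_calcInt_self (c : IsCalculus rel μ) {f : X → ℂ} {ψ : 𝓗} (hψ : MemLp f 2 (μ ψ)) :
    ⟪ψ, calcInt rel μ f ψ⟫_ℂ = ∫ x, f x ∂(μ ψ) := by
  have := c.finite ψ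
  obtain ⟨h, T, hT, hn⟩ := c.exists_seq (μ ψ) hψ
  have l1 := c.tendsto_calcInt hψ hT hn
  refine tendsto_nhds_unique (tendsto_const_nhds.inner l1) ?_
  simp only [fun n => c.inner (hT n) ψ]
  have hmem := fun n => c.memLp (hT n) (μ ψ) 2
  refine tendsto_integral_of_L1' f hψ.1
    (Eventually.of_forall fun n => (hmem n).integrable (by norm_num)) ?_
  have : Tendsto (fun n => eLpNorm (f - h n) 2 (μ ψ) * (μ ψ Set.univ) ^ (1 / 2 : ℝ)) atTop (𝓝 0) := by
    simpa using ENNReal.Tendsto.mul_const hn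
      (Or.inr (ENNReal.rpow_ne_top_of_nonneg (by norm_num) (measure_ne_top (μ ψ) Set.univ)))
  refine tendsto_of_tendsto_of_tendsto_of_le_of_le tendsto_const_nhds this (fun _ => zero_le)
    fun n => ?_
  have h1 := eLpNorm_le_eLpNorm_mul_rpow_measure_univ (p := 1) (q := 2) (by norm_num)
    (hψ.sub (hmem n)).1
  rw [← neg_sub, eLpNorm_neg]
  refine h1.trans_eq ?_
  norm_num

theorem memLp_mul (c : IsCalculus rel μ) {h f : X → ℂ} {T : 𝓗 →L[ℂ] 𝓗} (hT : rel h T)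
    {ν : Measure X} (hf : MemLp f 2 ν) : MemLp (h * f) 2 ν := by
  obtain ⟨C, hC⟩ := c.bdd hT
  refine MemLp.of_le_mul (c := C) hf ((c.meas hT).aestronglyMeasurable.mul hf.1)
    (ae_of_all _ fun x => ?_)
  rw [Pi.mul_apply, norm_mul]
  exact mul_le_mul_of_nonneg_right (hC x) (norm_nonneg _)

theorem apply_calcInt (c : IsCalculus rel μ) {h f : X → ℂ} {T : 𝓗 →L[ℂ] 𝓗} (hT : rel h T) {ψ : 𝓗}
    (hf : MemLp f 2 (μ ψ)) : T (calcInt rel μ f ψ) = calcInt rel μ (h * f) ψ := by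
  have := c.finite ψ
  obtain ⟨k, S, hS, hn⟩ := c.exists_seq (μ ψ) hf
  have l1 := (T.continuous.tendsto _).comp (c.tendsto_calcInt hf hS hn)
  refine tendsto_nhds_unique l1
    (c.tendsto_calcInt (c.memLp_mul hT hf) (fun n => c.mul hT (hS n)) ?_)
  obtain ⟨C, hC⟩ := c.bdd hT
  have : Tendsto (fun n => ENNReal.ofReal C * eLpNorm (f - k n) 2 (μ ψ)) atTop (𝓝 0) := by
    simpa using ENNReal.Tendsto.const_mul hn (Or.inr (by simp))
  refine tendsto_of_tendsto_of_tendsto_of_le_of_le tendsto_const_nhds this (fun _ => zero_le)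
    fun n => ?_
  refine eLpNorm_le_mul_eLpNorm_of_ae_le_mul (ae_of_all _ fun x => ?_) 2
  rw [← mul_sub, Pi.mul_apply, norm_mul]
  exact mul_le_mul_of_nonneg_right (hC x) (norm_nonneg _)

/-- Indicator functions are limits of functions of the calculus in `L²(ν + ν')`, and the norms pass
to the limit. -/
theorem eLpNorm_eq_of_rel (c : IsCalculus rel μ) {ν ν' : Measure X} [IsFiniteMeasure ν]
    [IsFiniteMeasure ν'] (H : ∀ h T, rel h T → eLpNorm h 2 ν = eLpNorm h 2 ν') : ν = ν' := by
  ext B hB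
  have h1 : MemLp (B.indicator fun _ => (1 : ℂ)) 2 (ν + ν') :=
    (memLp_const 1).indicator hB
  obtain ⟨k, S, hS, hn⟩ := c.exists_seq (ν + ν') h1
  have l1 := tendsto_eLpNorm_of_tendsto_sub (h1.left_of_add_measure)
    (fun n => (c.meas (hS n)).aestronglyMeasurable)
    (tendsto_eLpNorm_mono (Measure.le_add_right le_rfl) hn)
  have l2 := tendsto_eLpNorm_of_tendsto_sub (h1.right_of_add_measure)
    (fun n => (c.meas (hS n)).aestronglyMeasurable)
    (tendsto_eLpNorm_mono (Measure.le_add_left le_rfl) hn)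
  have l3 := tendsto_nhds_unique l1 (l2.congr fun n => (H _ _ (hS n)).symm)
  rw [eLpNorm_two_eq_iff] at l3
  have h2 : ∀ x, ‖B.indicator (fun _ => (1 : ℂ)) x‖ₑ ^ 2 = B.indicator 1 x := fun x => by
    by_cases hx : x ∈ B <;> simp [hx]
  simpa only [h2, lintegral_indicator_one hB] using l3

/-- Under both measures the squared norm of a function `h` of the calculus is the integral of `|h
f|²` against `μ ψ`. -/
theorem measure_calcInt (c : IsCalculus rel μ) {f : X → ℂ} {ψ : 𝓗} (hm : Measurable f)
    (hf : MemLp f 2 (μ ψ)) :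
    μ (calcInt rel μ f ψ) = (μ ψ).withDensity fun x => ‖f x‖ₑ ^ 2 := by
  have := c.finite ψ
  have := c.finite (calcInt rel μ f ψ)
  have : IsFiniteMeasure ((μ ψ).withDensity fun x => ‖f x‖ₑ ^ 2) :=
    isFiniteMeasure_withDensity ((memLp_two_iff_lintegral hf.1).1 hf).ne
  refine c.eLpNorm_eq_of_rel fun h T hT => ?_
  rw [← c.enorm_apply hT, c.apply_calcInt hT hf, c.enorm_calcInt (c.memLp_mul hT hf),
    eLpNorm_two_eq_iff, lintegral_withDensity_eq_lintegral_mul _ (by fun_prop)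
      (by have := c.meas hT; fun_prop)]
  simp [mul_pow, mul_comm]

theorem lintegral_measure_calcInt (c : IsCalculus rel μ) {f g : X → ℂ} {ψ : 𝓗} (hm : Measurable f)
    (hf : MemLp f 2 (μ ψ)) (hg : Measurable g) :
    ∫⁻ x, ‖g x‖ₑ ^ 2 ∂(μ (calcInt rel μ f ψ)) = ∫⁻ x, ‖(g * f) x‖ₑ ^ 2 ∂(μ ψ) := by
  rw [c.measure_calcInt hm hf, lintegral_withDensity_eq_lintegral_mul _ (by fun_prop) (by fun_prop)]
  simp [mul_pow, mul_comm]

theorem memLp_calcInt_iff (c : IsCalculus rel μ) {f g : X → ℂ} {ψ : 𝓗} (hm : Measurable f)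
    (hf : MemLp f 2 (μ ψ)) (hg : Measurable g) :
    MemLp g 2 (μ (calcInt rel μ f ψ)) ↔ MemLp (g * f) 2 (μ ψ) := by
  rw [memLp_two_iff_lintegral hg.aestronglyMeasurable,
    memLp_two_iff_lintegral (hg.mul hm).aestronglyMeasurable, c.lintegral_measure_calcInt hm hf hg]

/-- Approximate `g` with respect to the measure of `f(A) ψ`. By `measure_calcInt`, multiplying by
`f` gives an approximation of `g f` in `L²(μ ψ)` with the same errors. -/
theorem calcInt_calcInt (c : IsCalculus rel μ) {f g : X → ℂ} {ψ : 𝓗} (hm : Measurable f)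
    (hf : MemLp f 2 (μ ψ)) (hg : Measurable g) (hgf : MemLp (g * f) 2 (μ ψ)) :
    calcInt rel μ g (calcInt rel μ f ψ) = calcInt rel μ (g * f) ψ := by
  have := c.finite (calcInt rel μ f ψ)
  have hg' := (c.memLp_calcInt_iff hm hf hg).2 hgf
  obtain ⟨k, S, hS, hn⟩ := c.exists_seq (μ (calcInt rel μ f ψ)) hg'
  refine tendsto_nhds_unique (c.tendsto_calcInt hg' hS hn) ?_
  simp only [fun n => c.apply_calcInt (hS n) hf]
  rw [tendsto_iff_edist_tendsto_0]
  refine hn.congr fun n => ?_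
  rw [edist_comm, edist_eq_enorm_sub, ← c.calcInt_sub hgf (c.memLp_mul (hS n) hf),
    c.enorm_calcInt (hgf.sub (c.memLp_mul (hS n) hf)), eLpNorm_two_eq_iff,
    c.lintegral_measure_calcInt hm hf (hg.sub (c.meas (hS n))), sub_mul]

end IsCalculus

end Calculus

end TimeOp

end

/-! ### Integrals with respect to a projection-valued measure. -/

section

namespace TimeOp

open scoped InnerProductSpace

variable {𝓗 : Type*} [NormedAddCommGroup 𝓗] [InnerProductSpace ℂ 𝓗]

/-- Complex polarization: the values at `φ + ψ` and `φ + iψ` make the off-diagonal terms vanish, and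
the range of `J` is dense. -/
theorem eq_zero_of_quadratic_form {E : Type*} [AddCommGroup E] [Module ℂ E] (J N : E →ₗ[ℂ] 𝓗)
    (hJ : Dense (Set.range J)) (h : ∀ ψ, ⟪J ψ, N ψ⟫_ℂ = 0) (ψ : E) : N ψ = 0 := by
  have key : ∀ φ ψ : E, ⟪J φ, N ψ⟫_ℂ = 0 := by
    intro φ ψ
    have h1 := h (φ + ψ)
    have h2 := h (φ + Complex.I • ψ)
    simp only [map_add, map_smul, inner_add_left, inner_add_right, inner_smul_left,
      inner_smul_right, h, Complex.conj_I, mul_zero, zero_add, add_zero] at h1 h2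
    have h3 : ⟪J ψ, N φ⟫_ℂ = -⟪J φ, N ψ⟫_ℂ := eq_neg_of_add_eq_zero_left h1
    rw [h3] at h2
    have h4 : (2 * Complex.I) * ⟪J φ, N ψ⟫_ℂ = 0 := by linear_combination h2
    simpa using h4
  refine hJ.eq_zero_of_inner_left (𝕜 := ℂ) ?_
  rintro _ ⟨φ, rfl⟩
  rw [← inner_conj_symm, key, map_zero]

theorem eq_of_quadratic_form {A B : 𝓗 →ₗ.[ℂ] 𝓗} (hd : Dense (A.domain : Set 𝓗))
    (hAB : A.domain = B.domain)
    (h : ∀ (ψ : 𝓗) (hA : ψ ∈ A.domain) (hB : ψ ∈ B.domain), ⟪ψ, A ⟨ψ, hA⟩⟫_ℂ = ⟪ψ, B ⟨ψ, hB⟩⟫_ℂ) :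
    A = B := by
  refine LinearPMap.ext hAB fun ψ hA hB => ?_
  have := eq_zero_of_quadratic_form A.domain.subtype
    (A.toFun - B.toFun.comp (Submodule.inclusion hAB.le)) (by simpa using hd) (fun φ => by
      have := h φ φ.2 (hAB ▸ φ.2)
      rw [LinearMap.sub_apply, inner_sub_right, sub_eq_zero]
      exact this) ⟨ψ, hA⟩
  rw [LinearMap.sub_apply, sub_eq_zero] at this
  exact this

theorem dense_of_orthogonal [CompleteSpace 𝓗] {S : Submodule ℂ 𝓗}
    (h : ∀ ξ : 𝓗, (∀ ψ ∈ S, ⟪ψ, ξ⟫_ℂ = 0) → ξ = 0) : Dense (S : Set 𝓗) := by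
  rw [Submodule.dense_iff_topologicalClosure_eq_top, Submodule.topologicalClosure_eq_top_iff,
    Submodule.eq_bot_iff]
  exact fun ξ hξ => h ξ fun ψ hψ => (Submodule.mem_orthogonal _ _).1 hξ ψ hψ

namespace ProjectionValuedMeasure

theorem diagMeasure_apply (P : ProjectionValuedMeasure 𝓗) (ψ : 𝓗) {B : Set ℝ}
    (hB : MeasurableSet B) : P.diagMeasure ψ B = ‖P.proj B ψ‖ₑ ^ 2 := by
  rw [diagMeasure, Measure.ofMeasurable_apply B hB, ENNReal.ofReal_pow (norm_nonneg _),
    ofReal_norm]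

theorem diagMeasure_univ (P : ProjectionValuedMeasure 𝓗) (ψ : 𝓗) :
    P.diagMeasure ψ Set.univ = ‖ψ‖ₑ ^ 2 := by
  rw [P.diagMeasure_apply ψ MeasurableSet.univ, P.univ]

instance (P : ProjectionValuedMeasure 𝓗) (ψ : 𝓗) : IsFiniteMeasure (P.diagMeasure ψ) :=
  ⟨by rw [P.diagMeasure_univ]; exact ENNReal.pow_lt_top enorm_lt_top⟩

theorem eq_zero_of_diagMeasure (P : ProjectionValuedMeasure 𝓗) {ψ : 𝓗}
    (h : P.diagMeasure ψ = 0) : ψ = 0 := by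
  have := P.diagMeasure_univ ψ
  rw [h, Measure.coe_zero, Pi.zero_apply] at this
  simpa using this.symm

/-- This makes the vectors `ψ` with `f ∈ L²(μ_ψ)` closed under addition. -/
theorem diagMeasure_add_le (P : ProjectionValuedMeasure 𝓗) (φ ψ : 𝓗) :
    P.diagMeasure (φ + ψ) ≤ (2 : ℝ≥0∞) • (P.diagMeasure φ + P.diagMeasure ψ) := by
  refine Measure.le_iff.2 fun B hB => ?_
  simp only [Measure.smul_apply, Measure.add_apply, P.diagMeasure_apply _ hB, map_add, smul_eq_mul]
  have h1 : ‖P.proj B φ + P.proj B ψ‖ ^ 2 ≤ 2 * (‖P.proj B φ‖ ^ 2 + ‖P.proj B ψ‖ ^ 2) := by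
    have := norm_add_le (P.proj B φ) (P.proj B ψ)
    nlinarith [sq_nonneg (‖P.proj B φ‖ - ‖P.proj B ψ‖), norm_nonneg (P.proj B φ + P.proj B ψ)]
  have h2 := ENNReal.ofReal_le_ofReal h1
  rw [ENNReal.ofReal_mul (by norm_num), ENNReal.ofReal_add (by positivity) (by positivity),
    ENNReal.ofReal_pow (by positivity), ENNReal.ofReal_pow (by positivity),
    ENNReal.ofReal_pow (by positivity)] at h2
  simpa using h2

theorem diagMeasure_smul (P : ProjectionValuedMeasure 𝓗) (a : ℂ) (ψ : 𝓗) :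
    P.diagMeasure (a • ψ) = (‖a‖ₑ ^ 2) • P.diagMeasure ψ := by
  ext B hB
  simp [P.diagMeasure_apply _ hB, enorm_smul, mul_pow]

/-- The linear span of the pairs `(1_B, E(B))`. -/
inductive Rel (P : ProjectionValuedMeasure 𝓗) : (ℝ → ℂ) → (𝓗 →L[ℂ] 𝓗) → Prop
  | ind (B : Set ℝ) (hB : MeasurableSet B) : Rel P (B.indicator fun _ => 1) (P.proj B)
  | add {h k : ℝ → ℂ} {T S : 𝓗 →L[ℂ] 𝓗} : Rel P h T → Rel P k S → Rel P (h + k) (T + S)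
  | smul (a : ℂ) {h : ℝ → ℂ} {T : 𝓗 →L[ℂ] 𝓗} : Rel P h T → Rel P (a • h) (a • T)

theorem Rel.measurable {P : ProjectionValuedMeasure 𝓗} {h : ℝ → ℂ} {T : 𝓗 →L[ℂ] 𝓗}
    (hT : P.Rel h T) : Measurable h := by
  induction hT with
  | ind B hB => exact measurable_const.indicator hB
  | add _ _ h1 h2 => exact h1.add h2
  | smul a _ h1 => exact h1.const_smul a

theorem Rel.bounded {P : ProjectionValuedMeasure 𝓗} {h : ℝ → ℂ} {T : 𝓗 →L[ℂ] 𝓗}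
    (hT : P.Rel h T) : ∃ C : ℝ, ∀ x, ‖h x‖ ≤ C := by
  induction hT with
  | ind B hB =>
    refine ⟨1, fun x => ?_⟩
    by_cases hx : x ∈ B <;> simp [hx]
  | add _ _ h1 h2 =>
    obtain ⟨C, hC⟩ := h1
    obtain ⟨D, hD⟩ := h2
    exact ⟨C + D, fun x => norm_add_le_of_le (hC x) (hD x)⟩
  | smul a _ h1 =>
    obtain ⟨C, hC⟩ := h1
    exact ⟨‖a‖ * C, fun x => by
      rw [Pi.smul_apply, norm_smul]
      exact mul_le_mul_of_nonneg_left (hC x) (norm_nonneg a)⟩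

theorem exists_rel_simpleFunc (P : ProjectionValuedMeasure 𝓗) (g : SimpleFunc ℝ ℂ) :
    ∃ T, P.Rel g T := by
  induction g using SimpleFunc.induction with
  | @const c s hs =>
    refine ⟨c • P.proj s, ?_⟩
    convert Rel.smul c (Rel.ind (P := P) s hs) using 1
    ext x
    by_cases hx : x ∈ s <;> simp [hx]
  | @add f g _ hf hg =>
    obtain ⟨T, hT⟩ := hf
    obtain ⟨S, hS⟩ := hg
    exact ⟨T + S, hT.add hS⟩

theorem integral_indicator_diagMeasure (P : ProjectionValuedMeasure 𝓗) {B : Set ℝ}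
    (hB : MeasurableSet B) (ψ : 𝓗) :
    ∫ x, B.indicator (fun _ => (1 : ℂ)) x ∂(P.diagMeasure ψ) = ⟪ψ, P.proj B ψ⟫_ℂ := by
  rw [integral_indicator hB, integral_const, measureReal_restrict_apply MeasurableSet.univ,
    Set.univ_inter, Measure.real, P.diagMeasure_apply ψ hB]
  nth_rw 2 [← Set.inter_self B]
  rw [P.inter B B hB hB, ← P.symmetric B hB, inner_self_eq_norm_sq_to_K]
  simp

theorem isCalculus [CompleteSpace 𝓗] (P : ProjectionValuedMeasure 𝓗) :
    IsCalculus P.Rel P.diagMeasure where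
  finite ψ := inferInstance
  meas hT := hT.measurable
  bdd hT := hT.bounded
  add h1 h2 := h1.add h2
  smul a _ _ h := h.smul a
  mul := by
    intro h T k S hT hS
    induction hT with
    | ind B hB =>
      induction hS with
      | ind C hC =>
        convert Rel.ind (P := P) (B ∩ C) (hB.inter hC) using 1
        · ext x
          by_cases hx : x ∈ B <;> by_cases hx' : x ∈ C <;> simp [hx, hx']
        · ext ψ
          rw [P.inter B C hB hC]
          rfl
      | add _ _ h1 h2 => simpa [mul_add] using h1.add h2
      | smul a _ h1 => simpa using h1.smul a
    | add _ _ h1 h2 => simpa [add_mul] using h1.add h2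
    | smul a _ h1 => simpa using h1.smul a
  adj := by
    intro h T hT
    induction hT with
    | ind B hB =>
      convert Rel.ind (P := P) B hB using 1
      · ext x
        by_cases hx : x ∈ B <;> simp [hx]
      · rw [ContinuousLinearMap.star_eq_adjoint]
        symm
        rw [ContinuousLinearMap.eq_adjoint_iff]
        exact P.symmetric B hB
    | add _ _ h1 h2 => simpa using h1.add h2
    | smul a _ h1 => simpa using h1.smul (star a)
  inner := by
    intro h T hT ψ
    induction hT with
    | ind B hB => exact (P.integral_indicator_diagMeasure hB ψ).symm
    | add h1 h2 k1 k2 =>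
      have hi : ∀ {h : ℝ → ℂ} {T : 𝓗 →L[ℂ] 𝓗}, P.Rel h T → Integrable h (P.diagMeasure ψ) :=
        fun hT => by
          obtain ⟨C, hC⟩ := hT.bounded
          exact Integrable.of_bound hT.measurable.aestronglyMeasurable C (ae_of_all _ hC)
      simp only [Pi.add_apply, add_apply]
      rw [inner_add_right, k1, k2, integral_add (hi h1) (hi h2)]
    | smul a _ k =>
      simp only [Pi.smul_apply, smul_apply]
      rw [inner_smul_right, k, integral_smul, smul_eq_mul]
  dense := by
    intro ν _ f hf ε hε
    obtain ⟨g, hg, -⟩ := hf.exists_simpleFunc_eLpNorm_sub_lt (by norm_num) hε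
    obtain ⟨T, hT⟩ := P.exists_rel_simpleFunc g
    exact ⟨g, T, hT, hg.le⟩

/-- The vector `(∫ f dE) ψ`. -/
def int (P : ProjectionValuedMeasure 𝓗) (f : ℝ → ℂ) (ψ : 𝓗) : 𝓗 :=
  calcInt P.Rel P.diagMeasure f ψ

theorem memLp_add (P : ProjectionValuedMeasure 𝓗) {f : ℝ → ℂ} {φ ψ : 𝓗}
    (hφ : MemLp f 2 (P.diagMeasure φ)) (hψ : MemLp f 2 (P.diagMeasure ψ)) :
    MemLp f 2 (P.diagMeasure (φ + ψ)) :=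
  ((memLp_two_add_measure hφ hψ).smul_measure (by norm_num)).mono_measure (P.diagMeasure_add_le φ ψ)

theorem memLp_smul (P : ProjectionValuedMeasure 𝓗) {f : ℝ → ℂ} {ψ : 𝓗} (a : ℂ)
    (hψ : MemLp f 2 (P.diagMeasure ψ)) : MemLp f 2 (P.diagMeasure (a • ψ)) := by
  rw [P.diagMeasure_smul]
  exact hψ.smul_measure (by simp)

theorem diagMeasure_zero (P : ProjectionValuedMeasure 𝓗) : P.diagMeasure 0 = 0 := by
  ext B hB
  simp [P.diagMeasure_apply 0 hB]

theorem memLp_of_bound (P : ProjectionValuedMeasure 𝓗) {f : ℝ → ℂ} (hf : Measurable f) {C : ℝ}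
    (hC : ∀ x, ‖f x‖ ≤ C) (ψ : 𝓗) : MemLp f 2 (P.diagMeasure ψ) :=
  MemLp.of_bound hf.aestronglyMeasurable C (ae_of_all _ hC)

theorem proj_eq_zero_iff (P : ProjectionValuedMeasure 𝓗) {B : Set ℝ} (hB : MeasurableSet B)
    {ψ : 𝓗} : P.proj B ψ = 0 ↔ P.diagMeasure ψ B = 0 := by
  simp [P.diagMeasure_apply ψ hB]

theorem proj_proj (P : ProjectionValuedMeasure 𝓗) {B : Set ℝ} (hB : MeasurableSet B) (ψ : 𝓗) :
    P.proj B (P.proj B ψ) = P.proj B ψ := by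
  rw [← P.inter B B hB hB, Set.inter_self]

theorem iUnion_norm_le (f : ℝ → ℂ) : ⋃ n : ℕ, {x | ‖f x‖ ≤ n} = Set.univ :=
  Set.eq_univ_of_forall fun x => Set.mem_iUnion.2 (exists_nat_ge ‖f x‖)

variable [CompleteSpace 𝓗]

/-- The operator `∫ f dE` on its maximal domain. -/
def operator (P : ProjectionValuedMeasure 𝓗) (f : ℝ → ℂ) : 𝓗 →ₗ.[ℂ] 𝓗 where
  domain :=
    { carrier := {ψ | MemLp f 2 (P.diagMeasure ψ)}
      zero_mem' := by
        rw [Set.mem_ofPred_eq, P.diagMeasure_zero]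
        exact ⟨aestronglyMeasurable_zero_measure f, by simp⟩
      add_mem' := P.memLp_add
      smul_mem' := fun a _ => P.memLp_smul a }
  toFun :=
    { toFun := fun ψ => P.int f ψ
      map_add' := fun φ ψ => P.isCalculus.calcInt_vadd φ.2 ψ.2 (P.memLp_add φ.2 ψ.2)
      map_smul' := fun a ψ => P.isCalculus.calcInt_vsmul a ψ.2 (P.memLp_smul a ψ.2) }

theorem mem_operator_domain (P : ProjectionValuedMeasure 𝓗) {f : ℝ → ℂ} {ψ : 𝓗} :
    ψ ∈ (P.operator f).domain ↔ MemLp f 2 (P.diagMeasure ψ) := Iff.rfl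

theorem operator_apply (P : ProjectionValuedMeasure 𝓗) {f : ℝ → ℂ} (ψ : (P.operator f).domain) :
    P.operator f ψ = P.int f ψ := rfl

theorem isSpectralIntegral_operator (P : ProjectionValuedMeasure 𝓗) {f : ℝ → ℂ}
    (hf : Measurable f) : P.IsSpectralIntegral f (P.operator f) :=
  ⟨fun _ => memLp_two_iff_lintegral hf.aestronglyMeasurable,
    fun ψ => P.isCalculus.inner_calcInt_self ψ.2⟩

theorem int_indicator (P : ProjectionValuedMeasure 𝓗) {B : Set ℝ} (hB : MeasurableSet B) (ψ : 𝓗) :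
    P.int (B.indicator fun _ => 1) ψ = P.proj B ψ :=
  P.isCalculus.calcInt_rel (Rel.ind B hB) ψ

theorem proj_mem_operator_domain (P : ProjectionValuedMeasure 𝓗) {f : ℝ → ℂ} (hf : Measurable f)
    {B : Set ℝ} (hB : MeasurableSet B) {C : ℝ} (hC : ∀ x ∈ B, ‖f x‖ ≤ C) (ψ : 𝓗) :
    P.proj B ψ ∈ (P.operator f).domain := by
  have hm : Measurable (B.indicator fun _ => (1 : ℂ)) := measurable_const.indicator hB
  rw [mem_operator_domain, ← P.int_indicator hB, int, P.isCalculus.memLp_calcInt_iff hm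
    ((memLp_const 1).indicator hB) hf]
  refine P.memLp_of_bound (hf.mul hm) (C := max C 0) (fun x => ?_) ψ
  by_cases hx : x ∈ B
  · simp [hx, hC x hx]
  · simp [hx]

/-- The cutoffs `E(|f| ≤ n) ξ` lie in the domain. If `ξ` is orthogonal to the domain, each has norm
zero, and the sets `{|f| ≤ n}` exhaust `ℝ`. -/
theorem dense_operator_domain (P : ProjectionValuedMeasure 𝓗) {f : ℝ → ℂ} (hf : Measurable f) :
    Dense ((P.operator f).domain : Set 𝓗) := by
  refine dense_of_orthogonal fun ξ hξ => P.eq_zero_of_diagMeasure ?_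
  have hB : ∀ n : ℕ, MeasurableSet {x | ‖f x‖ ≤ n} := fun n =>
    measurableSet_le hf.norm measurable_const
  rw [← Measure.measure_univ_eq_zero, ← iUnion_norm_le f, measure_iUnion_null_iff]
  intro n
  rw [← P.proj_eq_zero_iff (hB n)]
  have := hξ _ (P.proj_mem_operator_domain hf (hB n) (fun x hx => hx) ξ)
  rwa [← P.proj_proj (hB n), P.symmetric _ (hB n), inner_self_eq_zero] at this

/-- A densely defined operator is fixed by its domain and its quadratic form. This identifies
operators selected by `Classical.epsilon`. -/
theorem IsSpectralIntegral.eq_operator {P : ProjectionValuedMeasure 𝓗} {f : ℝ → ℂ}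
    (hf : Measurable f) {A : 𝓗 →ₗ.[ℂ] 𝓗} (hA : P.IsSpectralIntegral f A) : A = P.operator f := by
  have hB := P.isSpectralIntegral_operator hf
  have hd : A.domain = (P.operator f).domain := by
    ext ψ
    rw [hA.1, hB.1]
  refine eq_of_quadratic_form (hd ▸ P.dense_operator_domain hf) hd fun ψ h1 h2 => ?_
  rw [hA.2 ⟨ψ, h1⟩, hB.2 ⟨ψ, h2⟩]

theorem spectralIntegral_eq (P : ProjectionValuedMeasure 𝓗) {f : ℝ → ℂ} (hf : Measurable f) :
    P.spectralIntegral f = P.operator f :=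
  (Classical.epsilon_spec (p := P.IsSpectralIntegral f)
    ⟨_, P.isSpectralIntegral_operator hf⟩).eq_operator hf

theorem inner_int_left (P : ProjectionValuedMeasure 𝓗) {f : ℝ → ℂ} {φ ψ : 𝓗}
    (hφ : MemLp f 2 (P.diagMeasure φ)) (hψ : MemLp f 2 (P.diagMeasure ψ)) :
    ⟪P.int f φ, ψ⟫_ℂ = ⟪φ, P.int (star f) ψ⟫_ℂ :=
  P.isCalculus.inner_calcInt_left hφ hψ

theorem int_int (P : ProjectionValuedMeasure 𝓗) {f g : ℝ → ℂ} {ψ : 𝓗} (hm : Measurable f)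
    (hf : MemLp f 2 (P.diagMeasure ψ)) (hg : Measurable g)
    (hgf : MemLp (g * f) 2 (P.diagMeasure ψ)) : P.int g (P.int f ψ) = P.int (g * f) ψ :=
  P.isCalculus.calcInt_calcInt hm hf hg hgf

/-- The operator is symmetric, so only `D(A*) ⊆ D(A)` is at stake. For `w = A* y`, testing against
cutoff vectors gives `E(|f| ≤ n) w = (f 1_{|f| ≤ n})(A) y`. Thus the integrals of `|f|²` over `{|f|
≤ n}` against `μ_y` are bounded by `‖w‖²`. -/
theorem isSelfAdjoint_operator (P : ProjectionValuedMeasure 𝓗) {f : ℝ → ℂ} (hf : Measurable f)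
    (hr : star f = f) : IsSelfAdjoint (P.operator f) := by
  set A := P.operator f with hA
  have hd : Dense (A.domain : Set 𝓗) := P.dense_operator_domain hf
  have hsymm : A.IsFormalAdjoint A := fun φ ψ => by
    have := P.inner_int_left φ.2 ψ.2
    rwa [hr] at this
  have hle : A ≤ A.adjoint := hsymm.le_adjoint hd
  rw [LinearPMap.isSelfAdjoint_def]
  refine (LinearPMap.eq_of_le_of_domain_eq hle (le_antisymm hle.1 fun y hy => ?_)).symm
  set w := A.adjoint ⟨y, hy⟩ with hw
  have hadj : ∀ x : A.domain, ⟪w, x⟫_ℂ = ⟪y, A x⟫_ℂ := fun x =>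
    LinearPMap.adjoint_isFormalAdjoint hd ⟨y, hy⟩ x
  have hB : ∀ n : ℕ, MeasurableSet {x | ‖f x‖ ≤ n} := fun n =>
    measurableSet_le hf.norm measurable_const
  have hind : ∀ n : ℕ, Measurable (({x | ‖f x‖ ≤ n}.indicator fun _ => (1 : ℂ))) := fun n =>
    measurable_const.indicator (hB n)
  have hbd : ∀ (n : ℕ) (z : 𝓗), MemLp (f * ({x | ‖f x‖ ≤ n}.indicator fun _ => (1 : ℂ))) 2
      (P.diagMeasure z) := fun n z => by
    refine P.memLp_of_bound (hf.mul (hind n)) (C := n) (fun x => ?_) z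
    by_cases hx : ‖f x‖ ≤ n
    · simp [hx]
    · simp [hx]
  have hstar : ∀ n : ℕ, star (f * ({x | ‖f x‖ ≤ n}.indicator fun _ => (1 : ℂ))) =
      f * ({x | ‖f x‖ ≤ n}.indicator fun _ => (1 : ℂ)) := fun n => by
    rw [star_mul', hr]
    congr 1
    ext x
    by_cases hx : ‖f x‖ ≤ n <;> simp [hx]
  have key : ∀ n : ℕ, P.int (f * ({x | ‖f x‖ ≤ n}.indicator fun _ => 1)) y =
      P.proj {x | ‖f x‖ ≤ n} w := by
    intro n
    refine ext_inner_right ℂ fun z => ?_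
    have h1 := hadj ⟨_, P.proj_mem_operator_domain hf (hB n) (fun x hx => hx) z⟩
    rw [P.symmetric _ (hB n)]
    refine Eq.trans ?_ h1.symm
    rw [P.inner_int_left (hbd n y) (hbd n z), hstar n]
    change _ = ⟪y, P.int f (P.proj _ z)⟫_ℂ
    rw [← P.int_indicator (hB n) z, P.int_int (hind n) ((memLp_const 1).indicator (hB n)) hf
      (hbd n z)]
  rw [hA, mem_operator_domain, memLp_two_iff_lintegral hf.aestronglyMeasurable]
  have hmono : Monotone fun n : ℕ => {x | ‖f x‖ ≤ n} := fun m n hmn x (hx : ‖f x‖ ≤ m) =>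
    show ‖f x‖ ≤ n from hx.trans (Nat.cast_le.2 hmn)
  -- Monotone convergence, as continuity from below of the measure `|f|² μ_y`.
  have hsup := hmono.measure_iUnion (μ := (P.diagMeasure y).withDensity fun x => ‖f x‖ₑ ^ 2)
  rw [iUnion_norm_le, withDensity_apply _ MeasurableSet.univ, Measure.restrict_univ] at hsup
  rw [hsup]
  refine lt_of_le_of_lt (b := ‖w‖ₑ ^ 2) (iSup_le fun n => ?_) (ENNReal.pow_lt_top enorm_lt_top)
  have h1 : ‖P.proj {x | ‖f x‖ ≤ n} w‖ₑ ^ 2 ≤ ‖w‖ₑ ^ 2 := by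
    rw [← P.diagMeasure_apply w (hB n), ← P.diagMeasure_univ]
    exact measure_mono (Set.subset_univ _)
  refine le_trans (le_of_eq ?_) h1
  rw [← key n, int, P.isCalculus.enorm_calcInt (hbd n y), eLpNorm_two_sq, withDensity_apply _ (hB n),
    ← lintegral_indicator (hB n)]
  congr 1
  ext x
  by_cases hx : ‖f x‖ ≤ n <;> simp [hx]

end ProjectionValuedMeasure

end TimeOp

end

/-! ### Resolvents of a self-adjoint operator at `±i`. -/

section

namespace TimeOp

open scoped InnerProductSpace

variable {𝓗 : Type*} [NormedAddCommGroup 𝓗] [InnerProductSpace ℂ 𝓗] [CompleteSpace 𝓗]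

section Resolvent

variable {A : 𝓗 →ₗ.[ℂ] 𝓗}

theorem inner_apply_comm (hA : IsSelfAdjoint A) (φ ψ : A.domain) :
    ⟪A φ, (ψ : 𝓗)⟫_ℂ = ⟪(φ : 𝓗), A ψ⟫_ℂ := by
  have := LinearPMap.adjoint_isFormalAdjoint hA.dense_domain
  rw [LinearPMap.isSelfAdjoint_def.1 hA] at this
  exact this φ ψ

theorem exists_mem_domain_of_isSelfAdjoint (hA : IsSelfAdjoint A) {y w : 𝓗}
    (h : ∀ x : A.domain, ⟪w, (x : 𝓗)⟫_ℂ = ⟪y, A x⟫_ℂ) : ∃ hy : y ∈ A.domain, A ⟨y, hy⟩ = w := by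
  have hd := hA.dense_domain
  have h1 : y ∈ A.domain := by
    have := LinearPMap.mem_adjoint_domain_of_exists (T := A) y ⟨w, h⟩
    rwa [LinearPMap.isSelfAdjoint_def.1 hA] at this
  refine ⟨h1, ?_⟩
  refine hd.eq_of_inner_left (𝕜 := ℂ) fun v hv => ?_
  rw [h ⟨v, hv⟩, inner_apply_comm hA ⟨y, h1⟩ ⟨v, hv⟩]

/-- The conditions on `c` say `c = ±i`; as `(A ψ, ψ)` is real, the cross term is purely imaginary.
-/
theorem norm_sq_add_smul (hA : IsSelfAdjoint A) {c : ℂ} (hc : star c = -c) (hc1 : ‖c‖ = 1)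
    (ψ : A.domain) : ‖A ψ + c • (ψ : 𝓗)‖ ^ 2 = ‖A ψ‖ ^ 2 + ‖(ψ : 𝓗)‖ ^ 2 := by
  have h1 : RCLike.re (⟪A ψ, c • (ψ : 𝓗)⟫_ℂ) = 0 := by
    have h2 : (starRingEnd ℂ) ⟪A ψ, c • (ψ : 𝓗)⟫_ℂ = -⟪A ψ, c • (ψ : 𝓗)⟫_ℂ := by
      rw [inner_smul_right, map_mul, inner_conj_symm, inner_apply_comm hA]
      have : (starRingEnd ℂ) c = -c := hc
      rw [this]
      ring
    have h3 := congrArg Complex.re h2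
    simp only [Complex.conj_re, Complex.neg_re] at h3
    change (⟪A ψ, c • (ψ : 𝓗)⟫_ℂ).re = 0
    linarith
  rw [norm_add_sq (𝕜 := ℂ), h1, norm_smul, hc1]
  ring

/-- `A + c` is bounded below, so it is injective, and since `A` is closed its range is closed. A
vector `y` orthogonal to the range lies in `D(A* ) = D(A)` and satisfies `A y = c y`, which forces
`y = 0` because `c` is not real. -/
theorem exists_resolvent (hA : IsSelfAdjoint A) {c : ℂ} (hc : star c = -c) (hc1 : ‖c‖ = 1) :
    ∃ R : 𝓗 →L[ℂ] 𝓗, (∀ ψ : 𝓗, ∃ h : R ψ ∈ A.domain, A ⟨R ψ, h⟩ + c • R ψ = ψ) ∧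
      ∀ ψ : A.domain, R (A ψ + c • (ψ : 𝓗)) = ψ := by
  set L : A.domain →ₗ[ℂ] 𝓗 := A.toFun + c • A.domain.subtype with hL
  have hLapp : ∀ ψ : A.domain, L ψ = A ψ + c • (ψ : 𝓗) := fun ψ => rfl
  have hbound : ∀ ψ : A.domain, ‖(ψ : 𝓗)‖ ≤ ‖L ψ‖ := fun ψ => by
    have := norm_sq_add_smul hA hc hc1 ψ
    rw [← hLapp] at this
    refine abs_le_of_sq_le_sq' ?_ (norm_nonneg _) |>.2
    nlinarith [sq_nonneg ‖A ψ‖]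
  have hinj : Function.Injective L := by
    rw [injective_iff_map_eq_zero]
    intro ψ hψ
    have := hbound ψ
    rw [hψ, norm_zero] at this
    exact Subtype.ext (norm_le_zero_iff.1 this)
  have hclosed : IsClosed (L.range : Set 𝓗) := by
    refine isSeqClosed_iff_isClosed.1 fun y y₀ hy hlim => ?_
    choose x hx using hy
    have hC : CauchySeq fun n => (x n : 𝓗) := by
      have hyC := hlim.cauchySeq
      rw [Metric.cauchySeq_iff] at hyC ⊢
      intro ε hε
      obtain ⟨N, hN⟩ := hyC ε hε
      refine ⟨N, fun m hm n hn => lt_of_le_of_lt ?_ (hN m hm n hn)⟩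
      rw [dist_eq_norm, dist_eq_norm, ← hx m, ← hx n, ← map_sub]
      exact hbound (x m - x n)
    obtain ⟨x₀, hx₀⟩ := cauchySeq_tendsto_of_complete hC
    have hAx : Tendsto (fun n => A (x n)) atTop (𝓝 (y₀ - c • x₀)) := by
      refine (hlim.sub (hx₀.const_smul c)).congr fun n => ?_
      rw [← hx n, hLapp, add_sub_cancel_right]
    have hg : (x₀, y₀ - c • x₀) ∈ (A.graph : Set (𝓗 × 𝓗)) := by
      refine IsClosed.mem_of_tendsto (hA.isClosed) (hx₀.prodMk_nhds hAx)
        (Eventually.of_forall fun n => A.mem_graph (x n))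
    obtain ⟨ψ, h1, h2⟩ := (A.mem_graph_iff).1 hg
    refine ⟨ψ, ?_⟩
    rw [hLapp, h2, h1]
    simp
  have hsurj : Function.Surjective L := by
    rw [← LinearMap.range_eq_top, ← hclosed.submodule_topologicalClosure_eq,
      Submodule.topologicalClosure_eq_top_iff, Submodule.eq_bot_iff]
    intro y hy
    have h1 : ∀ x : A.domain, ⟪c • y, (x : 𝓗)⟫_ℂ = ⟪y, A x⟫_ℂ := by
      intro x
      have h2 := (Submodule.mem_orthogonal' _ _).1 hy (L x) ⟨x, rfl⟩
      rw [hLapp, inner_add_right, inner_smul_right] at h2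
      have h3 : (starRingEnd ℂ) c = -c := hc
      rw [inner_smul_left, h3]
      linear_combination -h2
    obtain ⟨hy1, hy2⟩ := exists_mem_domain_of_isSelfAdjoint hA h1
    have h4 := inner_apply_comm hA ⟨y, hy1⟩ ⟨y, hy1⟩
    rw [hy2] at h4
    simp only [inner_smul_left, inner_smul_right] at h4
    have h3 : (starRingEnd ℂ) c = -c := hc
    rw [h3] at h4
    have h5 : (2 * c) * ⟪y, y⟫_ℂ = 0 := by linear_combination -h4
    have hc0 : c ≠ 0 := by
      rintro rfl
      simp at hc1
    simpa [hc0] using h5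
  let e := LinearEquiv.ofBijective L ⟨hinj, hsurj⟩
  have he : ∀ ψ, L (e.symm ψ) = ψ := fun ψ => e.apply_symm_apply ψ
  refine ⟨LinearMap.mkContinuous (A.domain.subtype ∘ₗ e.symm.toLinearMap) 1 fun ψ => ?_, ?_, ?_⟩
  · rw [one_mul]
    have := hbound (e.symm ψ)
    rwa [he] at this
  · exact fun ψ => ⟨(e.symm ψ).2, he ψ⟩
  · intro ψ
    exact congrArg Subtype.val (e.symm_apply_apply ψ)

end Resolvent

end TimeOp

end

/-! ### From a continuous functional calculus to a projection-valued measure. -/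

section

namespace TimeOp

open scoped InnerProductSpace

variable {𝓗 : Type*} [NormedAddCommGroup 𝓗] [InnerProductSpace ℂ 𝓗] [CompleteSpace 𝓗]

section Compact

variable {X : Type*} [MetricSpace X] [CompactSpace X] [MeasurableSpace X] [BorelSpace X]

/-- Riesz–Markov for the functional `h ↦ (ψ, Φ(h) ψ)`; it is positive because `h ≥ 0` is the square
of `√h`, so its value is `‖Φ(√h) ψ‖²`. -/
theorem exists_measure_of_starAlgHom (Φ : C(X, ℂ) →⋆ₐ[ℂ] (𝓗 →L[ℂ] 𝓗)) (ψ : 𝓗) :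
    ∃ μ : Measure X, IsFiniteMeasure μ ∧ ∀ g : C(X, ℂ), ⟪ψ, Φ g ψ⟫_ℂ = ∫ x, g x ∂μ := by
  let ι : C(X, ℝ) →ₗ[ℝ] C(X, ℂ) :=
    { toFun := fun h => ⟨fun x => (h x : ℂ), by fun_prop⟩
      map_add' := fun h k => by ext x; simp
      map_smul' := fun a h => by ext x; simp }
  have hιapp : ∀ h x, ι h x = (h x : ℂ) := fun _ _ => rfl
  have hreal : ∀ h : C(X, ℝ), (starRingEnd ℂ) ⟪ψ, Φ (ι h) ψ⟫_ℂ = ⟪ψ, Φ (ι h) ψ⟫_ℂ := by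
    intro h
    have h1 : star (ι h) = ι h := by
      ext x
      simp [hιapp]
    rw [inner_conj_symm, ← ContinuousLinearMap.adjoint_inner_right,
      ← ContinuousLinearMap.star_eq_adjoint, ← map_star, h1]
  let L : C(X, ℝ) →ₗ[ℝ] ℝ :=
    { toFun := fun h => (⟪ψ, Φ (ι h) ψ⟫_ℂ).re
      map_add' := fun h k => by simp [map_add]
      map_smul' := fun a h => by
        have : Φ (ι (a • h)) = (a : ℂ) • Φ (ι h) := by
          rw [← map_smul Φ]
          congr 1
          ext x
          simp [hιapp]
        rw [this]
        simp }
  have hL : ∀ h : C(X, ℝ), 0 ≤ h → 0 ≤ L h := by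
    intro h hh
    let k : C(X, ℝ) := ⟨fun x => √(h x), by fun_prop⟩
    have h1 : ι h = star (ι k) * ι k := by
      ext x
      have : √(h x) * √(h x) = h x := Real.mul_self_sqrt (hh x)
      simp only [ContinuousMap.mul_apply, ContinuousMap.star_apply, hιapp, RCLike.star_def,
        Complex.conj_ofReal]
      rw [← Complex.ofReal_mul]
      exact congrArg _ this.symm
    change 0 ≤ (⟪ψ, Φ (ι h) ψ⟫_ℂ).re
    rw [h1, map_mul, map_star, mul_apply_eq_comp, ContinuousLinearMap.star_eq_adjoint,
      ContinuousLinearMap.adjoint_inner_right]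
    exact inner_self_nonneg (𝕜 := ℂ)
  let Λ : CompactlySupportedContinuousMap X ℝ →ₚ[ℝ] ℝ := PositiveLinearMap.mk₀
    { toFun := fun h => L h.toContinuousMap
      map_add' := fun h k => L.map_add h.toContinuousMap k.toContinuousMap
      map_smul' := fun a h => L.map_smul a h.toContinuousMap }
    (fun h hh => hL h.toContinuousMap hh)
  have hΛ : ∀ h : C(X, ℝ), ∫ x, h x ∂(RealRMK.rieszMeasure Λ) = L h := fun h =>
    RealRMK.integral_rieszMeasure Λ ⟨h, HasCompactSupport.of_compactSpace _⟩
  refine ⟨RealRMK.rieszMeasure Λ, inferInstance, fun g => ?_⟩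
  set ν := RealRMK.rieszMeasure Λ with hν
  have hΛ' : ∀ h : C(X, ℝ), ⟪ψ, Φ (ι h) ψ⟫_ℂ = ∫ x, (h x : ℂ) ∂ν := fun h => by
    rw [integral_complex_ofReal, hΛ]
    exact (Complex.conj_eq_iff_re.1 (hreal h)).symm
  let gr : C(X, ℝ) := ⟨fun x => (g x).re, by fun_prop⟩
  let gi : C(X, ℝ) := ⟨fun x => (g x).im, by fun_prop⟩
  have hg : g = ι gr + Complex.I • ι gi := by
    ext x
    simp only [ContinuousMap.add_apply, ContinuousMap.smul_apply, hιapp, smul_eq_mul]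
    rw [mul_comm]
    exact (Complex.re_add_im (g x)).symm
  have hint : ∀ h : C(X, ℝ), Integrable (fun x => (h x : ℂ)) ν := fun h =>
    (ι h).continuous.integrable_of_hasCompactSupport (HasCompactSupport.of_compactSpace _)
  have hsum : ∀ x, g x = (gr x : ℂ) + Complex.I * (gi x : ℂ) := fun x => by
    rw [mul_comm]
    exact (Complex.re_add_im (g x)).symm
  simp only [hsum]
  rw [integral_add (hint gr) ((hint gi).const_mul _), integral_const_mul, ← hΛ', ← hΛ', hg, map_add,
    map_smul]
  simp only [add_apply, smul_apply, inner_add_right, inner_smul_right]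

theorem exists_isCalculus_of_starAlgHom (Φ : C(X, ℂ) →⋆ₐ[ℂ] (𝓗 →L[ℂ] 𝓗)) :
    ∃ μ : 𝓗 → Measure X, IsCalculus (fun h T => ∃ g : C(X, ℂ), h = g ∧ T = Φ g) μ := by
  choose μ hfin hμ using exists_measure_of_starAlgHom Φ
  refine ⟨μ, hfin, ?_, ?_, ?_, ?_, ?_, ?_, ?_, ?_⟩
  · rintro _ _ ⟨g, rfl, rfl⟩
    exact g.continuous.measurable
  · rintro _ _ ⟨g, rfl, rfl⟩
    exact ⟨‖g‖, g.norm_coe_le_norm⟩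
  · rintro _ _ _ _ ⟨g, rfl, rfl⟩ ⟨k, rfl, rfl⟩
    exact ⟨g + k, rfl, (map_add Φ g k).symm⟩
  · rintro a _ _ ⟨g, rfl, rfl⟩
    exact ⟨a • g, rfl, (map_smul Φ a g).symm⟩
  · rintro _ _ _ _ ⟨g, rfl, rfl⟩ ⟨k, rfl, rfl⟩
    exact ⟨g * k, rfl, (map_mul Φ g k).symm⟩
  · rintro _ _ ⟨g, rfl, rfl⟩
    exact ⟨star g, rfl, (map_star Φ g).symm⟩
  · rintro _ _ ⟨g, rfl, rfl⟩ ψ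
    exact hμ ψ g
  · intro ν _ f hf ε hε
    obtain ⟨g, hg, -⟩ := hf.exists_boundedContinuous_eLpNorm_sub_le (by norm_num) hε
    exact ⟨g, Φ g.toContinuousMap, ⟨g.toContinuousMap, rfl, rfl⟩, hg⟩

end Compact

section Pushforward

variable {X : Type*} [MeasurableSpace X] {rel : (X → ℂ) → (𝓗 →L[ℂ] 𝓗) → Prop} {μ : 𝓗 → Measure X}

namespace IsCalculus

/-- The bounded operator that a calculus assigns to the indicator function of a measurable set. -/
def indicatorOp (c : IsCalculus rel μ) (h1 : rel 1 1) (B : Set X) (hB : MeasurableSet B) :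
    𝓗 →L[ℂ] 𝓗 :=
  have hm : ∀ ψ, MemLp (B.indicator fun _ => (1 : ℂ)) 2 (μ ψ) := fun ψ =>
    have := c.finite ψ
    (memLp_const 1).indicator hB
  LinearMap.mkContinuous
    { toFun := calcInt rel μ (B.indicator fun _ => 1)
      map_add' := fun φ ψ => c.calcInt_vadd (hm φ) (hm ψ) (hm (φ + ψ))
      map_smul' := fun a ψ => c.calcInt_vsmul a (hm ψ) (hm (a • ψ)) } 1 (fun ψ => by
    have h2 := c.enorm_calcInt (hm ψ)
    have h3 : ‖calcInt rel μ (B.indicator fun _ => 1) ψ‖ₑ ≤ ‖ψ‖ₑ := by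
      rw [h2]
      have h4 := c.enorm_apply h1 ψ
      rw [one_apply_eq_self] at h4
      rw [h4]
      refine eLpNorm_mono fun x => ?_
      by_cases hx : x ∈ B <;> simp [hx]
    rw [one_mul]
    exact enorm_le_iff_norm_le.1 h3)

theorem memLp_indicator (c : IsCalculus rel μ) {B : Set X} (hB : MeasurableSet B) (ψ : 𝓗) :
    MemLp (B.indicator fun _ => (1 : ℂ)) 2 (μ ψ) :=
  have := c.finite ψ
  (memLp_const 1).indicator hB

variable (c : IsCalculus rel μ)

theorem indicatorOp_apply (h1 : rel 1 1) {B : Set X} (hB : MeasurableSet B) (ψ : 𝓗) :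
    c.indicatorOp h1 B hB ψ = calcInt rel μ (B.indicator fun _ => 1) ψ := rfl

theorem enorm_indicatorOp_sq (h1 : rel 1 1) {B : Set X} (hB : MeasurableSet B) (ψ : 𝓗) :
    ‖c.indicatorOp h1 B hB ψ‖ₑ ^ 2 = μ ψ B := by
  rw [indicatorOp_apply, c.enorm_calcInt (c.memLp_indicator hB ψ), eLpNorm_two_sq,
    ← lintegral_indicator_one hB]
  congr 1
  ext x
  by_cases hx : x ∈ B <;> simp [hx]

theorem indicatorOp_symmetric (h1 : rel 1 1) {B : Set X} (hB : MeasurableSet B) (φ ψ : 𝓗) :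
    ⟪c.indicatorOp h1 B hB φ, ψ⟫_ℂ = ⟪φ, c.indicatorOp h1 B hB ψ⟫_ℂ := by
  have hs : star (B.indicator fun _ => (1 : ℂ)) = B.indicator fun _ => 1 := by
    ext x
    by_cases hx : x ∈ B <;> simp [hx]
  have := c.inner_calcInt_left (c.memLp_indicator hB φ) (c.memLp_indicator hB ψ)
  rwa [hs] at this

theorem indicatorOp_inter (h1 : rel 1 1) {B C : Set X} (hB : MeasurableSet B)
    (hC : MeasurableSet C) (ψ : 𝓗) : c.indicatorOp h1 (B ∩ C) (hB.inter hC) ψ =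
      c.indicatorOp h1 B hB (c.indicatorOp h1 C hC ψ) := by
  have hs : (B ∩ C).indicator (fun _ => (1 : ℂ)) = (B.indicator fun _ => 1) * C.indicator fun _ => 1 := by
    ext x
    by_cases hx : x ∈ B <;> by_cases hx' : x ∈ C <;> simp [hx, hx']
  have := c.memLp_indicator (hB.inter hC) ψ
  rw [hs] at this
  rw [indicatorOp_apply, indicatorOp_apply, indicatorOp_apply, c.calcInt_calcInt
    (measurable_const.indicator hC) (c.memLp_indicator hC ψ) (measurable_const.indicator hB) this, hs]

theorem indicatorOp_univ (h1 : rel 1 1) (ψ : 𝓗) :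
    c.indicatorOp h1 Set.univ MeasurableSet.univ ψ = ψ := by
  rw [indicatorOp_apply, Set.indicator_univ]
  exact c.calcInt_rel h1 ψ

theorem indicatorOp_union (h1 : rel 1 1) {B C : Set X} (hB : MeasurableSet B)
    (hC : MeasurableSet C) (hBC : Disjoint B C) (ψ : 𝓗) :
    c.indicatorOp h1 (B ∪ C) (hB.union hC) ψ =
      c.indicatorOp h1 B hB ψ + c.indicatorOp h1 C hC ψ := by
  simp only [indicatorOp_apply]
  rw [← c.calcInt_add (c.memLp_indicator hB ψ) (c.memLp_indicator hC ψ),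
    Set.indicator_union_of_disjoint hBC]
  rfl

theorem sum_indicatorOp (h1 : rel 1 1) {B : ℕ → Set X} (hB : ∀ n, MeasurableSet (B n))
    (hd : Pairwise (Function.onFun Disjoint B)) (s : Finset ℕ) (ψ : 𝓗) :
    ∑ n ∈ s, c.indicatorOp h1 (B n) (hB n) ψ =
      c.indicatorOp h1 (⋃ n ∈ s, B n) (s.measurableSet_biUnion fun n _ => hB n) ψ := by
  induction s using Finset.induction_on with
  | empty =>
    simp only [Finset.sum_empty]
    symm
    rw [← enorm_eq_zero, ← pow_eq_zero_iff two_ne_zero, enorm_indicatorOp_sq]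
    simp
  | insert a s ha ih =>
    rw [Finset.sum_insert ha, ih, ← c.indicatorOp_union]
    · congr 2
      simp
    · refine Set.disjoint_iUnion₂_right.2 fun n hn => hd ?_
      rintro rfl
      exact ha hn

/-- The squared error of a partial sum is the `μ ψ`-measure of the union of the remaining sets,
hence at most a tail of a convergent series. -/
theorem hasSum_indicatorOp (h1 : rel 1 1) {B : ℕ → Set X} (hB : ∀ n, MeasurableSet (B n))
    (hd : Pairwise (Function.onFun Disjoint B)) (ψ : 𝓗) :
    HasSum (fun n => c.indicatorOp h1 (B n) (hB n) ψ)
      (c.indicatorOp h1 (⋃ n, B n) (MeasurableSet.iUnion hB) ψ) := by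
  have := c.finite ψ
  have hsum : ∑' n, μ ψ (B n) ≠ ∞ := by
    rw [← measure_iUnion hd hB]
    exact measure_ne_top _ _
  have hlim := ENNReal.tendsto_tsum_compl_atTop_zero hsum
  rw [HasSum, SummationFilter.unconditional_filter, tendsto_iff_edist_tendsto_0]
  have hsq : Tendsto (fun s : Finset ℕ => (edist (∑ n ∈ s, c.indicatorOp h1 (B n) (hB n) ψ)
      (c.indicatorOp h1 (⋃ n, B n) (MeasurableSet.iUnion hB) ψ)) ^ 2) atTop (𝓝 0) := by
    refine tendsto_of_tendsto_of_tendsto_of_le_of_le tendsto_const_nhds hlim (fun _ => zero_le)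
      fun s => ?_
    have hm1 := s.measurableSet_biUnion fun n _ => hB n
    have hm2 : MeasurableSet (⋃ n : {n // n ∉ s}, B n) := MeasurableSet.iUnion fun n => hB n
    have hdis : Disjoint (⋃ n ∈ s, B n) (⋃ n : {n // n ∉ s}, B n) := by
      refine Set.disjoint_iUnion₂_left.2 fun n hn => Set.disjoint_iUnion_right.2 fun m => hd ?_
      rintro rfl
      exact m.2 hn
    have hU : c.indicatorOp h1 (⋃ n, B n) (MeasurableSet.iUnion hB) ψ =
        c.indicatorOp h1 _ hm1 ψ + c.indicatorOp h1 _ hm2 ψ := by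
      rw [← c.indicatorOp_union h1 hm1 hm2 hdis]
      congr 2
      ext x
      simp only [Set.mem_iUnion, Set.mem_union, Subtype.exists]
      constructor
      · rintro ⟨n, hn⟩
        by_cases h : n ∈ s
        · exact Or.inl ⟨n, h, hn⟩
        · exact Or.inr ⟨n, h, hn⟩
      · rintro (⟨n, -, hn⟩ | ⟨n, -, hn⟩) <;> exact ⟨n, hn⟩
    rw [c.sum_indicatorOp h1 hB hd, hU, edist_eq_enorm_sub, sub_add_cancel_left, enorm_neg,
      c.enorm_indicatorOp_sq]
    exact measure_iUnion_le _
  have := ((ENNReal.continuous_rpow_const (y := (1 / 2 : ℝ))).tendsto 0).comp hsq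
  rw [ENNReal.zero_rpow_of_pos (by norm_num)] at this
  refine this.congr fun s => ?_
  rw [Function.comp_apply, ← ENNReal.rpow_natCast, ← ENNReal.rpow_mul]
  norm_num

/-- The projection-valued measure on `ℝ` obtained from a calculus on `X` by a measurable map. -/
def toPVM (h1 : rel 1 1) (κ : X → ℝ) (hκ : Measurable κ) : ProjectionValuedMeasure 𝓗 where
  proj B := open scoped Classical in
    if hB : MeasurableSet B then c.indicatorOp h1 (κ ⁻¹' B) (hκ hB) else 0
  symmetric B hB φ ψ := by
    simp only [dif_pos hB]
    exact c.indicatorOp_symmetric h1 _ φ ψ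
  inter B C hB hC ψ := by
    simp only [dif_pos hB, dif_pos hC, dif_pos (hB.inter hC)]
    exact c.indicatorOp_inter h1 (hκ hB) (hκ hC) ψ
  univ ψ := by
    simp only [dif_pos MeasurableSet.univ]
    exact c.indicatorOp_univ h1 ψ
  iUnion B hB hd ψ := by
    simp only [dif_pos (MeasurableSet.iUnion hB), Set.preimage_iUnion]
    convert c.hasSum_indicatorOp h1 (fun n => hκ (hB n)) (fun m n h => (hd h).preimage κ) ψ using 3
      with n
    exact dif_pos (hB n)
  notMeasurable B hB := dif_neg hB

theorem diagMeasure_toPVM (h1 : rel 1 1) {κ : X → ℝ} (hκ : Measurable κ) (ψ : 𝓗) :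
    (c.toPVM h1 κ hκ).diagMeasure ψ = (μ ψ).map κ := by
  ext B hB
  rw [ProjectionValuedMeasure.diagMeasure_apply _ ψ hB, Measure.map_apply hκ hB,
    ← c.enorm_indicatorOp_sq h1 (hκ hB)]
  simp only [toPVM, dif_pos hB]

end IsCalculus

end Pushforward

end TimeOp

end

/-! ### The spectral theorem for unbounded self-adjoint operators. -/

section

namespace TimeOp

open scoped InnerProductSpace

variable {𝓗 : Type*} [NormedAddCommGroup 𝓗] [InnerProductSpace ℂ 𝓗]

theorem isSpectralIntegral_spectralMeasure {A : 𝓗 →ₗ.[ℂ] 𝓗}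
    (h : ∃ P : ProjectionValuedMeasure 𝓗, P.IsSpectralIntegral (fun x => (x : ℂ)) A) :
    (spectralMeasure A).IsSpectralIntegral (fun x => (x : ℂ)) A :=
  Classical.epsilon_spec h

theorem resolvent_identity {A : 𝓗 →ₗ.[ℂ] 𝓗} {c d : ℂ} {R S : 𝓗 →L[ℂ] 𝓗}
    (hR : ∀ ψ : 𝓗, ∃ h : R ψ ∈ A.domain, A ⟨R ψ, h⟩ + c • R ψ = ψ)
    (hS : ∀ ψ : A.domain, S (A ψ + d • (ψ : 𝓗)) = ψ) : S - R = (c - d) • (S * R) := by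
  ext ψ
  obtain ⟨h1, h2⟩ := hR ψ
  have h3 := hS ⟨R ψ, h1⟩
  have h4 : A ⟨R ψ, h1⟩ + d • R ψ = ψ - (c - d) • R ψ := by
    rw [sub_smul, eq_sub_of_add_eq h2]
    abel
  simp only at h3
  rw [h4, map_sub, map_smul] at h3
  exact sub_eq_of_eq_add (eq_add_of_sub_eq' h3)

variable [CompleteSpace 𝓗]

theorem resolvent_adjoint {A : 𝓗 →ₗ.[ℂ] 𝓗} (hA : IsSelfAdjoint A) {c : ℂ} (hc : star c = -c)
    {R S : 𝓗 →L[ℂ] 𝓗} (hR : ∀ ψ : 𝓗, ∃ h : R ψ ∈ A.domain, A ⟨R ψ, h⟩ + c • R ψ = ψ)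
    (hS : ∀ ψ : 𝓗, ∃ h : S ψ ∈ A.domain, A ⟨S ψ, h⟩ + (-c) • S ψ = ψ) : star R = S := by
  rw [ContinuousLinearMap.star_eq_adjoint]
  symm
  rw [ContinuousLinearMap.eq_adjoint_iff]
  intro φ ψ
  obtain ⟨h1, h2⟩ := hS φ
  obtain ⟨h3, h4⟩ := hR ψ
  have hc' : (starRingEnd ℂ) c = -c := hc
  conv_lhs => rw [← h4]
  conv_rhs => rw [← h2]
  rw [inner_add_right, inner_add_left, inner_smul_right, inner_smul_left, map_neg, hc', neg_neg]
  congr 1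
  exact (inner_apply_comm hA ⟨_, h1⟩ ⟨_, h3⟩).symm

/-- The spectral theorem for unbounded self-adjoint operators. -/
theorem exists_isSpectralIntegral {A : 𝓗 →ₗ.[ℂ] 𝓗} (hA : IsSelfAdjoint A) :
    ∃ P : ProjectionValuedMeasure 𝓗, P.IsSpectralIntegral (fun x => (x : ℂ)) A := by
  obtain ⟨R, hR1, hR2⟩ := exists_resolvent hA (c := Complex.I) (by simp) (by simp)
  obtain ⟨S, hS1, hS2⟩ := exists_resolvent hA (c := -Complex.I) (by simp) (by simp)
  have hstar : star R = S := resolvent_adjoint hA (by simp) hR1 hS1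
  have e1 : R - S = (-Complex.I - Complex.I) • (R * S) := resolvent_identity hS1 hR2
  have e2 : S - R = (Complex.I - -Complex.I) • (S * R) := resolvent_identity hR1 hS2
  -- The two resolvent identities express `R* R` and `R R*` by the same difference `R* - R`.
  have hnorm : IsStarNormal R := by
    refine ⟨?_⟩
    rw [hstar]
    have h2 : (2 * Complex.I) • (S * R) = (2 * Complex.I) • (R * S) := by
      have h3 : (2 * Complex.I) • (S * R) = S - R := by rw [e2]; congr 1; ring
      have h4 : (-(2 * Complex.I)) • (R * S) = R - S := by rw [e1]; congr 1; ring
      rw [h3, ← neg_sub R S, ← h4, neg_smul, neg_neg]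
    exact smul_right_injective _ (by simp : (2 * Complex.I) ≠ 0) h2
  set Φ := cfcHom (R := ℂ) hnorm with hΦ
  set z : C(spectrum ℂ R, ℂ) := (ContinuousMap.id ℂ).restrict (spectrum ℂ R) with hz
  have hzapp : ∀ x, z x = (x : ℂ) := fun _ => rfl
  have hΦz : Φ z = R := cfcHom_id hnorm
  -- The identity `R - R* = -2i R R*`, read on the spectrum of `R`, says that `z⁻¹` has imaginary
  -- part `1` wherever `z ≠ 0`.
  have hzrel : z - star z = (-Complex.I - Complex.I) • (z * star z) := by
    refine cfcHom_injective hnorm ?_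
    rw [map_sub, map_smul, map_mul, map_star, ← hΦ, hΦz, hstar, e1]
  have hre : ∀ x : spectrum ℂ R, (x : ℂ) ≠ 0 → (((x : ℂ)⁻¹.re : ℝ) : ℂ) + Complex.I = (x : ℂ)⁻¹ := by
    intro x hx
    have h1 := DFunLike.congr_fun hzrel x
    simp only [ContinuousMap.sub_apply, ContinuousMap.star_apply, ContinuousMap.smul_apply,
      ContinuousMap.mul_apply, hzapp, RCLike.star_def, smul_eq_mul] at h1
    have h2 : (starRingEnd ℂ) (x : ℂ) ≠ 0 := by simpa using hx
    have h3 : (x : ℂ)⁻¹ - (starRingEnd ℂ) ((x : ℂ)⁻¹) = 2 * Complex.I := by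
      rw [map_inv₀]
      field_simp
      linear_combination -h1
    have h4 := congrArg Complex.im h3
    simp only [Complex.sub_im, Complex.conj_im, Complex.mul_im, Complex.I_im, Complex.I_re] at h4
    norm_num at h4
    have h5 : ((x : ℂ)⁻¹).im = 1 := by
      rw [Complex.inv_im]
      linarith
    conv_rhs => rw [← Complex.re_add_im ((x : ℂ)⁻¹), h5]
    simp
  obtain ⟨μ, c⟩ := exists_isCalculus_of_starAlgHom Φ
  set rel := fun (h : spectrum ℂ R → ℂ) (T : 𝓗 →L[ℂ] 𝓗) => ∃ g : C(spectrum ℂ R, ℂ), h = g ∧ T = Φ g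
  have h1 : rel 1 1 := ⟨1, rfl, (map_one Φ).symm⟩
  have hrz : rel z R := ⟨z, rfl, hΦz.symm⟩
  -- Since `A = R⁻¹ - i`, the spectral variable of `A` is `z⁻¹ - i`, that is, the real part of
  -- `z⁻¹`.
  let κ : spectrum ℂ R → ℝ := fun x => ((x : ℂ)⁻¹).re
  have hinvm : Measurable fun x : spectrum ℂ R => (x : ℂ)⁻¹ := measurable_subtype_coe.inv
  have hκ : Measurable κ := Complex.measurable_re.comp hinvm
  have hinj : ∀ ψ, R ψ = 0 → ψ = 0 := fun ψ h => by
    obtain ⟨h2, h3⟩ := hR1 ψ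
    have h4 : (⟨R ψ, h2⟩ : A.domain) = 0 := Subtype.ext h
    rw [← h3, h4, LinearPMap.map_zero, h, smul_zero, add_zero]
  -- Injectivity of `R` removes the point `z = 0`, where `z⁻¹` has the default value `0`.
  have hnull : ∀ ψ, ∀ᵐ x : spectrum ℂ R ∂(μ ψ), (x : ℂ) ≠ 0 := by
    intro ψ
    have hms : MeasurableSet {x : spectrum ℂ R | (x : ℂ) = 0} :=
      measurable_subtype_coe (measurableSet_singleton 0)
    have h2 : R (c.indicatorOp h1 _ hms ψ) = 0 := by
      rw [c.indicatorOp_apply, c.apply_calcInt hrz (c.memLp_indicator hms ψ)]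
      have h3 : (z : spectrum ℂ R → ℂ) * ({x : spectrum ℂ R | (x : ℂ) = 0}.indicator fun _ => 1) = 0 := by
        ext x
        by_cases hx : (x : ℂ) = 0 <;> simp [hx, hzapp]
      rw [h3, c.calcInt_rel c.zero]
      rfl
    have h4 := c.enorm_indicatorOp_sq h1 hms ψ
    rw [hinj _ h2] at h4
    rw [ae_iff]
    simp only [not_not]
    rw [← h4]
    simp
  have hfin := c.finite
  set g : spectrum ℂ R → ℂ := fun x => (x : ℂ)⁻¹ with hg
  have hgκ : ∀ ψ, ∀ᵐ x ∂(μ ψ), g x = (κ x : ℂ) + Complex.I := fun ψ => by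
    filter_upwards [hnull ψ] with x hx
    exact (hre x hx).symm
  have hgz : ∀ ψ, ((z : spectrum ℂ R → ℂ) * g) =ᵐ[μ ψ] 1 := fun ψ => by
    filter_upwards [hnull ψ] with x hx
    exact mul_inv_cancel₀ hx
  have hgmem : ∀ ψ, MemLp (fun x => (κ x : ℂ)) 2 (μ ψ) ↔ MemLp g 2 (μ ψ) := by
    intro ψ
    rw [memLp_congr_ae (hgκ ψ)]
    constructor
    · intro h
      exact h.add (memLp_const Complex.I)
    · intro h
      have := h.sub (memLp_const (μ := μ ψ) Complex.I)
      convert this using 1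
      ext x
      simp
  -- `D(A)` is the range of `R`. On `R χ` the factor `z` cancels `z⁻¹`; conversely `ψ = R (g(R) ψ)`
  -- whenever `g(R) ψ` is defined.
  have hdom : ∀ ψ, ψ ∈ A.domain ↔ MemLp g 2 (μ ψ) := by
    intro ψ
    constructor
    · intro hψ
      have h2 := hR2 ⟨ψ, hψ⟩
      simp only at h2
      rw [← h2, ← c.calcInt_rel hrz, c.memLp_calcInt_iff z.continuous.measurable
        (c.memLp hrz _ _) hinvm, mul_comm, memLp_congr_ae (hgz _)]
      exact memLp_const 1
    · intro hψ
      have h2 : R (calcInt rel μ g ψ) = ψ := by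
        rw [c.apply_calcInt hrz hψ, calcInt_congr (hgz ψ), c.calcInt_rel h1]
        rfl
      rw [← h2]
      exact (hR1 _).1
  have happ : ∀ ψ : A.domain, A ψ = calcInt rel μ g ψ - Complex.I • (ψ : 𝓗) := by
    intro ψ
    have h2 := hR2 ψ
    set χ := A ψ + Complex.I • (ψ : 𝓗) with hχ
    have h3 : calcInt rel μ g ψ = χ := by
      rw [← h2, ← c.calcInt_rel hrz, c.calcInt_calcInt z.continuous.measurable (c.memLp hrz _ _) hinvm,
        mul_comm, calcInt_congr (hgz χ), c.calcInt_rel h1]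
      · rfl
      · rw [mul_comm, memLp_congr_ae (hgz _)]
        exact memLp_const 1
    rw [h3, hχ, add_sub_cancel_right]
  refine ⟨c.toPVM h1 κ hκ, fun ψ => ?_, fun ψ => ?_⟩
  · rw [hdom, ← hgmem, c.diagMeasure_toPVM h1 hκ, lintegral_map (by fun_prop) hκ,
      memLp_two_iff_lintegral (by fun_prop)]
  · have hψ := (hdom ψ).1 ψ.2
    rw [c.diagMeasure_toPVM h1 hκ, integral_map hκ.aemeasurable (by fun_prop), happ, inner_sub_right,
      c.inner_calcInt_self hψ, inner_smul_right]
    have h2 : ⟪(ψ : 𝓗), (ψ : 𝓗)⟫_ℂ = ∫ x, (1 : ℂ) ∂(μ ψ) := by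
      have := c.inner h1 ψ
      rwa [one_apply_eq_self] at this
    rw [h2, ← integral_const_mul, ← integral_sub (hψ.integrable (by norm_num)) (by simp)]
    refine integral_congr_ae ?_
    filter_upwards [hgκ ψ] with x hx
    rw [hx]
    simp

end TimeOp

end

/-! ### Uniqueness of the spectral measure, reducing subspaces, spectra and eigenvectors. -/

section

namespace TimeOp

open scoped InnerProductSpace BoundedContinuousFunction

variable {𝓗 : Type*} [NormedAddCommGroup 𝓗] [InnerProductSpace ℂ 𝓗]

theorem mem_eigenspace_iff {A : 𝓗 →ₗ.[ℂ] 𝓗} {x : ℝ} {v : 𝓗} :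
    v ∈ eigenspace A x ↔ ∃ h : v ∈ A.domain, A ⟨v, h⟩ = (x : ℂ) • v :=
  ⟨fun ⟨h, _, h2⟩ => ⟨h, h2⟩, fun ⟨h, h2⟩ => ⟨h, Submodule.mem_top, h2⟩⟩

namespace ProjectionValuedMeasure

theorem int_congr (P : ProjectionValuedMeasure 𝓗) {f g : ℝ → ℂ} {ψ : 𝓗}
    (h : f =ᵐ[P.diagMeasure ψ] g) : P.int f ψ = P.int g ψ :=
  calcInt_congr h

theorem memLp_const (P : ProjectionValuedMeasure 𝓗) (a : ℂ) (ψ : 𝓗) :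
    MemLp (fun _ => a) 2 (P.diagMeasure ψ) := MeasureTheory.memLp_const a

/-- The restriction of a projection-valued measure to a closed reducing subspace. -/
def restrict (P : ProjectionValuedMeasure 𝓗) (M : Submodule ℂ 𝓗)
    (hM : ∀ B, ∀ ψ ∈ M, P.proj B ψ ∈ M) : ProjectionValuedMeasure M where
  proj B := ((P.proj B).comp M.subtypeL).codRestrict M fun ψ => hM B ψ ψ.2
  symmetric B hB φ ψ := P.symmetric B hB φ ψ
  inter B C hB hC ψ := Subtype.ext (P.inter B C hB hC ψ)
  univ ψ := Subtype.ext (P.univ ψ)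
  iUnion B hB hd ψ := by
    have h := P.iUnion B hB hd ψ
    rw [HasSum, tendsto_subtype_rng]
    refine h.congr fun s => ?_
    simp only [Submodule.coe_sum]
    rfl
  notMeasurable B hB := by
    ext ψ
    simp [P.notMeasurable B hB]

section Restrict

variable (P : ProjectionValuedMeasure 𝓗) {M : Submodule ℂ 𝓗} (hM : ∀ B, ∀ ψ ∈ M, P.proj B ψ ∈ M)

theorem diagMeasure_restrict (ψ : M) :
    (P.restrict M hM).diagMeasure ψ = P.diagMeasure (ψ : 𝓗) := by
  ext B hB
  rw [diagMeasure_apply _ _ hB, diagMeasure_apply _ _ hB]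
  rfl

theorem exists_rel_of_restrict {h : ℝ → ℂ} {T : M →L[ℂ] M} (hT : (P.restrict M hM).Rel h T) :
    ∃ S, P.Rel h S ∧ ∀ ψ : M, (T ψ : 𝓗) = S ψ := by
  induction hT with
  | ind B hB => exact ⟨P.proj B, Rel.ind B hB, fun ψ => rfl⟩
  | add _ _ h1 h2 =>
    obtain ⟨S, hS, hS'⟩ := h1
    obtain ⟨S', hS1, hS1'⟩ := h2
    exact ⟨S + S', hS.add hS1, fun ψ => by simp [hS', hS1']⟩
  | smul a _ h1 =>
    obtain ⟨S, hS, hS'⟩ := h1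
    exact ⟨a • S, hS.smul a, fun ψ => by simp [hS']⟩

end Restrict

end ProjectionValuedMeasure

variable [CompleteSpace 𝓗]

theorem eq_of_add_smul_eq {A : 𝓗 →ₗ.[ℂ] 𝓗} (hA : IsSelfAdjoint A) {c : ℂ} (hc : star c = -c)
    (hc1 : ‖c‖ = 1) {v w : A.domain} (h : A v + c • (v : 𝓗) = A w + c • (w : 𝓗)) : v = w := by
  have h1 := norm_sq_add_smul hA hc hc1 (v - w)
  have h2 : A (v - w) + c • ((v - w : A.domain) : 𝓗) = 0 := by
    rw [LinearPMap.map_sub, Submodule.coe_sub, smul_sub, ← sub_eq_zero.2 h]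
    abel
  rw [h2, norm_zero] at h1
  have h3 : ‖((v - w : A.domain) : 𝓗)‖ = 0 := by
    nlinarith [sq_nonneg ‖A (v - w)‖, norm_nonneg ((v - w : A.domain) : 𝓗)]
  exact sub_eq_zero.1 (Subtype.ext (norm_eq_zero.1 h3))

namespace ProjectionValuedMeasure

theorem enorm_int (P : ProjectionValuedMeasure 𝓗) {f : ℝ → ℂ} {ψ : 𝓗}
    (hf : MemLp f 2 (P.diagMeasure ψ)) : ‖P.int f ψ‖ₑ = eLpNorm f 2 (P.diagMeasure ψ) :=
  P.isCalculus.enorm_calcInt hf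

theorem int_add (P : ProjectionValuedMeasure 𝓗) {f g : ℝ → ℂ} {ψ : 𝓗}
    (hf : MemLp f 2 (P.diagMeasure ψ)) (hg : MemLp g 2 (P.diagMeasure ψ)) :
    P.int (f + g) ψ = P.int f ψ + P.int g ψ :=
  P.isCalculus.calcInt_add hf hg

theorem int_sub (P : ProjectionValuedMeasure 𝓗) {f g : ℝ → ℂ} {ψ : 𝓗}
    (hf : MemLp f 2 (P.diagMeasure ψ)) (hg : MemLp g 2 (P.diagMeasure ψ)) :
    P.int (f - g) ψ = P.int f ψ - P.int g ψ :=
  P.isCalculus.calcInt_sub hf hg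

theorem int_smul (P : ProjectionValuedMeasure 𝓗) (a : ℂ) {f : ℝ → ℂ} {ψ : 𝓗}
    (hf : MemLp f 2 (P.diagMeasure ψ)) : P.int (a • f) ψ = a • P.int f ψ :=
  P.isCalculus.calcInt_smul a hf

theorem int_one (P : ProjectionValuedMeasure 𝓗) (ψ : 𝓗) : P.int 1 ψ = ψ := by
  have := P.int_indicator MeasurableSet.univ ψ
  rw [P.univ, Set.indicator_univ] at this
  exact this

theorem int_const (P : ProjectionValuedMeasure 𝓗) (a : ℂ) (ψ : 𝓗) :
    P.int (fun _ => a) ψ = a • ψ := by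
  have h1 : (fun _ : ℝ => a) = a • (1 : ℝ → ℂ) := by
    ext
    simp
  have h2 : MemLp (1 : ℝ → ℂ) 2 (P.diagMeasure ψ) := P.memLp_const 1 ψ
  rw [h1, P.int_smul a h2, P.int_one]

/-- The bounded operator `∫ f dE` for a bounded Borel function `f`. -/
def boundedOp (P : ProjectionValuedMeasure 𝓗) (f : ℝ → ℂ) (hf : Measurable f) (C : ℝ)
    (hC : ∀ x, ‖f x‖ ≤ C) : 𝓗 →L[ℂ] 𝓗 :=
  LinearMap.mkContinuous
    { toFun := P.int f
      map_add' := fun φ ψ => P.isCalculus.calcInt_vadd (P.memLp_of_bound hf hC φ)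
        (P.memLp_of_bound hf hC ψ) (P.memLp_of_bound hf hC _)
      map_smul' := fun a ψ => P.isCalculus.calcInt_vsmul a (P.memLp_of_bound hf hC ψ)
        (P.memLp_of_bound hf hC _) } C (fun ψ => by
    have h0 : 0 ≤ C := (norm_nonneg _).trans (hC 0)
    have h1 := P.enorm_int (P.memLp_of_bound hf hC ψ)
    have h2 : eLpNorm f 2 (P.diagMeasure ψ) ≤ ENNReal.ofReal C * eLpNorm (1 : ℝ → ℂ) 2 (P.diagMeasure ψ) :=
      eLpNorm_le_mul_eLpNorm_of_ae_le_mul (ae_of_all _ fun x => by simpa using hC x) 2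
    have h3 := P.enorm_int (P.memLp_const 1 ψ)
    have h4 : P.int (fun _ => 1) ψ = ψ := P.int_one ψ
    rw [h4] at h3
    change ‖P.int f ψ‖ ≤ C * ‖ψ‖
    rw [← ENNReal.ofReal_le_ofReal_iff (by positivity), ENNReal.ofReal_mul h0, ofReal_norm,
      ofReal_norm, h1, h3]
    exact h2)

theorem isSelfAdjoint_ofReal (P : ProjectionValuedMeasure 𝓗) {f : ℝ → ℝ} (hf : Measurable f) :
    IsSelfAdjoint (P.operator fun x => (f x : ℂ)) :=
  P.isSelfAdjoint_operator (by fun_prop) (by ext x; simp)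

theorem ofReal_add_I_ne_zero (x : ℝ) : (x : ℂ) + Complex.I ≠ 0 := fun h => by
  simpa using congrArg Complex.im h

theorem norm_inv_add_I_le (x : ℝ) : ‖((x : ℂ) + Complex.I)⁻¹‖ ≤ 1 := by
  rw [norm_inv]
  refine inv_le_one_of_one_le₀ ?_
  simpa using Complex.abs_im_le_norm ((x : ℂ) + Complex.I)

theorem resolvent_eq (P : ProjectionValuedMeasure 𝓗) (ψ : 𝓗) :
    ∃ h : P.int (fun x => ((x : ℂ) + Complex.I)⁻¹) ψ ∈ (P.operator fun x => (x : ℂ)).domain,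
      P.operator (fun x => (x : ℂ)) ⟨_, h⟩ +
        Complex.I • P.int (fun x => ((x : ℂ) + Complex.I)⁻¹) ψ = ψ := by
  have hm : Measurable fun x : ℝ => ((x : ℂ) + Complex.I)⁻¹ := by fun_prop
  have hb := P.memLp_of_bound hm norm_inv_add_I_le ψ
  have heq : (fun x : ℝ => (x : ℂ)) * (fun x : ℝ => ((x : ℂ) + Complex.I)⁻¹) +
      Complex.I • (fun x : ℝ => ((x : ℂ) + Complex.I)⁻¹) = 1 := by
    ext x
    have := ofReal_add_I_ne_zero x
    simp only [Pi.add_apply, Pi.mul_apply, Pi.smul_apply, smul_eq_mul, Pi.one_apply]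
    field_simp
  have h1 : MemLp ((fun x : ℝ => (x : ℂ)) * (fun x : ℝ => ((x : ℂ) + Complex.I)⁻¹)) 2
      (P.diagMeasure ψ) := by
    rw [eq_sub_of_add_eq heq]
    exact (P.memLp_const 1 ψ).sub (hb.const_smul _)
  refine ⟨(P.isCalculus.memLp_calcInt_iff hm hb (by fun_prop)).2 h1, ?_⟩
  rw [operator_apply]
  simp only
  rw [P.int_int hm hb (by fun_prop) h1, ← P.int_smul _ hb, ← P.int_add h1 (hb.const_smul _), heq,
    P.int_one]

/-- The spectral measure of a self-adjoint operator is unique. -/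
theorem eq_of_operator_eq {P Q : ProjectionValuedMeasure 𝓗}
    (h : P.operator (fun x => (x : ℂ)) = Q.operator fun x => (x : ℂ)) : P = Q := by
  have hA : IsSelfAdjoint (P.operator fun x => (x : ℂ)) := P.isSelfAdjoint_ofReal measurable_id
  set A := P.operator fun x => (x : ℂ) with hAdef
  have hm : Measurable fun x : ℝ => ((x : ℂ) + Complex.I)⁻¹ := by fun_prop
  -- Both sides are the unique solution `v ∈ D(A)` of `A v + i v = ψ`.
  have hres : ∀ ψ, P.int (fun x => ((x : ℂ) + Complex.I)⁻¹) ψ =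
      Q.int (fun x => ((x : ℂ) + Complex.I)⁻¹) ψ := by
    intro ψ
    obtain ⟨h1, h2⟩ := P.resolvent_eq ψ
    obtain ⟨h3, h4⟩ := Q.resolvent_eq ψ
    have h5 : ∃ h : Q.int (fun x => ((x : ℂ) + Complex.I)⁻¹) ψ ∈ A.domain, A ⟨_, h⟩ +
        Complex.I • Q.int (fun x => ((x : ℂ) + Complex.I)⁻¹) ψ = ψ := by
      rw [h]
      exact ⟨h3, h4⟩
    obtain ⟨h6, h7⟩ := h5
    exact congrArg Subtype.val (eq_of_add_smul_eq hA (c := Complex.I) (v := ⟨_, h1⟩) (w := ⟨_, h6⟩)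
      (by simp) (by simp) (h2.trans h7.symm))
  let r : ℝ →ᵇ ℂ := BoundedContinuousFunction.ofNormedAddCommGroup
    (fun x : ℝ => ((x : ℂ) + Complex.I)⁻¹)
    (Continuous.inv₀ (by fun_prop) ofReal_add_I_ne_zero) 1 norm_inv_add_I_le
  have hbd : ∀ (S : ProjectionValuedMeasure 𝓗) (g : ℝ →ᵇ ℂ) (ψ : 𝓗), MemLp g 2 (S.diagMeasure ψ) :=
    fun S g ψ => S.memLp_of_bound g.continuous.measurable g.norm_coe_le_norm ψ
  have key : ∀ g ∈ StarAlgebra.adjoin ℂ {r}, ∀ ψ, P.int g ψ = Q.int g ψ := by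
    intro g hg
    induction hg using StarAlgebra.adjoin_induction with
    | mem x hx =>
      rw [Set.mem_singleton_iff.1 hx]
      exact hres
    | algebraMap a =>
      intro ψ
      exact (P.int_const a ψ).trans (Q.int_const a ψ).symm
    | add x y _ _ h1 h2 =>
      intro ψ
      rw [BoundedContinuousFunction.coe_add, P.int_add (hbd P x ψ) (hbd P y ψ),
        Q.int_add (hbd Q x ψ) (hbd Q y ψ), h1, h2]
    | mul x y _ _ h1 h2 =>
      intro ψ
      rw [BoundedContinuousFunction.coe_mul,
        ← P.int_int y.continuous.measurable (hbd P y ψ) x.continuous.measurable (hbd P (x * y) ψ),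
        ← Q.int_int y.continuous.measurable (hbd Q y ψ) x.continuous.measurable (hbd Q (x * y) ψ),
        h1, h2]
    | star x _ h1 =>
      intro ψ
      refine ext_inner_left ℂ fun φ => ?_
      have e1 := P.inner_int_left (hbd P x φ) (hbd P x ψ)
      have e2 := Q.inner_int_left (hbd Q x φ) (hbd Q x ψ)
      rw [BoundedContinuousFunction.coe_star, ← e1, ← e2, h1]
  -- The star algebra generated by `(x + i)⁻¹` separates points, so finite measures that agree on it
  -- are equal; polarization then recovers the projections.
  have hsep : ((StarAlgebra.adjoin ℂ {r}).map
      (BoundedContinuousFunction.toContinuousMapStarₐ ℂ)).SeparatesPoints := by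
    intro x y hxy
    refine ⟨r, ⟨_, ⟨r, StarAlgebra.subset_adjoin ℂ _ rfl, rfl⟩, rfl⟩, fun h1 => hxy ?_⟩
    have h2 : ((x : ℂ) + Complex.I)⁻¹ = ((y : ℂ) + Complex.I)⁻¹ := h1
    have h3 := add_right_cancel (inv_injective h2)
    exact_mod_cast h3
  have hdiag : ∀ ψ, P.diagMeasure ψ = Q.diagMeasure ψ := fun ψ =>
    ext_of_forall_mem_subalgebra_integral_eq_of_pseudoEMetric_complete_countable hsep fun g hg => by
      have e1 := P.isCalculus.inner_calcInt_self (hbd P g ψ)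
      have e2 := Q.isCalculus.inner_calcInt_self (hbd Q g ψ)
      rw [← e1, ← e2]
      exact congrArg _ (key g hg ψ)
  have hproj : P.proj = Q.proj := by
    ext1 B
    by_cases hB : MeasurableSet B
    · ext ψ
      have := eq_zero_of_quadratic_form (LinearMap.id : 𝓗 →ₗ[ℂ] 𝓗)
        ((P.proj B - Q.proj B : 𝓗 →L[ℂ] 𝓗) : 𝓗 →ₗ[ℂ] 𝓗) (by simp [Set.range_id]) (fun φ => by
          have e1 := P.integral_indicator_diagMeasure hB φ
          have e2 := Q.integral_indicator_diagMeasure hB φ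
          rw [← hdiag φ, e1] at e2
          simp [e2]) ψ
      simpa [sub_eq_zero] using this
    · rw [P.notMeasurable B hB, Q.notMeasurable B hB]
  cases P
  cases Q
  simp only at hproj
  subst hproj
  rfl

theorem spectralMeasure_operator (P : ProjectionValuedMeasure 𝓗) :
    spectralMeasure (P.operator fun x => (x : ℂ)) = P := by
  have h1 := isSpectralIntegral_spectralMeasure
    ⟨P, P.isSpectralIntegral_operator Complex.measurable_ofReal⟩
  exact (eq_of_operator_eq (h1.eq_operator Complex.measurable_ofReal)).symm

section Restrict

variable (P : ProjectionValuedMeasure 𝓗) {M : Submodule ℂ 𝓗} (hM : ∀ B, ∀ ψ ∈ M, P.proj B ψ ∈ M)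

theorem coe_int_restrict [CompleteSpace M] {f : ℝ → ℂ} {ψ : M}
    (hf : MemLp f 2 (P.diagMeasure (ψ : 𝓗))) :
    ((P.restrict M hM).int f ψ : 𝓗) = P.int f ψ := by
  have hf' : MemLp f 2 ((P.restrict M hM).diagMeasure ψ) := by rwa [P.diagMeasure_restrict hM]
  obtain ⟨h, T, hT, hn⟩ := (P.restrict M hM).isCalculus.exists_seq _ hf'
  choose S hS hST using fun n => P.exists_rel_of_restrict hM (hT n)
  have l1 := (continuous_subtype_val.tendsto _).comp
    ((P.restrict M hM).isCalculus.tendsto_calcInt hf' hT hn)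
  rw [P.diagMeasure_restrict hM] at hn
  have l2 := P.isCalculus.tendsto_calcInt hf hS hn
  exact tendsto_nhds_unique l1 (l2.congr fun n => (hST n ψ).symm)

/-- Exhibits the restricted projection-valued measure as the spectral measure of the reduced part,
so that everything shown for `operator` applies to `A_ac` and `A_sc`. -/
theorem reducedPart_operator [CompleteSpace M] (f : ℝ → ℂ) :
    reducedPart (P.operator f) M = (P.restrict M hM).operator f := by
  refine LinearPMap.ext ?_ ?_
  · ext ψ
    rw [mem_operator_domain, P.diagMeasure_restrict hM]
    constructor
    · rintro ⟨h, -⟩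
      exact h
    · intro h
      refine ⟨h, ?_⟩
      rw [operator_apply]
      simp only
      rw [← P.coe_int_restrict hM h]
      exact Subtype.property _
  · intro ψ h1 h2
    refine Subtype.ext ?_
    refine Eq.trans ?_ (P.coe_int_restrict hM h1.1).symm
    rfl

end Restrict

theorem expNegI_operator (P : ProjectionValuedMeasure 𝓗) (t : ℝ) (ψ : 𝓗) :
    expNegI (P.operator fun x => (x : ℂ)) t ψ =
      P.int (fun x => Complex.exp (-(Complex.I * t * x))) ψ := by
  set e : ℝ → ℂ := fun x => Complex.exp (-(Complex.I * t * x)) with he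
  have hm : Measurable e := by fun_prop
  have hb : ∀ x, ‖e x‖ ≤ 1 := fun x => by
    rw [he]
    simp only
    rw [show -(Complex.I * t * x) = ((-(t * x) : ℝ) : ℂ) * Complex.I by push_cast; ring,
      Complex.norm_exp_ofReal_mul_I]
  have hex : ∃ U : 𝓗 →L[ℂ] 𝓗, P.IsSpectralIntegral e ((U : 𝓗 →ₗ[ℂ] 𝓗).toPMap ⊤) := by
    refine ⟨P.boundedOp e hm 1 hb, fun φ => ?_, fun φ => ?_⟩
    · rw [← memLp_two_iff_lintegral hm.aestronglyMeasurable]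
      exact ⟨fun _ => P.memLp_of_bound hm hb φ, fun _ => Submodule.mem_top⟩
    · exact P.isCalculus.inner_calcInt_self (P.memLp_of_bound hm hb _)
  have h1 := Classical.epsilon_spec hex
  have h2 := h1.eq_operator hm
  have h3 : expNegI (P.operator fun x => (x : ℂ)) t =
      Classical.epsilon fun U : 𝓗 →L[ℂ] 𝓗 => P.IsSpectralIntegral e ((U : 𝓗 →ₗ[ℂ] 𝓗).toPMap ⊤) := by
    rw [expNegI, spectralMeasure_operator]
  rw [← h3] at h2
  have h4 : ∀ (B : 𝓗 →ₗ.[ℂ] 𝓗) (hB : B = P.operator e) (hψ : ψ ∈ B.domain), B ⟨ψ, hψ⟩ = P.int e ψ := by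
    rintro _ rfl _
    rfl
  exact h4 _ h2 Submodule.mem_top

/-- Near a point `x` with resolvent `R`, a vector `v` in the range of `E(ball x ε)` satisfies `‖v‖ =
‖R (A - x) v‖ ≤ ‖R‖ ε ‖v‖`, hence vanishes once `‖R‖ ε < 1`. So every spectral measure is locally
null. -/
theorem eq_zero_of_spec_eq_empty (P : ProjectionValuedMeasure 𝓗)
    (h : spec (P.operator fun x => (x : ℂ)) = ∅) (ψ : 𝓗) : ψ = 0 := by
  refine P.eq_zero_of_diagMeasure ?_
  rw [← Measure.measure_univ_eq_zero]
  refine measure_null_of_locally_null _ fun x _ => ?_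
  have hx : (x : ℂ) ∈ resolventSet (P.operator fun x => (x : ℂ)) := by
    by_contra hx
    exact (Set.eq_empty_iff_forall_notMem.1 h x) hx
  obtain ⟨R, -, hR⟩ := hx
  set ε : ℝ := (‖R‖ + 1)⁻¹ with hε
  have hε0 : 0 < ε := by positivity
  refine ⟨Metric.ball x ε, mem_nhdsWithin_of_mem_nhds (Metric.ball_mem_nhds x hε0), ?_⟩
  have hB : MeasurableSet (Metric.ball x ε) := measurableSet_ball
  rw [← P.proj_eq_zero_iff hB]
  set v := P.proj (Metric.ball x ε) ψ with hv
  have hind : Measurable ((Metric.ball x ε).indicator fun _ => (1 : ℂ)) :=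
    measurable_const.indicator hB
  have hindm : MemLp ((Metric.ball x ε).indicator fun _ => (1 : ℂ)) 2 (P.diagMeasure ψ) :=
    (P.memLp_const 1 ψ).indicator hB
  have hv' : P.int ((Metric.ball x ε).indicator fun _ => 1) ψ = v := P.int_indicator hB ψ
  have hvd : v ∈ (P.operator fun x => (x : ℂ)).domain :=
    P.proj_mem_operator_domain Complex.measurable_ofReal hB (C := |x| + ε) (fun y hy => by
      have h1 : |y - x| < ε := hy
      have h2 : |y| ≤ |x| + |y - x| := by
        have := abs_add_le x (y - x)
        rwa [add_sub_cancel] at this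
      rw [Complex.norm_real, Real.norm_eq_abs]
      linarith) ψ
  have h1 := hR ⟨v, hvd⟩
  rw [operator_apply] at h1
  simp only at h1
  have hsubm : MemLp ((fun y : ℝ => (y : ℂ)) - fun _ => (x : ℂ)) 2 (P.diagMeasure v) :=
    hvd.sub (P.memLp_const _ v)
  have hm' : Measurable ((fun y : ℝ => (y : ℂ)) - fun _ => (x : ℂ)) :=
    Complex.measurable_ofReal.sub measurable_const
  rw [← P.int_const (x : ℂ) v, ← P.int_sub hvd (P.memLp_const _ v)] at h1
  have hmul := (P.isCalculus.memLp_calcInt_iff hind hindm hm').1 (by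
    change MemLp _ 2 (P.diagMeasure (P.int _ ψ))
    rwa [hv'])
  rw [← hv', P.int_int hind hindm hm' hmul] at h1
  have h2 := P.enorm_int hmul
  have h3 : ‖P.int (((fun y : ℝ => (y : ℂ)) - fun _ => (x : ℂ)) *
      (Metric.ball x ε).indicator fun _ => 1) ψ‖ₑ ≤ ENNReal.ofReal ε * ‖v‖ₑ := by
    rw [h2, ← hv', P.enorm_int hindm]
    refine eLpNorm_le_mul_eLpNorm_of_ae_le_mul (ae_of_all _ fun y => ?_) 2
    by_cases hy : y ∈ Metric.ball x ε
    · have h4 : |y - x| < ε := hy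
      simp only [Pi.mul_apply, Pi.sub_apply, Set.indicator_of_mem hy, mul_one, norm_one]
      rw [← Complex.ofReal_sub, Complex.norm_real]
      exact h4.le
    · simp [Set.indicator_of_notMem hy]
  rw [← ofReal_norm, ← ofReal_norm, ← ENNReal.ofReal_mul hε0.le,
    ENNReal.ofReal_le_ofReal_iff (by positivity)] at h3
  rw [hv'] at h1
  have h5 : ‖v‖ ≤ ‖R‖ * (ε * ‖v‖) := by
    conv_lhs => rw [← h1]
    exact (R.le_opNorm _).trans (mul_le_mul_of_nonneg_left h3 (norm_nonneg R))
  have h6 : ‖R‖ * ε < 1 := by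
    rw [hε, ← div_eq_mul_inv, div_lt_one (by positivity)]
    linarith
  have h7 : ‖v‖ = 0 := by
    by_contra h8
    have h9 : 0 < ‖v‖ := lt_of_le_of_ne (norm_nonneg v) (Ne.symm h8)
    nlinarith
  exact norm_eq_zero.1 h7

/-- The integral of `|y - x|²` against `μ_v` is `‖(A - x) v‖² = 0`. -/
theorem ae_eq_of_mem_eigenspace (P : ProjectionValuedMeasure 𝓗) {x : ℝ} {v : 𝓗}
    (hv : v ∈ eigenspace (P.operator fun x => (x : ℂ)) x) : ∀ᵐ y ∂(P.diagMeasure v), y = x := by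
  obtain ⟨h1, h2⟩ := mem_eigenspace_iff.1 hv
  rw [operator_apply] at h2
  simp only at h2
  rw [← P.int_const (x : ℂ) v, ← sub_eq_zero, ← P.int_sub h1 (P.memLp_const _ v)] at h2
  have hm := MemLp.sub h1 (P.memLp_const (x : ℂ) v)
  have h3 := P.enorm_int hm
  rw [h2, enorm_zero, eq_comm, eLpNorm_eq_zero_iff hm.1 two_ne_zero] at h3
  filter_upwards [h3] with y hy
  have h4 : (y : ℂ) - x = 0 := hy
  exact_mod_cast sub_eq_zero.1 h4

theorem int_of_mem_eigenspace (P : ProjectionValuedMeasure 𝓗) {x : ℝ} {v : 𝓗}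
    (hv : v ∈ eigenspace (P.operator fun x => (x : ℂ)) x) (f : ℝ → ℂ) :
    MemLp f 2 (P.diagMeasure v) ∧ P.int f v = f x • v := by
  have h1 : f =ᵐ[P.diagMeasure v] fun _ => f x := by
    filter_upwards [P.ae_eq_of_mem_eigenspace hv] with y hy
    rw [hy]
  refine ⟨(memLp_congr_ae h1).2 (P.memLp_const _ v), ?_⟩
  rw [P.int_congr h1, P.int_const]

end ProjectionValuedMeasure

end TimeOp

end

/-! ### The absolutely continuous and singular continuous subspaces. -/

section

namespace TimeOp

open scoped InnerProductSpace

variable {𝓗 : Type*} [NormedAddCommGroup 𝓗] [InnerProductSpace ℂ 𝓗]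

theorem proj_mem_acSubspace (A : 𝓗 →ₗ.[ℂ] 𝓗) (B : Set ℝ) (ψ : 𝓗) (hψ : ψ ∈ acSubspace A) :
    (spectralMeasure A).proj B ψ ∈ acSubspace A := by
  intro C hC h0
  by_cases hB : MeasurableSet B
  · rw [← (spectralMeasure A).inter C B hC hB, Set.inter_comm, (spectralMeasure A).inter B C hB hC,
      hψ C hC h0, map_zero]
  · rw [(spectralMeasure A).notMeasurable B hB]
    simp

theorem isClosed_acSubspace (A : 𝓗 →ₗ.[ℂ] 𝓗) : IsClosed (acSubspace A : Set 𝓗) := by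
  have : (acSubspace A : Set 𝓗) = ⋂ (B : Set ℝ) (_ : MeasurableSet B) (_ : volume B = 0),
      {ψ | (spectralMeasure A).proj B ψ = 0} := by
    ext ψ
    simp only [Set.mem_iInter]
    rfl
  rw [this]
  exact isClosed_iInter fun B => isClosed_iInter fun _ => isClosed_iInter fun _ =>
    isClosed_eq ((spectralMeasure A).proj B).continuous continuous_const

theorem mem_scSubspace_iff (A : 𝓗 →ₗ.[ℂ] 𝓗) {ξ : 𝓗} :
    ξ ∈ scSubspace A ↔ (∀ ψ ∈ acSubspace A, ⟪ψ, ξ⟫_ℂ = 0) ∧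
      ∀ x, ∀ v ∈ eigenspace A x, ⟪v, ξ⟫_ℂ = 0 := by
  rw [scSubspace, ← Submodule.inf_orthogonal, Submodule.mem_inf, ppSubspace,
    Submodule.orthogonal_closure, ← Submodule.iInf_orthogonal, Submodule.mem_iInf]
  simp only [Submodule.mem_orthogonal]

variable [CompleteSpace 𝓗]

theorem eq_operator_spectralMeasure {A : 𝓗 →ₗ.[ℂ] 𝓗} (hA : IsSelfAdjoint A) :
    A = (spectralMeasure A).operator fun x => (x : ℂ) :=
  (isSpectralIntegral_spectralMeasure (exists_isSpectralIntegral hA)).eq_operator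
    Complex.measurable_ofReal

instance (A : 𝓗 →ₗ.[ℂ] 𝓗) : CompleteSpace (acSubspace A) :=
  (isClosed_acSubspace A).completeSpace_coe

instance (A : 𝓗 →ₗ.[ℂ] 𝓗) : CompleteSpace (scSubspace A) :=
  (Submodule.isClosed_orthogonal _).completeSpace_coe

theorem proj_of_mem_eigenspace {A : 𝓗 →ₗ.[ℂ] 𝓗} (hA : IsSelfAdjoint A) {x : ℝ} {v : 𝓗}
    (hv : v ∈ eigenspace A x) {B : Set ℝ} (hB : MeasurableSet B) :
    (spectralMeasure A).proj B v = B.indicator (fun _ => (1 : ℂ)) x • v := by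
  rw [← (spectralMeasure A).int_indicator hB]
  refine ((spectralMeasure A).int_of_mem_eigenspace ?_ _).2
  rwa [← eq_operator_spectralMeasure hA]

/-- `E({x})` fixes `v` and kills `ψ`, a singleton being Lebesgue-null. -/
theorem inner_acSubspace_eigenspace {A : 𝓗 →ₗ.[ℂ] 𝓗} (hA : IsSelfAdjoint A) {x : ℝ} {v ψ : 𝓗}
    (hv : v ∈ eigenspace A x) (hψ : ψ ∈ acSubspace A) : ⟪v, ψ⟫_ℂ = 0 := by
  have h1 := proj_of_mem_eigenspace hA hv (measurableSet_singleton x)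
  simp only [Set.mem_singleton_iff, Set.indicator_of_mem, one_smul] at h1
  rw [← h1, (spectralMeasure A).symmetric _ (measurableSet_singleton x),
    hψ _ (measurableSet_singleton x) Real.volume_singleton, inner_zero_right]

theorem proj_mem_scSubspace {A : 𝓗 →ₗ.[ℂ] 𝓗} (hA : IsSelfAdjoint A) (B : Set ℝ) (ξ : 𝓗)
    (hξ : ξ ∈ scSubspace A) : (spectralMeasure A).proj B ξ ∈ scSubspace A := by
  by_cases hB : MeasurableSet B
  · rw [mem_scSubspace_iff] at hξ ⊢
    refine ⟨fun ψ hψ => ?_, fun x v hv => ?_⟩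
    · rw [← (spectralMeasure A).symmetric B hB]
      exact hξ.1 _ (proj_mem_acSubspace A B ψ hψ)
    · rw [← (spectralMeasure A).symmetric B hB, proj_of_mem_eigenspace hA hv hB, inner_smul_left,
        hξ.2 x v hv, mul_zero]
  · rw [(spectralMeasure A).notMeasurable B hB]
    exact Submodule.zero_mem _

theorem eq_zero_of_mem_scSubspace {A : 𝓗 →ₗ.[ℂ] 𝓗} (hA : IsSelfAdjoint A)
    (h : spec (reducedPart A (scSubspace A)) = ∅) {ξ : 𝓗} (hξ : ξ ∈ scSubspace A) : ξ = 0 := by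
  have h1 := (spectralMeasure A).reducedPart_operator (proj_mem_scSubspace hA) fun x => (x : ℂ)
  rw [← eq_operator_spectralMeasure hA] at h1
  rw [h1] at h
  exact congrArg Subtype.val
    (((spectralMeasure A).restrict _ (proj_mem_scSubspace hA)).eq_zero_of_spec_eq_empty h ⟨ξ, hξ⟩)

end TimeOp

end

/-! ### Commutation of a strong time operator with functions of `A`. -/

section

namespace TimeOp

open scoped InnerProductSpace

section GaussianRegularization

open scoped FourierTransform
open Complex

/-- The Fourier integral of `𝓕 f` against a Gaussian cutoff of width `√c`. -/
def gaussianRegularization (f : ℝ → ℂ) (c v : ℝ) : ℂ :=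
  ∫ w : ℝ, (cexp (-(c : ℂ)⁻¹ * (w : ℂ) ^ 2) * 𝓕 f w) * cexp (2 * Real.pi * I * v * w)

/-- Moving the Fourier transform from `f` to the Gaussian shows a Gaussian average of `f`, which
gives pointwise convergence and a uniform bound. The cutoff is there because `𝓕 f` need not be
integrable when `f` is the derivative of a C¹ function. -/
theorem gaussianRegularization_eq {f : ℝ → ℂ} (hf : Integrable f) {c : ℝ} (hc : 0 < c) (v : ℝ) :
    gaussianRegularization f c v =
      ∫ w : ℝ, ((Real.pi * c : ℂ) ^ ((Module.finrank ℝ ℝ : ℂ) / 2) *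
        cexp (-(Real.pi : ℂ) ^ 2 * c * (‖v - w‖ : ℂ) ^ 2)) • f w := by
  have J : Integrable (fun w : ℝ => cexp (-(c : ℂ)⁻¹ * (‖w‖ : ℂ) ^ 2 +
      2 * Real.pi * I * (⟪v, w⟫_ℝ : ℝ))) := by
    refine GaussianFourier.integrable_cexp_neg_mul_sq_norm_add ?_ _ _
    rw [← ofReal_inv, ofReal_re]
    positivity
  have h1 := VectorFourier.integral_fourierIntegral_smul_eq_flip (L := innerₗ ℝ)
      Real.continuous_fourierChar continuous_inner J hf
  have h2 : gaussianRegularization f c v = ∫ w : ℝ, cexp (-(c : ℂ)⁻¹ * (‖w‖ : ℂ) ^ 2 +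
      2 * Real.pi * I * (⟪v, w⟫_ℝ : ℝ)) • 𝓕 f w := by
    refine integral_congr_ae (ae_of_all _ fun w => ?_)
    simp only [smul_eq_mul, Complex.exp_add]
    have e1 : (‖w‖ : ℂ) ^ 2 = (w : ℂ) ^ 2 := by
      rw [← ofReal_pow, ← ofReal_pow, Real.norm_eq_abs, sq_abs]
    have e2 : ((⟪v, w⟫_ℝ : ℝ) : ℂ) = v * w := by
      rw [← ofReal_mul]
      congr 1
      simp [mul_comm]
    rw [e1, e2]
    ring_nf
  rw [h2]
  have h3 : ∫ w : ℝ, 𝓕 (fun w : ℝ => cexp (-(c : ℂ)⁻¹ * (‖w‖ : ℂ) ^ 2 +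
      2 * Real.pi * I * (⟪v, w⟫_ℝ : ℝ))) w • f w = ∫ w : ℝ, cexp (-(c : ℂ)⁻¹ * (‖w‖ : ℂ) ^ 2 +
      2 * Real.pi * I * (⟪v, w⟫_ℝ : ℝ)) • 𝓕 f w := by
    simpa using! h1
  rw [← h3]
  refine integral_congr_ae (ae_of_all _ fun w => ?_)
  simp only
  rw [fourier_gaussian_innerProductSpace' (by rw [← ofReal_inv, ofReal_re]; positivity)]
  congr 2
  · rw [div_inv_eq_mul]
  · rw [div_inv_eq_mul]
    ring_nf

theorem tendsto_gaussianRegularization {f : ℝ → ℂ} (hf : Integrable f) (hc : Continuous f) (v : ℝ) :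
    Tendsto (fun n : ℕ => gaussianRegularization f ((n : ℝ) + 1) v) atTop (𝓝 (f v)) := by
  have h1 := Real.tendsto_integral_gaussian_smul' hf (hc.continuousAt (x := v))
  have h2 : Tendsto (fun n : ℕ => (n : ℝ) + 1) atTop atTop :=
    tendsto_atTop_add_const_right _ _ tendsto_natCast_atTop_atTop
  refine (h1.comp h2).congr fun n => ?_
  rw [gaussianRegularization_eq hf (by positivity)]
  rfl

theorem norm_gaussianRegularization_le {f : ℝ → ℂ} (hf : Integrable f) {C : ℝ}
    (hC : ∀ x, ‖f x‖ ≤ C) {c : ℝ} (hc : 0 < c) (v : ℝ) : ‖gaussianRegularization f c v‖ ≤ C := by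
  rw [gaussianRegularization_eq hf hc]
  have hb : 0 < Real.pi ^ 2 * c := by positivity
  have hnorm : ∀ w : ℝ, ‖(Real.pi * c : ℂ) ^ ((Module.finrank ℝ ℝ : ℂ) / 2) *
      cexp (-(Real.pi : ℂ) ^ 2 * c * (‖v - w‖ : ℂ) ^ 2)‖ =
      √(Real.pi * c) * Real.exp (-(Real.pi ^ 2 * c) * (v - w) ^ 2) := by
    intro w
    rw [norm_mul]
    congr 1
    · have e1 : ((Module.finrank ℝ ℝ : ℂ) / 2) = ((1 / 2 : ℝ) : ℂ) := by simp
      rw [e1, ← ofReal_mul, ← ofReal_cpow (by positivity), norm_real, Real.norm_eq_abs,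
        abs_of_nonneg (by positivity), Real.sqrt_eq_rpow]
    · have e1 : -(Real.pi : ℂ) ^ 2 * c * (‖v - w‖ : ℂ) ^ 2 =
          ((-(Real.pi ^ 2 * c) * (v - w) ^ 2 : ℝ) : ℂ) := by
        rw [← sq_abs (v - w)]
        push_cast
        rw [Real.norm_eq_abs]
        ring
      rw [e1, ← ofReal_exp, norm_real, Real.norm_eq_abs, abs_of_pos (Real.exp_pos _)]
  have hint : Integrable fun w : ℝ => Real.exp (-(Real.pi ^ 2 * c) * (v - w) ^ 2) :=
    (integrable_exp_neg_mul_sq hb).comp_sub_left v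
  refine (norm_integral_le_of_norm_le (g := fun w => (√(Real.pi * c) *
    Real.exp (-(Real.pi ^ 2 * c) * (v - w) ^ 2)) * C) ((hint.const_mul _).mul_const _)
    (ae_of_all _ fun w => ?_)).trans ?_
  · rw [norm_smul, hnorm]
    exact mul_le_mul_of_nonneg_left (hC w) (by positivity)
  · rw [integral_mul_const, integral_const_mul,
      integral_sub_left_eq_self (fun w => Real.exp (-(Real.pi ^ 2 * c) * w ^ 2)) volume v,
      integral_gaussian, ← Real.sqrt_mul (by positivity)]
    have e1 : Real.pi * c * (Real.pi / (Real.pi ^ 2 * c)) = 1 := by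
      field_simp
    rw [e1, Real.sqrt_one, one_mul]

theorem continuous_fourier {f : ℝ → ℂ} (hf : Integrable f) : Continuous (𝓕 f) :=
  VectorFourier.fourierIntegral_continuous Real.continuous_fourierChar
    (by exact continuous_inner) hf

theorem integrable_gaussian_mul_fourier {f : ℝ → ℂ} (hf : Integrable f) {c : ℝ} (hc : 0 < c) :
    Integrable fun w : ℝ => cexp (-(c : ℂ)⁻¹ * (w : ℂ) ^ 2) * 𝓕 f w := by
  refine Integrable.mul_bdd (c := ∫ v, ‖f v‖) (integrable_cexp_neg_mul_sq ?_)
    (continuous_fourier hf).aestronglyMeasurable (ae_of_all _ fun w => ?_)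
  · rw [← ofReal_inv, ofReal_re]
    positivity
  · exact VectorFourier.norm_fourierIntegral_le_integral_norm _ _ _ _ _

end GaussianRegularization

variable {𝓗 : Type*} [NormedAddCommGroup 𝓗] [InnerProductSpace ℂ 𝓗]

theorem inner_polarization (T : 𝓗 →ₗ[ℂ] 𝓗) (φ ψ : 𝓗) :
    ⟪φ, T ψ⟫_ℂ = 4⁻¹ * (⟪φ + ψ, T (φ + ψ)⟫_ℂ - ⟪φ - ψ, T (φ - ψ)⟫_ℂ
      - Complex.I * ⟪φ + Complex.I • ψ, T (φ + Complex.I • ψ)⟫_ℂ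
      + Complex.I * ⟪φ - Complex.I • ψ, T (φ - Complex.I • ψ)⟫_ℂ) := by
  simp only [map_add, map_sub, map_smul, inner_add_left, inner_add_right, inner_sub_left,
    inner_sub_right, inner_smul_left, inner_smul_right, Complex.conj_I]
  linear_combination ((1 / 2) * (⟪φ, T ψ⟫_ℂ - ⟪ψ, T φ⟫_ℂ)) * Complex.I_mul_I

variable [CompleteSpace 𝓗]

namespace ProjectionValuedMeasure

variable (P : ProjectionValuedMeasure 𝓗)

theorem tendsto_int_of_bounded {h : ℕ → ℝ → ℂ} {k : ℝ → ℂ} {C : ℝ} (hm : ∀ n, Measurable (h n))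
    (hC : ∀ n x, ‖h n x‖ ≤ C) (hlim : ∀ x, Tendsto (fun n => h n x) atTop (𝓝 (k x))) (ψ : 𝓗) :
    Tendsto (fun n => P.int (h n) ψ) atTop (𝓝 (P.int k ψ)) := by
  have hk : Measurable k := measurable_of_tendsto_metrizable hm (tendsto_pi_nhds.2 hlim)
  have hkC : ∀ x, ‖k x‖ ≤ C := fun x =>
    le_of_tendsto (hlim x).norm (Eventually.of_forall fun n => hC n x)
  have hmem := fun n => P.memLp_of_bound (hm n) (hC n) ψ
  have hkm := P.memLp_of_bound hk hkC ψ
  rw [tendsto_iff_edist_tendsto_0]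
  have hsq : Tendsto (fun n => (edist (P.int (h n) ψ) (P.int k ψ)) ^ 2) atTop (𝓝 0) := by
    have h1 : ∀ n, (edist (P.int (h n) ψ) (P.int k ψ)) ^ 2 =
        ∫⁻ x, ‖h n x - k x‖ₑ ^ 2 ∂(P.diagMeasure ψ) := fun n => by
      rw [edist_eq_enorm_sub, ← P.int_sub (hmem n) hkm, P.enorm_int ((hmem n).sub hkm),
        eLpNorm_two_sq]
      rfl
    simp only [h1]
    have h2 := tendsto_lintegral_of_dominated_convergence (μ := P.diagMeasure ψ)
      (F := fun n x => ‖h n x - k x‖ₑ ^ 2) (f := fun _ => 0)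
      (fun _ => (ENNReal.ofReal (C + C)) ^ 2)
      (fun n => by have := hm n; fun_prop) (fun n => ae_of_all _ fun x => by
        simp only
        gcongr
        rw [← ofReal_norm]
        exact ENNReal.ofReal_le_ofReal (norm_sub_le_of_le (hC n x) (hkC x)))
      (by
        rw [lintegral_const]
        exact ENNReal.mul_ne_top (by simp) (measure_ne_top _ _))
      (ae_of_all _ fun x => by
        have h3 : Tendsto (fun n => ‖h n x - k x‖ₑ ^ 2) atTop (𝓝 (‖k x - k x‖ₑ ^ 2)) :=
          (ENNReal.continuous_pow 2).tendsto _ |>.comp ((hlim x).sub_const (k x)).enorm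
        simpa using h3)
    simpa using h2
  have := ((ENNReal.continuous_rpow_const (y := (1 / 2 : ℝ))).tendsto 0).comp hsq
  rw [ENNReal.zero_rpow_of_pos (by norm_num)] at this
  refine this.congr fun s => ?_
  rw [Function.comp_apply, ← ENNReal.rpow_natCast, ← ENNReal.rpow_mul]
  norm_num

theorem measurable_integral_exp {g : ℝ → ℂ} (hg : Integrable g) :
    Measurable fun x : ℝ => ∫ w : ℝ, g w * Complex.exp (2 * Real.pi * Complex.I * x * w) := by
  have : Continuous fun x : ℝ => ∫ w : ℝ, g w * Complex.exp (2 * Real.pi * Complex.I * x * w) := by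
    refine continuous_of_dominated (bound := fun w => ‖g w‖) (fun x => ?_) (fun x => ?_) hg.norm ?_
    · exact hg.1.mul (by fun_prop)
    · refine ae_of_all _ fun w => ?_
      rw [norm_mul, show 2 * Real.pi * Complex.I * x * w = ((2 * Real.pi * x * w : ℝ) : ℂ) * Complex.I by
        push_cast; ring, Complex.norm_exp_ofReal_mul_I, mul_one]
    · exact ae_of_all _ fun w => by fun_prop
  exact this.measurable

theorem norm_exp_two_pi (w x : ℝ) : ‖Complex.exp (2 * Real.pi * Complex.I * x * w)‖ = 1 := by
  rw [show 2 * Real.pi * Complex.I * x * w = ((2 * Real.pi * x * w : ℝ) : ℂ) * Complex.I by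
    push_cast; ring, Complex.norm_exp_ofReal_mul_I]

theorem norm_integral_exp_le {g : ℝ → ℂ} (x : ℝ) :
    ‖∫ w : ℝ, g w * Complex.exp (2 * Real.pi * Complex.I * x * w)‖ ≤ ∫ w, ‖g w‖ := by
  refine (norm_integral_le_integral_norm _).trans_eq ?_
  simp only [norm_mul, norm_exp_two_pi, mul_one]

theorem inner_int_integral_exp_self {g : ℝ → ℂ} (hg : Integrable g) (ψ : 𝓗) :
    Integrable (fun w : ℝ => g w *
      ⟪ψ, P.int (fun x => Complex.exp (2 * Real.pi * Complex.I * x * w)) ψ⟫_ℂ) ∧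
    ⟪ψ, P.int (fun x => ∫ w : ℝ, g w * Complex.exp (2 * Real.pi * Complex.I * x * w)) ψ⟫_ℂ =
      ∫ w : ℝ, g w * ⟪ψ, P.int (fun x => Complex.exp (2 * Real.pi * Complex.I * x * w)) ψ⟫_ℂ := by
  have h1 : ∀ w : ℝ, ⟪ψ, P.int (fun x => Complex.exp (2 * Real.pi * Complex.I * x * w)) ψ⟫_ℂ =
      ∫ x : ℝ, Complex.exp (2 * Real.pi * Complex.I * x * w) ∂(P.diagMeasure ψ) := fun w =>
    P.isCalculus.inner_calcInt_self (P.memLp_of_bound (by fun_prop)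
      (fun x => (norm_exp_two_pi w x).le) ψ)
  have h2 : ⟪ψ, P.int (fun x => ∫ w : ℝ, g w * Complex.exp (2 * Real.pi * Complex.I * x * w)) ψ⟫_ℂ =
      ∫ x : ℝ, (∫ w : ℝ, g w * Complex.exp (2 * Real.pi * Complex.I * x * w))
        ∂(P.diagMeasure ψ) :=
    P.isCalculus.inner_calcInt_self (P.memLp_of_bound (measurable_integral_exp hg)
      norm_integral_exp_le ψ)
  have hint : Integrable (Function.uncurry fun (x w : ℝ) =>
      g w * Complex.exp (2 * Real.pi * Complex.I * x * w)) ((P.diagMeasure ψ).prod volume) := by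
    have := (hg.comp_snd (P.diagMeasure ψ))
    refine Integrable.mul_bdd (c := 1) this (Continuous.aestronglyMeasurable (by fun_prop))
      (ae_of_all _ fun p => (norm_exp_two_pi p.2 p.1).le)
  simp only [h1, h2]
  constructor
  · have := hint.integral_prod_right
    simpa only [Function.uncurry, integral_const_mul] using this
  · rw [integral_integral_swap hint]
    simp only [integral_const_mul]

/-- Polarization of the diagonal case, which is Fubini's theorem for the finite measure `μ_ψ` and
Lebesgue measure. -/
theorem inner_int_integral_exp {g : ℝ → ℂ} (hg : Integrable g) (φ ψ : 𝓗) :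
    Integrable (fun w : ℝ => g w *
      ⟪φ, P.int (fun x => Complex.exp (2 * Real.pi * Complex.I * x * w)) ψ⟫_ℂ) ∧
    ⟪φ, P.int (fun x => ∫ w : ℝ, g w * Complex.exp (2 * Real.pi * Complex.I * x * w)) ψ⟫_ℂ =
      ∫ w : ℝ, g w * ⟪φ, P.int (fun x => Complex.exp (2 * Real.pi * Complex.I * x * w)) ψ⟫_ℂ := by
  set U : ℝ → 𝓗 →L[ℂ] 𝓗 := fun w => P.boundedOp
    (fun x => Complex.exp (2 * Real.pi * Complex.I * x * w)) (by fun_prop) 1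
    (fun x => (norm_exp_two_pi w x).le) with hU
  set T := P.boundedOp _ (measurable_integral_exp hg) _ norm_integral_exp_le with hT
  have hq : ∀ χ : 𝓗, Integrable (fun w : ℝ => g w * ⟪χ, U w χ⟫_ℂ) ∧
      ⟪χ, T χ⟫_ℂ = ∫ w : ℝ, g w * ⟪χ, U w χ⟫_ℂ := fun χ => P.inner_int_integral_exp_self hg χ
  change Integrable (fun w : ℝ => g w * ⟪φ, U w ψ⟫_ℂ) ∧
    ⟪φ, T ψ⟫_ℂ = ∫ w : ℝ, g w * ⟪φ, U w ψ⟫_ℂ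
  have hpol : ∀ w, g w * ⟪φ, U w ψ⟫_ℂ = 4⁻¹ * (g w * ⟪φ + ψ, U w (φ + ψ)⟫_ℂ
      - g w * ⟪φ - ψ, U w (φ - ψ)⟫_ℂ
      - Complex.I * (g w * ⟪φ + Complex.I • ψ, U w (φ + Complex.I • ψ)⟫_ℂ)
      + Complex.I * (g w * ⟪φ - Complex.I • ψ, U w (φ - Complex.I • ψ)⟫_ℂ)) := fun w => by
    have := inner_polarization (U w : 𝓗 →ₗ[ℂ] 𝓗) φ ψ
    simp only [ContinuousLinearMap.coe_coe] at this
    rw [this]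
    ring
  have i1 := (hq (φ + ψ)).1
  have i2 := (hq (φ - ψ)).1
  have i3 := (hq (φ + Complex.I • ψ)).1.const_mul Complex.I
  have i4 := (hq (φ - Complex.I • ψ)).1.const_mul Complex.I
  simp only [hpol]
  have i12 := i1.sub i2
  have i123 := i12.sub i3
  simp only [Pi.sub_def] at i12 i123
  refine ⟨(i123.add i4).const_mul _, ?_⟩
  rw [integral_const_mul, integral_add i123 i4, integral_sub i12 i3,
    integral_sub i1 i2, integral_const_mul, integral_const_mul, ← (hq _).2, ← (hq _).2, ← (hq _).2,
    ← (hq _).2]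
  exact inner_polarization (T : 𝓗 →ₗ[ℂ] 𝓗) φ ψ

end ProjectionValuedMeasure

open scoped FourierTransform in
/-- The commutation relation of a strong time operator `T` of `A` with `h(A)`, in weak form. -/
theorem inner_strongTimeOperator_int (P : ProjectionValuedMeasure 𝓗) {T : 𝓗 →ₗ.[ℂ] 𝓗}
    (hT : IsStrongTimeOperator (P.operator fun x => (x : ℂ)) T) {h : ℝ → ℂ} (hh : ContDiff ℝ 1 h)
    (hs : HasCompactSupport h) (η χ : T.domain) :
    ⟪T η, P.int h χ⟫_ℂ = ⟪(η : 𝓗), P.int h (T χ)⟫_ℂ +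
      Complex.I * ⟪(η : 𝓗), P.int (deriv h) χ⟫_ℂ := by
  have hdc : Continuous (deriv h) := hh.continuous_deriv le_rfl
  have hi : Integrable h := hh.continuous.integrable_of_hasCompactSupport hs
  have hdi : Integrable (deriv h) := hdc.integrable_of_hasCompactSupport hs.deriv
  obtain ⟨C, hC⟩ := hh.continuous.bounded_above_of_compact_support hs
  obtain ⟨D, hD⟩ := hdc.bounded_above_of_compact_support hs.deriv
  -- The weak Weyl relation at `t = -2πw`, combined with the symmetry of `T`.
  have hW : ∀ w : ℝ, ⟪T η, P.int (fun x => Complex.exp (2 * Real.pi * Complex.I * x * w)) χ⟫_ℂ =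
      ⟪(η : 𝓗), P.int (fun x => Complex.exp (2 * Real.pi * Complex.I * x * w)) (T χ)⟫_ℂ -
      (2 * Real.pi * w : ℝ) *
        ⟪(η : 𝓗), P.int (fun x => Complex.exp (2 * Real.pi * Complex.I * x * w)) χ⟫_ℂ := by
    intro w
    have hexp : ∀ ψ, expNegI (P.operator fun x => (x : ℂ)) (-(2 * Real.pi * w)) ψ =
        P.int (fun x => Complex.exp (2 * Real.pi * Complex.I * x * w)) ψ := fun ψ => by
      rw [P.expNegI_operator]
      congr 1
      ext x
      congr 1
      push_cast
      ring
    have h1 := hT.weakWeyl (-(2 * Real.pi * w)) χ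
    have h2 := hT.symmetric η ⟨_, hT.mem (-(2 * Real.pi * w)) χ⟩
    rw [h1, map_add, map_smul, inner_add_right, inner_smul_right] at h2
    simp only [hexp] at h2
    rw [h2]
    push_cast
    ring
  -- Integrate `hW` against the Gaussian times `𝓕 h`. The factor `-2πw` equals `i · 2πiw`, and `2πiw
  -- 𝓕 h` is the Fourier transform of `h'`.
  have hreg : ∀ c : ℝ, 0 < c → ⟪T η, P.int (gaussianRegularization h c) χ⟫_ℂ =
      ⟪(η : 𝓗), P.int (gaussianRegularization h c) (T χ)⟫_ℂ +
      Complex.I * ⟪(η : 𝓗), P.int (gaussianRegularization (deriv h) c) χ⟫_ℂ := by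
    intro c hc
    have g1 := integrable_gaussian_mul_fourier hi hc
    have g2 := integrable_gaussian_mul_fourier hdi hc
    obtain ⟨-, e1⟩ := P.inner_int_integral_exp g1 (T η) χ
    obtain ⟨j2, e2⟩ := P.inner_int_integral_exp g1 (η : 𝓗) (T χ)
    obtain ⟨j3, e3⟩ := P.inner_int_integral_exp g2 (η : 𝓗) χ
    unfold gaussianRegularization
    rw [e1, e2, e3, ← integral_const_mul, ← integral_add j2 (j3.const_mul _)]
    refine integral_congr_ae (ae_of_all _ fun w => ?_)
    have h1 : 𝓕 (deriv h) w = (2 * Real.pi * Complex.I * w) * 𝓕 h w := by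
      rw [Real.fourier_deriv hi (hh.differentiable one_ne_zero) hdi]
      simp
    simp only
    rw [hW, h1]
    push_cast
    linear_combination (-2 * Real.pi * w * Complex.exp (-(c : ℂ)⁻¹ * (w : ℂ) ^ 2) * 𝓕 h w *
      ⟪(η : 𝓗), P.int (fun x => Complex.exp (2 * Real.pi * Complex.I * x * w)) χ⟫_ℂ) * Complex.I_mul_I
  have hm : ∀ {f : ℝ → ℂ}, Integrable f → ∀ n : ℕ,
      Measurable (gaussianRegularization f ((n : ℝ) + 1)) := fun hf n =>
    ProjectionValuedMeasure.measurable_integral_exp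
      (integrable_gaussian_mul_fourier hf (by positivity))
  have l1 : ∀ ψ : 𝓗, Tendsto (fun n : ℕ => P.int (gaussianRegularization h ((n : ℝ) + 1)) ψ) atTop
      (𝓝 (P.int h ψ)) := fun ψ => P.tendsto_int_of_bounded (hm hi)
    (fun n x => norm_gaussianRegularization_le hi hC (by positivity) x)
    (tendsto_gaussianRegularization hi hh.continuous) ψ
  have l2 : ∀ ψ : 𝓗, Tendsto (fun n : ℕ => P.int (gaussianRegularization (deriv h) ((n : ℝ) + 1)) ψ)
      atTop (𝓝 (P.int (deriv h) ψ)) := fun ψ => P.tendsto_int_of_bounded (hm hdi)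
    (fun n x => norm_gaussianRegularization_le hdi hD (by positivity) x)
    (tendsto_gaussianRegularization hdi hdc) ψ
  refine tendsto_nhds_unique (tendsto_const_nhds.inner (l1 χ)) ?_
  refine Tendsto.congr (fun n : ℕ => (hreg ((n : ℝ) + 1) (by positivity)).symm) ?_
  exact (tendsto_const_nhds.inner (l1 (T χ))).add ((tendsto_const_nhds.inner (l2 χ)).const_mul _)

end TimeOp

end

/-! ### Test functions, and the adjoint of the time operator on the local domain. -/

section

namespace TimeOp

open scoped InnerProductSpace

/-- A continuously differentiable function with compact support in `U`. -/
structure IsTestFunction (U : Set ℝ) (h : ℝ → ℂ) : Prop where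
  contDiff : ContDiff ℝ 1 h
  hasCompactSupport : HasCompactSupport h
  tsupport_subset : tsupport h ⊆ U

namespace IsTestFunction

variable {U : Set ℝ} {g h k : ℝ → ℂ}

theorem bounded (hh : IsTestFunction U h) : ∃ C, ∀ x, ‖h x‖ ≤ C :=
  hh.contDiff.continuous.bounded_above_of_compact_support hh.hasCompactSupport

theorem measurable (hh : IsTestFunction U h) : Measurable h :=
  hh.contDiff.continuous.measurable

theorem measurable_deriv (hh : IsTestFunction U h) : Measurable (deriv h) :=
  (hh.contDiff.continuous_deriv le_rfl).measurable

theorem bounded_deriv (hh : IsTestFunction U h) : ∃ C, ∀ x, ‖deriv h x‖ ≤ C :=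
  (hh.contDiff.continuous_deriv le_rfl).bounded_above_of_compact_support hh.hasCompactSupport.deriv

theorem star (hh : IsTestFunction U h) : IsTestFunction U (star h) where
  contDiff := Complex.conjCLE.contDiff.comp hh.contDiff
  hasCompactSupport := hh.hasCompactSupport.comp_left (g := (starRingEnd ℂ)) (map_zero _)
  tsupport_subset := (closure_mono (Function.support_comp_subset (g := (starRingEnd ℂ)) (map_zero _) h)).trans
    hh.tsupport_subset

theorem deriv_eq_zero {x : ℝ} (hx : x ∉ tsupport h) : deriv h x = 0 := by
  have : h =ᶠ[𝓝 x] fun _ => 0 := notMem_tsupport_iff_eventuallyEq.1 hx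
  rw [this.deriv_eq, deriv_const]

/-- The reason why test functions are C¹ rather than smooth: they have to absorb the factor `1 /
f'`, which is only C¹ when `f` is C². -/
theorem mul (hU : IsOpen U) (hg : ContDiffOn ℝ 1 g U) (hh : IsTestFunction U h) :
    IsTestFunction U (g * h) where
  contDiff := by
    rw [contDiff_iff_contDiffAt]
    intro x
    by_cases hx : x ∈ tsupport h
    · exact (hg.contDiffAt (hU.mem_nhds (hh.tsupport_subset hx))).mul hh.contDiff.contDiffAt
    · have : g * h =ᶠ[𝓝 x] fun _ => 0 := by
        filter_upwards [notMem_tsupport_iff_eventuallyEq.1 hx] with y hy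
        simp [hy]
      exact contDiffAt_const.congr_of_eventuallyEq this
  hasCompactSupport := hh.hasCompactSupport.mul_left
  tsupport_subset := (tsupport_mul_subset_right).trans hh.tsupport_subset

theorem deriv_mul (hU : IsOpen U) (hg : ContDiffOn ℝ 1 g U) (hh : IsTestFunction U h) :
    deriv (g * h) = deriv g * h + g * deriv h := by
  ext x
  by_cases hx : x ∈ tsupport h
  · have h1 := (hg.contDiffAt (hU.mem_nhds (hh.tsupport_subset hx))).differentiableAt one_ne_zero
    exact _root_.deriv_mul h1 (hh.contDiff.differentiable one_ne_zero x)
  · have h1 : x ∉ tsupport (g * h) := fun h2 => hx (tsupport_mul_subset_right h2)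
    simp [deriv_eq_zero hx, deriv_eq_zero h1, image_eq_zero_of_notMem_tsupport hx]

end IsTestFunction

variable {𝓗 : Type*} [NormedAddCommGroup 𝓗] [InnerProductSpace ℂ 𝓗]

namespace ProjectionValuedMeasure

variable (P : ProjectionValuedMeasure 𝓗) {T : 𝓗 →ₗ.[ℂ] 𝓗} {U : Set ℝ} {g h : ℝ → ℂ}

/-- The span of the vectors `h(A) χ`, where `χ ∈ D(T)` and `h` is a test function on `U`. -/
def localDomain (T : 𝓗 →ₗ.[ℂ] 𝓗) (U : Set ℝ) : Submodule ℂ 𝓗 :=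
  Submodule.span ℂ {ψ | ∃ (h : ℝ → ℂ) (χ : T.domain), IsTestFunction U h ∧ ψ = P.int h χ}

theorem int_mem_localDomain (hh : IsTestFunction U h) (χ : T.domain) :
    P.int h χ ∈ P.localDomain T U :=
  Submodule.subset_span ⟨h, χ, hh, rfl⟩

theorem memLp_testFunction (hh : IsTestFunction U h) (ψ : 𝓗) : MemLp h 2 (P.diagMeasure ψ) :=
  P.memLp_of_bound hh.measurable hh.bounded.choose_spec ψ

theorem memLp_deriv_testFunction (hh : IsTestFunction U h) (ψ : 𝓗) :
    MemLp (deriv h) 2 (P.diagMeasure ψ) :=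
  P.memLp_of_bound hh.measurable_deriv hh.bounded_deriv.choose_spec ψ

variable [CompleteSpace 𝓗]

theorem memLp_int_testFunction (hm : Measurable g) (hh : IsTestFunction U h)
    (hgh : IsTestFunction U (g * h)) (ψ : 𝓗) : MemLp g 2 (P.diagMeasure (P.int h ψ)) :=
  (P.isCalculus.memLp_calcInt_iff hh.measurable (P.memLp_testFunction hh ψ) hm).2
    (P.memLp_testFunction hgh ψ)

theorem int_int_testFunction (hm : Measurable g) (hh : IsTestFunction U h)
    (hgh : IsTestFunction U (g * h)) (ψ : 𝓗) : P.int g (P.int h ψ) = P.int (g * h) ψ :=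
  P.int_int hh.measurable (P.memLp_testFunction hh ψ) hm (P.memLp_testFunction hgh ψ)

theorem localDomain_le_domain (hU : IsOpen U) (hm : Measurable g) (hg : ContDiffOn ℝ 1 g U) :
    P.localDomain T U ≤ (P.operator g).domain := by
  refine Submodule.span_le.2 ?_
  rintro _ ⟨h, χ, hh, rfl⟩
  exact P.memLp_int_testFunction hm hh (hh.mul hU hg) _

theorem int_mem_localDomain_of_mem (hU : IsOpen U) (hm : Measurable g) (hg : ContDiffOn ℝ 1 g U)
    (φ : P.localDomain T U) : P.int g φ ∈ P.localDomain T U := by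
  -- The image of a preimage expresses, as one submodule, that a vector lies in `D(g(A))` and is
  -- sent into the local domain; so generators suffice.
  have h1 : P.localDomain T U ≤ ((P.localDomain T U).comap (P.operator g).toFun).map
      (P.operator g).domain.subtype := by
    refine Submodule.span_le.2 ?_
    rintro _ ⟨h, χ, hh, rfl⟩
    refine ⟨⟨_, P.memLp_int_testFunction hm hh (hh.mul hU hg) _⟩, ?_, rfl⟩
    change P.int g (P.int h χ) ∈ P.localDomain T U
    rw [P.int_int_testFunction hm hh (hh.mul hU hg)]
    exact P.int_mem_localDomain (hh.mul hU hg) χ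
  obtain ⟨ψ, h2, h3⟩ := h1 φ.2
  rw [← h3]
  exact h2

/-- The operator `g(A)` on the local domain. -/
def localInt (hU : IsOpen U) (hm : Measurable g) (hg : ContDiffOn ℝ 1 g U) :
    P.localDomain T U →ₗ[ℂ] P.localDomain T U :=
  ((P.operator g).toFun.comp (Submodule.inclusion (P.localDomain_le_domain hU hm hg))).codRestrict
    (P.localDomain T U) (P.int_mem_localDomain_of_mem hU hm hg)

theorem coe_localInt (hU : IsOpen U) (hm : Measurable g) (hg : ContDiffOn ℝ 1 g U)
    (φ : P.localDomain T U) : (P.localInt hU hm hg φ : 𝓗) = P.int g φ := rfl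

/-- Two functions of `A` commute on the local domain, and a product acts as their composition. -/
theorem int_localInt (hU : IsOpen U) {k : ℝ → ℂ} (hm : Measurable g) (hg : ContDiffOn ℝ 1 g U)
    (hk : Measurable k) (hk' : ContDiffOn ℝ 1 k U) (φ : P.localDomain T U) :
    P.int k (P.int g φ) = P.int (k * g) φ :=
  P.int_int hm (P.localDomain_le_domain hU hm hg φ.2) hk
    (P.localDomain_le_domain hU (hk.mul hm) (hk'.mul hg) φ.2)

variable {P} in
theorem inner_int_strongTimeOperator
    (hT : IsStrongTimeOperator (P.operator fun x => (x : ℂ)) T) (hh : IsTestFunction U h)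
    (χ η : T.domain) :
    ⟪P.int h (T χ) + Complex.I • P.int (deriv h) χ, η⟫_ℂ = ⟪P.int h χ, T η⟫_ℂ := by
  have h1 := inner_strongTimeOperator_int P hT hh.contDiff hh.hasCompactSupport η χ
  rw [← inner_conj_symm _ (η : 𝓗), ← inner_conj_symm _ (T η), h1, inner_add_right,
    inner_smul_right]

variable {P} in
-- The vectors `h(A) χ` are not known to lie in `D(T)`; the weak commutation relation only places
-- them in `D(T*)`.
theorem localDomain_le_adjoint_domain
    (hT : IsStrongTimeOperator (P.operator fun x => (x : ℂ)) T) :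
    P.localDomain T U ≤ T.adjoint.domain := by
  refine Submodule.span_le.2 ?_
  rintro _ ⟨h, χ, hh, rfl⟩
  exact T.mem_adjoint_domain_of_exists _ ⟨_, inner_int_strongTimeOperator hT hh χ⟩

variable {P} in
/-- The adjoint of a strong time operator on the local domain. -/
def localTime (hT : IsStrongTimeOperator (P.operator fun x => (x : ℂ)) T) (U : Set ℝ) :
    P.localDomain T U →ₗ[ℂ] 𝓗 :=
  T.adjoint.toFun.comp (Submodule.inclusion (localDomain_le_adjoint_domain hT))

variable {P} in
theorem localTime_int (hT : IsStrongTimeOperator (P.operator fun x => (x : ℂ)) T)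
    (hh : IsTestFunction U h) (χ : T.domain) :
    localTime hT U ⟨P.int h χ, P.int_mem_localDomain hh χ⟩ =
      P.int h (T χ) + Complex.I • P.int (deriv h) χ :=
  T.adjoint_apply_eq hT.dense _ (inner_int_strongTimeOperator hT hh χ)

variable {P} in
/-- The commutation relation of the adjoint of a strong time operator with `g(A)`. -/
theorem inner_localTime_localInt (hT : IsStrongTimeOperator (P.operator fun x => (x : ℂ)) T)
    (hU : IsOpen U) (hm : Measurable g) (hg : ContDiffOn ℝ 2 g U) (hr : star g = g)
    (φ ζ : P.localDomain T U) :
    ⟪localTime hT U (P.localInt hU hm (hg.of_le one_le_two) φ), ζ⟫_ℂ =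
      ⟪localTime hT U φ, P.int g ζ⟫_ℂ - Complex.I * ⟪P.int (deriv g) φ, ζ⟫_ℂ := by
  have hg1 := hg.of_le one_le_two
  have hg' : ContDiffOn ℝ 1 (deriv g) U := hg.deriv_of_isOpen hU (by norm_num)
  have hm' : Measurable (deriv g) := measurable_deriv g
  obtain ⟨φ, hφ⟩ := φ
  -- With `ζ` in the first slot both sides are linear in `φ`, so `φ = h(A) χ` suffices. There the
  -- Leibniz rule for `g h` amounts to `T* g(A) φ = g(A) T* φ + i g'(A) φ`.
  have key : P.localDomain T U ≤ (LinearMap.eqLocus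
      (((innerₛₗ ℂ (ζ : 𝓗))).comp ((localTime hT U).comp (P.localInt hU hm hg1)))
      (((innerₛₗ ℂ (P.int g ζ))).comp (localTime hT U) +
        Complex.I • ((innerₛₗ ℂ (ζ : 𝓗))).comp ((P.localDomain T U).subtype.comp
          (P.localInt hU hm' hg')))).map (P.localDomain T U).subtype := by
    refine Submodule.span_le.2 ?_
    rintro _ ⟨h, χ, hh, rfl⟩
    refine ⟨⟨_, P.int_mem_localDomain hh χ⟩, ?_, rfl⟩
    have e1 : P.localInt (T := T) hU hm hg1 ⟨_, P.int_mem_localDomain hh χ⟩ =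
        ⟨_, P.int_mem_localDomain (hh.mul hU hg1) χ⟩ :=
      Subtype.ext (P.int_int_testFunction hm hh (hh.mul hU hg1) _)
    have e2 : P.localInt (T := T) hU hm' hg' ⟨_, P.int_mem_localDomain hh χ⟩ =
        ⟨_, P.int_mem_localDomain (hh.mul hU hg') χ⟩ :=
      Subtype.ext (P.int_int_testFunction hm' hh (hh.mul hU hg') _)
    change ⟪(ζ : 𝓗), localTime hT U (P.localInt hU hm hg1 ⟨_, P.int_mem_localDomain hh χ⟩)⟫_ℂ =
      ⟪P.int g ζ, localTime hT U ⟨_, P.int_mem_localDomain hh χ⟩⟫_ℂ + Complex.I *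
        ⟪(ζ : 𝓗), (P.localInt (T := T) hU hm' hg' ⟨_, P.int_mem_localDomain hh χ⟩ : 𝓗)⟫_ℂ
    have mζ := P.localDomain_le_domain hU hm hg1 ζ.2
    have m1 : ∀ ψ, MemLp g 2 (P.diagMeasure (P.int h ψ)) :=
      fun ψ => P.memLp_int_testFunction hm hh (hh.mul hU hg1) ψ
    have m3 : MemLp (g * deriv h) 2 (P.diagMeasure (χ : 𝓗)) := by
      have : g * deriv h = deriv (g * h) - deriv g * h := by
        rw [IsTestFunction.deriv_mul hU hg1 hh, add_sub_cancel_left]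
      rw [this]
      exact (P.memLp_deriv_testFunction (hh.mul hU hg1) _).sub
        (P.memLp_testFunction (hh.mul hU hg') _)
    have m2 : MemLp g 2 (P.diagMeasure (P.int (deriv h) χ)) :=
      (P.isCalculus.memLp_calcInt_iff hh.measurable_deriv (P.memLp_deriv_testFunction hh χ) hm).2 m3
    have s : ∀ ψ, MemLp g 2 (P.diagMeasure ψ) → ⟪P.int g ζ, ψ⟫_ℂ = ⟪(ζ : 𝓗), P.int g ψ⟫_ℂ :=
      fun ψ hψ => by rw [P.inner_int_left mζ hψ, hr]
    rw [e1, e2, localTime_int hT (hh.mul hU hg1), localTime_int hT hh,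
      IsTestFunction.deriv_mul hU hg1 hh, inner_add_right, inner_add_right, inner_smul_right,
      inner_smul_right, s _ (m1 _), s _ m2, P.int_int_testFunction hm hh (hh.mul hU hg1),
      P.int_int hh.measurable_deriv (P.memLp_deriv_testFunction hh χ) hm m3,
      P.int_add (P.memLp_testFunction (hh.mul hU hg') _) m3, inner_add_right]
    ring
  obtain ⟨φ', h1, h2⟩ := key hφ
  obtain rfl : φ' = ⟨φ, hφ⟩ := Subtype.ext h2
  have h3 : ⟪(ζ : 𝓗), localTime hT U (P.localInt hU hm hg1 ⟨φ, hφ⟩)⟫_ℂ =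
      ⟪P.int g ζ, localTime hT U ⟨φ, hφ⟩⟫_ℂ + Complex.I * ⟪(ζ : 𝓗), P.int (deriv g) φ⟫_ℂ := h1
  rw [← inner_conj_symm, h3]
  simp only [map_add, map_mul, inner_conj_symm, Complex.conj_I]
  ring

end ProjectionValuedMeasure

end TimeOp

end

/-! ### The time operator of `g(A)` on the absolutely continuous part. -/

section

namespace TimeOp

open scoped InnerProductSpace

variable {𝓗 : Type*} [NormedAddCommGroup 𝓗] [InnerProductSpace ℂ 𝓗] [CompleteSpace 𝓗]

namespace ProjectionValuedMeasure

variable {P : ProjectionValuedMeasure 𝓗} {T : 𝓗 →ₗ.[ℂ] 𝓗} {U : Set ℝ} {g : ℝ → ℂ}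

/-- A vector `ξ` orthogonal to the local domain satisfies `h(A) ξ = 0` for every test function; bump
functions then show that `μ_ξ` is locally null on `U`. -/
theorem dense_localDomain (hT : Dense (T.domain : Set 𝓗)) (hU : IsOpen U)
    (hP : ∀ ψ, P.diagMeasure ψ Uᶜ = 0) : Dense (P.localDomain T U : Set 𝓗) := by
  refine dense_of_orthogonal fun ξ hξ => P.eq_zero_of_diagMeasure ?_
  have hz : ∀ h, IsTestFunction U h → P.int h ξ = 0 := fun h hh => by
    refine hT.eq_zero_of_inner_right ℂ fun χ hχ => ?_
    have h1 := hξ _ (P.int_mem_localDomain hh.star ⟨χ, hχ⟩)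
    rwa [P.inner_int_left (P.memLp_testFunction hh.star _) (P.memLp_testFunction hh.star _),
      star_star] at h1
  have hU0 : P.diagMeasure ξ U = 0 := by
    refine measure_null_of_locally_null _ fun x hx => ?_
    obtain ⟨b, hb1, hb2, hb3, -, hb4⟩ := exists_contDiff_tsupport_subset (n := 1) (hU.mem_nhds hx)
    have hh : IsTestFunction U fun y => (b y : ℂ) :=
      ⟨Complex.ofRealCLM.contDiff.comp hb3, hb2.comp_left (g := Complex.ofReal) Complex.ofReal_zero,
        (closure_mono (Function.support_comp_subset Complex.ofReal_zero b)).trans hb1⟩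
    have h1 := P.enorm_int (P.memLp_testFunction hh ξ)
    rw [hz _ hh, enorm_zero, eq_comm, eLpNorm_eq_zero_iff hh.measurable.aestronglyMeasurable
      (by norm_num)] at h1
    refine ⟨{y | b y ≠ 0}, mem_nhdsWithin_of_mem_nhds
      (hb3.continuous.continuousAt.eventually_ne (by simp [hb4])), ?_⟩
    have h2 : ∀ᵐ y ∂(P.diagMeasure ξ), b y = 0 := by
      filter_upwards [h1] with y hy
      simpa using hy
    exact h2
  rw [← Measure.measure_univ_eq_zero, ← Set.union_compl_self U]
  exact measure_union_null hU0 (hP ξ)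

/-- The form `(φ, ψ) ↦ ½ ((T* φ, g(A) ψ) + (g(A) φ, T* ψ))` on the local domain. -/
def localForm (hT : IsStrongTimeOperator (P.operator fun x => (x : ℂ)) T) (hU : IsOpen U)
    (hm : Measurable g) (hg : ContDiffOn ℝ 1 g U) :
    P.localDomain T U →ₗ⋆[ℂ] P.localDomain T U →ₗ[ℂ] ℂ :=
  LinearMap.mk₂'ₛₗ (starRingEnd ℂ) (RingHom.id ℂ)
    (fun φ ψ => (1 / 2) * (⟪localTime hT U φ, P.localInt (T := T) hU hm hg ψ⟫_ℂ +
      ⟪(P.localInt (T := T) hU hm hg φ : 𝓗), localTime hT U ψ⟫_ℂ))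
    (fun φ φ' ψ => by simp only [map_add, Submodule.coe_add, inner_add_left]; ring)
    (fun c φ ψ => by
      simp only [map_smul, Submodule.coe_smul, inner_smul_left, smul_eq_mul]; ring)
    (fun φ ψ ψ' => by simp only [map_add, Submodule.coe_add, inner_add_right]; ring)
    (fun c φ ψ => by
      simp only [map_smul, Submodule.coe_smul, inner_smul_right, smul_eq_mul, RingHom.id_apply]
      ring)

theorem localForm_apply (hT : IsStrongTimeOperator (P.operator fun x => (x : ℂ)) T) (hU : IsOpen U)
    (hm : Measurable g) (hg : ContDiffOn ℝ 1 g U) (φ ψ : P.localDomain T U) :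
    localForm hT hU hm hg φ ψ = (1 / 2) * (⟪localTime hT U φ, P.int g ψ⟫_ℂ +
      ⟪P.int g φ, localTime hT U ψ⟫_ℂ) := rfl

theorem star_localForm (hT : IsStrongTimeOperator (P.operator fun x => (x : ℂ)) T) (hU : IsOpen U)
    (hm : Measurable g) (hg : ContDiffOn ℝ 1 g U) (φ ψ : P.localDomain T U) :
    star (localForm hT hU hm hg φ ψ) = localForm hT hU hm hg ψ φ := by
  simp only [localForm_apply, Complex.star_def, map_mul, map_add, inner_conj_symm, map_div₀,
    map_one, map_ofNat]
  ring

/-- The time operator of `g(A)` that a strong time operator of `A` induces on the absolutely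
continuous subspace, on a dense domain where `g'(A)` is invertible. -/
theorem exists_form_of_strongTimeOperator
    (hT : IsStrongTimeOperator (P.operator fun x => (x : ℂ)) T) (hU : IsOpen U)
    (hP : ∀ ψ, P.diagMeasure ψ Uᶜ = 0) (hm : Measurable g) (hg : ContDiffOn ℝ 2 g U)
    (hr : star g = g) (hg0 : ∀ x ∈ U, deriv g x ≠ 0) :
    ∃ (D : Submodule ℂ 𝓗) (α : D →ₗ[ℂ] D) (t : D →ₗ⋆[ℂ] D →ₗ[ℂ] ℂ), Dense (D : Set 𝓗) ∧
      (∀ φ : D, MemLp g 2 (P.diagMeasure (φ : 𝓗)) ∧ (α φ : 𝓗) = P.int g φ) ∧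
      (∀ φ ψ, star (t φ ψ) = t ψ φ) ∧
      ∀ φ ψ : D, t (α φ) ψ - star (t (α ψ) φ) = -Complex.I * ⟪(φ : 𝓗), ψ⟫_ℂ := by
  have hg1 := hg.of_le one_le_two
  have hg' : ContDiffOn ℝ 1 (deriv g) U := hg.deriv_of_isOpen hU (by norm_num)
  have hm' : Measurable (deriv g) := measurable_deriv g
  have hr' : star (deriv g) = deriv g := by
    ext x
    nth_rw 2 [← hr]
    exact (deriv.star (𝕜 := ℝ) (f := g) (x := x)).symm
  have hs : ContDiffOn ℝ 1 (deriv g)⁻¹ U := hg'.inv hg0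
  have hsm : Measurable (deriv g)⁻¹ := hm'.inv
  refine ⟨P.localDomain T U, P.localInt hU hm hg1, localForm hT hU hsm hs,
    dense_localDomain hT.dense hU hP,
    fun φ => ⟨P.localDomain_le_domain hU hm hg1 φ.2, rfl⟩, star_localForm hT hU hsm hs,
    fun φ ψ => ?_⟩
  have hinv : ∀ ψ : P.localDomain T U, P.int (deriv g) (P.int (deriv g)⁻¹ ψ) = ψ := fun ψ => by
    rw [P.int_localInt hU hsm hs hm' hg']
    have h1 : deriv g * (deriv g)⁻¹ =ᵐ[P.diagMeasure (ψ : 𝓗)] 1 := by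
      have : ∀ᵐ x ∂(P.diagMeasure (ψ : 𝓗)), x ∈ U := hP ψ
      filter_upwards [this] with x hx
      exact mul_inv_cancel₀ (hg0 x hx)
    rw [P.int_congr h1, P.int_one]
  have hcomm : ∀ ψ : P.localDomain T U,
      P.int g (P.int (deriv g)⁻¹ ψ) = P.int (deriv g)⁻¹ (P.int g ψ) := fun ψ => by
    rw [P.int_localInt hU hsm hs hm hg1, P.int_localInt hU hm hg1 hsm hs, mul_comm]
  -- Moving `g(A)` across `T*` costs `-i g'(A)`, which the weight `1 / g'` turns into `-i`.
  have key : ∀ φ ψ : P.localDomain T U,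
      ⟪localTime hT U (P.localInt hU hm hg1 φ), P.int (deriv g)⁻¹ ψ⟫_ℂ =
        ⟪localTime hT U φ, P.int (deriv g)⁻¹ (P.int g ψ)⟫_ℂ - Complex.I * ⟪(φ : 𝓗), ψ⟫_ℂ := by
    intro φ ψ
    have h1 := inner_localTime_localInt hT hU hm hg hr φ (P.localInt hU hsm hs ψ)
    have h2 : MemLp (deriv g) 2 (P.diagMeasure (P.int (deriv g)⁻¹ ψ)) :=
      P.localDomain_le_domain hU hm' hg' (P.localInt hU hsm hs ψ).2
    rw [P.coe_localInt, hcomm, P.inner_int_left (P.localDomain_le_domain hU hm' hg' φ.2) h2, hr',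
      hinv] at h1
    exact h1
  -- `T*` need not be symmetric, whence the two halves of the form; `key` and its conjugate
  -- contribute `-(i/2) (φ, ψ)` each.
  rw [localForm_apply, localForm_apply, P.coe_localInt, P.coe_localInt, key φ ψ]
  simp only [Complex.star_def, map_mul, map_add, inner_conj_symm, map_div₀, map_one, map_ofNat]
  rw [← inner_conj_symm (P.int (deriv g)⁻¹ φ), key ψ φ]
  simp only [map_sub, map_mul, inner_conj_symm, Complex.conj_I]
  ring

end ProjectionValuedMeasure

end TimeOp

end

/-! ### A time operator on the span of the eigenvectors. -/

section

namespace TimeOp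

open scoped InnerProductSpace

section Grouping

variable {I : Type*} [Countable I]

/-- If `F` has infinite range, the index set splits into infinite groups on each of which `F` is
injective. -/
theorem exists_grouping {β : Type*} (F : I → β) (hF : (Set.range F).Infinite) :
    ∃ g : I → ℕ, (∀ a b, g a = g b → F a = F b → a = b) ∧ ∀ a, {b | g b = g a}.Infinite := by
  obtain ⟨ι, hι⟩ := exists_injective_nat I
  have := hF.to_subtype
  have : Countable (Set.range F) := (Set.countable_range F).to_subtype
  obtain ⟨e⟩ : Nonempty (Set.range F ≃ ℕ) := nonempty_equiv_of_countable
  have hrep : ∀ k : ℕ, ∃ a : I, F a = e.symm k ∧ ∀ b, F b = e.symm k → ι a ≤ ι b := fun k => by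
    obtain ⟨a, ha⟩ := (e.symm k).2
    obtain ⟨m, hm, hmin⟩ := (InvImage.wf ι wellFounded_lt).has_min {b | F b = e.symm k} ⟨a, ha⟩
    exact ⟨m, hm, fun b hb => not_lt.1 (hmin b hb)⟩
  choose rep hrepF hrepmin using hrep
  set k : I → ℕ := fun a => e ⟨F a, a, rfl⟩ with hk
  have hks : ∀ a, (e.symm (k a) : β) = F a := fun a => by simp [hk]
  have hkr : ∀ n, k (rep n) = n := fun n => by
    rw [hk]
    simp only [hrepF, Subtype.coe_eta, Equiv.apply_symm_apply]
  -- `rep n` has the least index in the `n`-th fibre of `F`, so the subtraction is not truncated and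
  -- the label is injective on each fibre. The label of `rep (Nat.pair n m)` is `n` for every `m`,
  -- so each group meets infinitely many fibres.
  refine ⟨fun a => ι a - ι (rep (k a)) + (k a).unpair.1, fun a b h hab => hι ?_, fun a => ?_⟩
  · have h1 : k a = k b := by simp only [hk, hab]
    have h2 := hrepmin (k b) a (by rw [← h1, hks])
    have h3 := hrepmin (k b) b (by rw [hks])
    simp only [h1] at h
    omega
  · refine Set.infinite_of_injective_forall_mem
      (f := fun m => rep (Nat.pair (ι a - ι (rep (k a)) + (k a).unpair.1) m)) (fun m m' h => ?_)
      fun m => ?_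
    · have := congrArg k h
      simp only [hkr] at this
      exact (Nat.pair_eq_pair.1 this).2
    · simp [hkr]

end Grouping

section FinsuppForm

variable {I : Type*}

/-- The sesquilinear form with matrix `K` on the finitely supported functions. -/
def matrixForm (K : I → I → ℂ) : (I →₀ ℂ) →ₗ⋆[ℂ] (I →₀ ℂ) →ₗ[ℂ] ℂ :=
  LinearMap.mk₂'ₛₗ (starRingEnd ℂ) (RingHom.id ℂ)
    (fun c d => c.sum fun a x => d.sum fun b y => starRingEnd ℂ x * y * K a b)
    (fun c c' d => Finsupp.sum_add_index' (by simp) (fun a x y => by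
      simp only [map_add, add_mul, Finsupp.sum_add]))
    (fun r c d => by
      rw [Finsupp.sum_smul_index' (by simp), smul_eq_mul, Finsupp.mul_sum]
      refine Finsupp.sum_congr fun a _ => ?_
      rw [Finsupp.mul_sum]
      refine Finsupp.sum_congr fun b _ => ?_
      simp only [smul_eq_mul, map_mul]
      ring)
    (fun c d d' => by
      rw [← Finsupp.sum_add]
      refine Finsupp.sum_congr fun a _ => ?_
      exact Finsupp.sum_add_index' (by simp) (fun b x y => by ring))
    (fun r c d => by
      rw [RingHom.id_apply, smul_eq_mul, Finsupp.mul_sum]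
      refine Finsupp.sum_congr fun a _ => ?_
      rw [Finsupp.sum_smul_index' (by simp), Finsupp.mul_sum]
      refine Finsupp.sum_congr fun b _ => ?_
      simp only [smul_eq_mul]
      ring)

theorem matrixForm_apply (K : I → I → ℂ) (c d : I →₀ ℂ) {s : Finset I} (hc : c.support ⊆ s)
    (hd : d.support ⊆ s) :
    matrixForm K c d = ∑ a ∈ s, ∑ b ∈ s, starRingEnd ℂ (c a) * d b * K a b := by
  change (c.sum fun a x => d.sum fun b y => starRingEnd ℂ x * y * K a b) = _
  rw [Finsupp.sum_of_support_subset _ hc _ (by simp)]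
  exact Finset.sum_congr rfl fun a _ => Finsupp.sum_of_support_subset _ hd _ (by simp)

/-- Multiplication by `F` on the finitely supported functions. -/
def diagonalMap (F : I → ℂ) : (I →₀ ℂ) →ₗ[ℂ] I →₀ ℂ :=
  Finsupp.linearCombination ℂ fun a => Finsupp.single a (F a)

theorem diagonalMap_apply (F : I → ℂ) (c : I →₀ ℂ) (a : I) : diagonalMap F c a = F a * c a := by
  classical
  induction c using Finsupp.induction_linear with
  | zero => simp
  | add c d hc hd => rw [map_add, Finsupp.add_apply, hc, hd, Finsupp.add_apply, mul_add]
  | single b x =>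
    rw [diagonalMap, Finsupp.linearCombination_single, Finsupp.smul_single, Finsupp.single_apply,
      Finsupp.single_apply]
    split_ifs with h
    · rw [h, smul_eq_mul, mul_comm]
    · simp

theorem support_diagonalMap_subset (F : I → ℂ) (c : I →₀ ℂ) :
    (diagonalMap F c).support ⊆ c.support := fun a ha => by
  rw [Finsupp.mem_support_iff, diagonalMap_apply] at ha
  exact Finsupp.mem_support_iff.2 (right_ne_zero_of_mul ha)

theorem star_matrixForm {K : I → I → ℂ} (hK : ∀ a b, starRingEnd ℂ (K a b) = K b a)
    (c d : I →₀ ℂ) : star (matrixForm K c d) = matrixForm K d c := by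
  classical
  rw [matrixForm_apply K c d Finset.subset_union_left Finset.subset_union_right,
    matrixForm_apply K d c Finset.subset_union_right Finset.subset_union_left, Finset.sum_comm,
    Complex.star_def, map_sum]
  refine Finset.sum_congr rfl fun a _ => ?_
  rw [map_sum]
  refine Finset.sum_congr rfl fun b _ => ?_
  rw [map_mul, map_mul, hK, Complex.conj_conj]
  ring

open scoped Classical in
/-- The Galapon kernel `i / (F a - F b)`, restricted to the pairs in one group. -/
def timeKernel {G : Type*} (F : I → ℝ) (g : I → G) (a b : I) : ℂ :=
  if g a = g b ∧ a ≠ b then Complex.I / ((F a : ℂ) - F b) else 0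

variable {G : Type*} {F : I → ℝ} {g : I → G}

theorem conj_timeKernel (a b : I) : starRingEnd ℂ (timeKernel F g a b) = timeKernel F g b a := by
  rw [timeKernel, timeKernel]
  by_cases h : g a = g b ∧ a ≠ b
  · rw [if_pos h, if_pos ⟨h.1.symm, h.2.symm⟩, map_div₀, Complex.conj_I, map_sub,
      Complex.conj_ofReal, Complex.conj_ofReal, neg_div, ← div_neg, neg_sub]
  · rw [if_neg h, if_neg fun h' => h ⟨h'.1.symm, h'.2.symm⟩, map_zero]

/-- Inside a group the product is `i` except on the diagonal. The constant part will be killed by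
vanishing group sums; the diagonal defect is what produces the commutation relation. -/
theorem sub_mul_timeKernel [DecidableEq I] [DecidableEq G]
    (hg : ∀ a b, g a = g b → F a = F b → a = b) (a b : I) :
    ((F a : ℂ) - F b) * timeKernel F g a b =
      Complex.I * ((if g b = g a then 1 else 0) - if b = a then 1 else 0) := by
  rw [timeKernel]
  by_cases h : a = b
  · simp [h]
  · by_cases h' : g a = g b
    · rw [if_pos ⟨h', h⟩, if_pos h'.symm, if_neg (Ne.symm h), mul_div_cancel₀]
      · simp
      · rw [sub_ne_zero]
        exact fun h2 => h (hg a b h' (by exact_mod_cast h2))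
    · simp [h', Ne.symm h, Ne.symm h']

/-- The canonical commutation relation of the form with kernel `timeKernel` with multiplication
by `F`, on the functions whose sum over each group vanishes. -/
theorem matrixForm_timeKernel (hg : ∀ a b, g a = g b → F a = F b → a = b) (c d : I →₀ ℂ)
    (hd : Finsupp.mapDomain g d = 0) :
    matrixForm (timeKernel F g) (diagonalMap (fun a => (F a : ℂ)) c) d -
        star (matrixForm (timeKernel F g) (diagonalMap (fun a => (F a : ℂ)) d) c) =
      -Complex.I * d.sum fun a y => starRingEnd ℂ (c a) * y := by
  classical
  set s := c.support ∪ d.support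
  have hc : c.support ⊆ s := Finset.subset_union_left
  have hds : d.support ⊆ s := Finset.subset_union_right
  have hsum : ∀ a, ∑ b ∈ s, (if g b = g a then d b else 0) = 0 := fun a => by
    have h1 := DFunLike.congr_fun hd (g a)
    rw [Finsupp.mapDomain, Finsupp.sum_apply, Finsupp.sum_of_support_subset _ hds _ (by simp)] at h1
    simpa only [Finsupp.single_apply, Finsupp.coe_zero, Pi.zero_apply] using h1
  rw [star_matrixForm conj_timeKernel,
    matrixForm_apply _ _ _ ((support_diagonalMap_subset _ c).trans hc) hds,
    matrixForm_apply _ _ _ hc ((support_diagonalMap_subset _ d).trans hds),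
    Finsupp.sum_of_support_subset _ hds _ (by simp), ← Finset.sum_sub_distrib, Finset.mul_sum]
  refine Finset.sum_congr rfl fun a ha => ?_
  rw [← Finset.sum_sub_distrib]
  have h1 : ∀ b, starRingEnd ℂ (diagonalMap (fun a => (F a : ℂ)) c a) * d b * timeKernel F g a b -
      starRingEnd ℂ (c a) * diagonalMap (fun a => (F a : ℂ)) d b * timeKernel F g a b =
      Complex.I * starRingEnd ℂ (c a) * (if g b = g a then d b else 0) -
        Complex.I * starRingEnd ℂ (c a) * (if b = a then d b else 0) := fun b => by
    rw [diagonalMap_apply, diagonalMap_apply, map_mul, Complex.conj_ofReal]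
    have h2 := sub_mul_timeKernel hg a b
    have e1 : (if g b = g a then d b else 0) = (if g b = g a then 1 else 0) * d b := by simp
    have e2 : (if b = a then d b else 0) = (if b = a then 1 else 0) * d b := by simp
    rw [e1, e2]
    linear_combination (starRingEnd ℂ (c a) * d b) * h2
  simp only [h1]
  -- Only the sums of `d` over groups have to vanish; the term left is the one with `b = a`.
  rw [Finset.sum_sub_distrib, ← Finset.mul_sum, ← Finset.mul_sum, hsum, Finset.sum_ite_eq',
    if_pos ha]
  ring

end FinsuppForm

section Orthonormal

variable {𝓗 : Type*} [NormedAddCommGroup 𝓗] [InnerProductSpace ℂ 𝓗]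

/-- A vector that is orthogonal to all differences of members of an infinite orthonormal family is
orthogonal to the family. -/
theorem inner_eq_zero_of_infinite {I : Type*} {e : I → 𝓗} (he : Orthonormal ℂ e) {s : Set I}
    (hs : s.Infinite) {z : ℂ} {ξ : 𝓗} (h : ∀ b ∈ s, ⟪e b, ξ⟫_ℂ = z) : z = 0 := by
  by_contra hz
  have h1 := (he.inner_products_summable (x := ξ)).tendsto_cofinite_zero
  have h2 := h1.eventually (gt_mem_nhds (show (0 : ℝ) < ‖z‖ ^ 2 by positivity))
  rw [eventually_cofinite] at h2
  refine hs (h2.subset fun b hb => ?_)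
  rw [Set.mem_ofPred_eq, h b hb]
  exact lt_irrefl _

/-- Differences `e b - e a` within a group have vanishing group sums, so `(e b, ξ)` is constant on
each infinite group. This is what makes the commutation domain dense. -/
theorem inner_eq_zero_of_mapDomain {I G : Type*} {e : I → 𝓗} (he : Orthonormal ℂ e) {g : I → G}
    (hg : ∀ a, {b | g b = g a}.Infinite) {ξ : 𝓗}
    (h : ∀ c : I →₀ ℂ, Finsupp.mapDomain g c = 0 → ⟪Finsupp.linearCombination ℂ e c, ξ⟫_ℂ = 0)
    (a : I) : ⟪e a, ξ⟫_ℂ = 0 := by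
  refine inner_eq_zero_of_infinite he (hg a) (ξ := ξ) fun b hb => ?_
  have h1 := h (Finsupp.single b 1 - Finsupp.single a 1) (by
    rw [Finsupp.mapDomain_sub, Finsupp.mapDomain_single, Finsupp.mapDomain_single,
      show g b = g a from hb, sub_self])
  simpa [inner_sub_left, sub_eq_zero] using h1

end Orthonormal

end TimeOp

end

/-! ### Transport of forms to the Hilbert space, and the orthogonal sum. -/

section

namespace TimeOp

open scoped InnerProductSpace

variable {𝓗 : Type*} [NormedAddCommGroup 𝓗] [InnerProductSpace ℂ 𝓗] [CompleteSpace 𝓗]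

/-- A symmetric form on an abstract core, with the canonical commutation relation on a subspace
whose image is dense, gives an ultra-weak time operator. -/
theorem hasDenselyUltraWeakTimeOperator_of_form [Nontrivial 𝓗] {A : 𝓗 →ₗ.[ℂ] 𝓗}
    (hA : IsSelfAdjoint A) {W : Type*} [AddCommGroup W] [Module ℂ W] (J : W →ₗ[ℂ] 𝓗)
    (hJ : Function.Injective J) (α : W →ₗ[ℂ] W) (t : W →ₗ⋆[ℂ] W →ₗ[ℂ] ℂ) (S : Submodule ℂ W)
    (hα : ∀ v, ∃ h : J v ∈ A.domain, A ⟨J v, h⟩ = J (α v))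
    (ht : ∀ v w, star (t v w) = t w v)
    (hccr : ∀ v ∈ S, ∀ w ∈ S, t (α v) w - star (t (α w) v) = -Complex.I * ⟪J v, J w⟫_ℂ)
    (hS : Dense (S.map J : Set 𝓗)) : HasDenselyUltraWeakTimeOperator A := by
  set e := LinearEquiv.ofInjective J hJ with he
  have hJe : ∀ w (h : J w ∈ LinearMap.range J), e.symm ⟨J w, h⟩ = w := fun w h => by
    rw [LinearEquiv.symm_apply_eq]
    rfl
  have hne : S.map J ≠ ⊥ := fun h => by
    rw [h] at hS
    obtain ⟨x, hx⟩ := exists_ne (0 : 𝓗)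
    have := hS x
    rw [Submodule.bot_coe, closure_singleton] at this
    exact hx this
  have hle : S.map J ≤ LinearMap.range J := LinearMap.map_le_range
  have hne' : LinearMap.range J ≠ ⊥ := fun h => hne (le_bot_iff.1 (h ▸ hle))
  -- The form lives on the whole range of `J`, not just on `J(S)`, because `α` need not preserve
  -- `S`: multiplication by eigenvalues destroys vanishing sums.
  refine ⟨hA, LinearMap.range J, LinearMap.range J, LinearMap.mk₂'ₛₗ (starRingEnd ℂ) (RingHom.id ℂ)
    (fun φ ψ => t (e.symm φ) (e.symm ψ)) (by simp) (by simp) (by simp) (by simp),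
    LinearMap.range J, S.map J, ?_, hS⟩
  refine ⟨hne', hne', hne', hne, le_rfl, le_rfl, hle, ?_, fun φ ψ => ht _ _, ?_, ?_⟩
  · rintro _ ⟨v, -, rfl⟩
    exact (hα v).1
  · rintro ⟨_, v, -, rfl⟩
    exact ⟨α v, (hα v).2.symm⟩
  · rintro ⟨_, v, hv, rfl⟩ ⟨_, w, hw, rfl⟩
    have h1 : ∀ v, A ⟨J v, (hα v).1⟩ = J (α v) := fun v => (hα v).2
    simp only [LinearMap.mk₂'ₛₗ_apply, h1, hJe]
    exact hccr v hv w hw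

/-- The direct sum of a time operator on a closed subspace `M` and the time operator on the span of
an orthonormal family of eigenvectors of `B` orthogonal to `M`. -/
theorem hasDenselyUltraWeakTimeOperator_of_sum [Nontrivial 𝓗] {B : 𝓗 →ₗ.[ℂ] 𝓗}
    (hB : IsSelfAdjoint B) {M : Submodule ℂ 𝓗} {D : Submodule ℂ M} (hD : Dense (D : Set M))
    (α : D →ₗ[ℂ] D) (t : D →ₗ⋆[ℂ] D →ₗ[ℂ] ℂ)
    (hα : ∀ φ : D, ∃ h : ((φ : M) : 𝓗) ∈ B.domain, B ⟨_, h⟩ = ((α φ : M) : 𝓗))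
    (ht : ∀ φ ψ, star (t φ ψ) = t ψ φ)
    (hccr : ∀ φ ψ : D, t (α φ) ψ - star (t (α ψ) φ) = -Complex.I * ⟪(φ : M), (ψ : M)⟫_ℂ)
    {I : Type*} [Countable I] {e : I → 𝓗} (he : Orthonormal ℂ e) (F : I → ℝ)
    (hF : (Set.range F).Infinite) (heF : ∀ a, ∃ h : e a ∈ B.domain, B ⟨_, h⟩ = (F a : ℂ) • e a)
    (hM : ∀ a, ∀ ψ ∈ M, ⟪e a, ψ⟫_ℂ = 0)
    (htot : ∀ ξ, (∀ ψ ∈ M, ⟪ψ, ξ⟫_ℂ = 0) → (∀ a, ⟪e a, ξ⟫_ℂ = 0) → ξ = 0) :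
    HasDenselyUltraWeakTimeOperator B := by
  obtain ⟨g, hg, hg'⟩ := exists_grouping F hF
  set L := Finsupp.linearCombination ℂ e with hL
  set i : D →ₗ[ℂ] 𝓗 := M.subtype.comp D.subtype with hi
  set J : D × (I →₀ ℂ) →ₗ[ℂ] 𝓗 := i.coprod L with hJ
  have hLM : ∀ (c : I →₀ ℂ), ∀ ψ ∈ M, ⟪L c, ψ⟫_ℂ = 0 := fun c ψ hψ => by
    rw [hL, Finsupp.linearCombination_apply, Finsupp.sum_inner]
    exact Finset.sum_eq_zero fun a _ => (inner_smul_left _ _ _).trans (by rw [hM a ψ hψ, mul_zero])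
  have hML : ∀ (c : I →₀ ℂ), ∀ ψ ∈ M, ⟪ψ, L c⟫_ℂ = 0 := fun c ψ hψ => by
    rw [← inner_conj_symm, hLM c ψ hψ, map_zero]
  have hJJ : ∀ v w, ⟪J v, J w⟫_ℂ = ⟪i v.1, i w.1⟫_ℂ + ⟪L v.2, L w.2⟫_ℂ := fun v w => by
    rw [hJ, LinearMap.coprod_apply, LinearMap.coprod_apply, inner_add_left, inner_add_right,
      inner_add_right, hML w.2 (i v.1) (v.1 : M).2, hLM v.2 (i w.1) (w.1 : M).2]
    ring
  have hJinj : Function.Injective J := by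
    rw [← LinearMap.ker_eq_bot, LinearMap.ker_eq_bot']
    rintro ⟨φ, c⟩ h
    have h1 : i φ = 0 := by
      rw [← inner_self_eq_zero (𝕜 := ℂ)]
      have : J (φ, c) = i φ + L c := rfl
      nth_rw 2 [← add_sub_cancel_right (i φ) (L c)]
      rw [← this, h, zero_sub, inner_neg_right, hML c (i φ) (φ : M).2, neg_zero]
    have h2 : L c = 0 := by
      have : J (φ, c) = i φ + L c := rfl
      rwa [h1, zero_add, h, eq_comm] at this
    have h3 : φ = 0 := Subtype.ext (Subtype.ext h1)
    have h4 : c = 0 := by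
      have := he.linearIndependent
      rw [LinearIndependent] at this
      exact this (by rw [map_zero]; exact h2)
    rw [h3, h4]
    rfl
  refine hasDenselyUltraWeakTimeOperator_of_form hB J hJinj
    (α.prodMap (diagonalMap fun a => (F a : ℂ)))
    (LinearMap.mk₂'ₛₗ (starRingEnd ℂ) (RingHom.id ℂ)
      (fun v w => t v.1 w.1 + matrixForm (timeKernel F g) v.2 w.2)
      (fun v v' w => by
        simp only [Prod.fst_add, Prod.snd_add, map_add, LinearMap.add_apply]; ring)
      (fun c v w => by
        simp only [Prod.smul_fst, Prod.smul_snd, LinearMap.map_smulₛₗ, LinearMap.smul_apply,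
          smul_eq_mul]
        ring)
      (fun v w w' => by simp only [Prod.fst_add, Prod.snd_add, map_add]; ring)
      (fun c v w => by
        simp only [Prod.smul_fst, Prod.smul_snd, map_smul, smul_eq_mul, RingHom.id_apply]
        ring))
    -- The kernel consists of the coefficient families whose sum over each group vanishes; on the
    -- `M` component nothing is imposed.
    (Submodule.prod ⊤ (LinearMap.ker (Finsupp.lmapDomain ℂ ℂ g))) ?_ ?_ ?_ ?_
  · have hLd : ∀ c, (L c, L (diagonalMap (fun a => (F a : ℂ)) c)) ∈ B.graph := by
      intro c
      induction c using Finsupp.induction_linear with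
      | zero =>
        simp only [map_zero]
        exact B.graph.zero_mem
      | add c d hc hd =>
        simp only [map_add]
        exact B.graph.add_mem hc hd
      | single a x =>
        obtain ⟨h1, h2⟩ := heF a
        have h3 : L (Finsupp.single a x) = x • e a := Finsupp.linearCombination_single ℂ x a
        have h4 : diagonalMap (fun a => (F a : ℂ)) (Finsupp.single a x) =
            x • Finsupp.single a (F a : ℂ) := Finsupp.linearCombination_single ℂ x a
        rw [h3, h4, map_smul, hL, Finsupp.linearCombination_single, ← h2]
        exact B.graph.smul_mem x (B.mem_graph ⟨e a, h1⟩)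
    rintro ⟨φ, c⟩
    obtain ⟨h1, h2⟩ := hα φ
    obtain ⟨⟨_, h3⟩, rfl, h4⟩ := B.mem_graph_iff.1 (hLd c)
    refine ⟨B.domain.add_mem h1 h3, ?_⟩
    change _ = ((α φ : M) : 𝓗) + L (diagonalMap (fun a => (F a : ℂ)) c)
    simp only at h4
    rw [← h2, ← h4, ← B.map_add]
    rfl
  · intro v w
    simp only [LinearMap.mk₂'ₛₗ_apply, star_add, ht, star_matrixForm conj_timeKernel]
  · rintro ⟨φ, c⟩ - ⟨ψ, d⟩ hd
    have hd' : Finsupp.mapDomain g d = 0 := hd.2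
    have h1 := hccr φ ψ
    have h2 := matrixForm_timeKernel hg c d hd'
    rw [← he.inner_finsupp_eq_sum_right] at h2
    rw [hJJ]
    simp only [LinearMap.mk₂'ₛₗ_apply, star_add, LinearMap.prodMap_apply]
    rw [mul_add, ← h2]
    refine Eq.trans ?_ (congrArg (· + _) h1)
    ring
  · refine dense_of_orthogonal fun ξ hξ => htot ξ ?_ ?_
    · have hc : IsClosed {ψ : M | ⟪(ψ : 𝓗), ξ⟫_ℂ = 0} :=
        isClosed_eq (by fun_prop) continuous_const
      have : ∀ ψ : M, ψ ∈ {ψ : M | ⟪(ψ : 𝓗), ξ⟫_ℂ = 0} := fun ψ => by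
        refine hc.closure_subset_iff.2 (fun φ hφ => ?_) (hD ψ)
        exact hξ _ ⟨(⟨φ, hφ⟩, 0), ⟨trivial, Submodule.zero_mem _⟩, by simp [hJ, hi]⟩
      exact fun ψ hψ => this ⟨ψ, hψ⟩
    · refine inner_eq_zero_of_mapDomain he hg' fun c hc => ?_
      exact hξ _ ⟨(0, c), ⟨trivial, hc⟩, by simp [hJ, hL]⟩

end TimeOp

end

/-! ### Functions of an operator of class `S₁`. -/

section

namespace TimeOp

open scoped InnerProductSpace

variable {𝓗 : Type*} [NormedAddCommGroup 𝓗] [InnerProductSpace ℂ 𝓗]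

theorem acSubspace_diagMeasure (A : 𝓗 →ₗ.[ℂ] 𝓗) (ψ : acSubspace A) {B : Set ℝ}
    (hB : MeasurableSet B) (h0 : volume B = 0) :
    ((spectralMeasure A).restrict (acSubspace A) (proj_mem_acSubspace A)).diagMeasure ψ B = 0 := by
  rw [ProjectionValuedMeasure.diagMeasure_restrict, ← ProjectionValuedMeasure.proj_eq_zero_iff _ hB]
  exact ψ.2 B hB h0

variable [CompleteSpace 𝓗]

theorem inner_eigenspace_eigenspace {A : 𝓗 →ₗ.[ℂ] 𝓗} (hA : IsSelfAdjoint A) {x y : ℝ} (hxy : x ≠ y)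
    {v w : 𝓗} (hv : v ∈ eigenspace A x) (hw : w ∈ eigenspace A y) : ⟪v, w⟫_ℂ = 0 := by
  have h1 := proj_of_mem_eigenspace hA hv (measurableSet_singleton x)
  have h2 := proj_of_mem_eigenspace hA hw (measurableSet_singleton x)
  rw [Set.indicator_of_mem (Set.mem_singleton x), one_smul] at h1
  rw [Set.indicator_of_notMem (fun h => hxy (Set.mem_singleton_iff.1 h).symm), zero_smul] at h2
  rw [← h1, (spectralMeasure A).symmetric _ (measurableSet_singleton x), h2, inner_zero_right]

theorem deriv_ofReal_comp {f : ℝ → ℝ} {x : ℝ} (hf : DifferentiableAt ℝ f x) :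
    deriv (fun y => (f y : ℂ)) x = deriv f x :=
  hf.hasDerivAt.ofReal_comp.deriv

/-- Functions of an operator of class `S₁` have an ultra-weak time operator with a dense
ultra-weak CCR-domain. -/
theorem ClassS₁.hasDenselyUltraWeakTimeOperator {A : 𝓗 →ₗ.[ℂ] 𝓗} (hA : ClassS₁ A) {f : ℝ → ℝ}
    (hf : Measurable f) {K : Set ℝ} (hK : IsClosed K) (hK0 : volume K = 0)
    (hfK : ContDiffOn ℝ 2 f Kᶜ) (hf' : volume {x : ℝ | x ∈ Kᶜ ∧ deriv f x = 0} = 0)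
    (hinf : (f '' discreteSpectrum A).Infinite) :
    HasDenselyUltraWeakTimeOperator (borelCalculus f A) := by
  obtain ⟨E, hE, -, -, hdisc, hpoint⟩ := hA.disc
  obtain ⟨T, hT⟩ := hA.time
  set P := spectralMeasure A with hP
  have hAP : A = P.operator fun x => (x : ℂ) := eq_operator_spectralMeasure hA.selfAdjoint
  set g : ℝ → ℂ := fun x => (f x : ℂ) with hg
  have hgm : Measurable g := by fun_prop
  have hB : borelCalculus f A = P.operator g := P.spectralIntegral_eq hgm
  rw [hB]
  have hgK : ContDiffOn ℝ 2 g Kᶜ := Complex.ofRealCLM.contDiff.comp_contDiffOn hfK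
  have hder : ∀ x ∈ Kᶜ, deriv g x = deriv f x := fun x hx =>
    deriv_ofReal_comp ((hfK.contDiffAt (hK.isOpen_compl.mem_nhds hx)).differentiableAt two_ne_zero)
  -- The open set where `1 / g'` is C¹; its complement is Lebesgue-null, hence invisible to
  -- absolutely continuous vectors.
  set U : Set ℝ := Kᶜ ∩ deriv g ⁻¹' {0}ᶜ with hU
  have hUo : IsOpen U := (hgK.continuousOn_deriv_of_isOpen hK.isOpen_compl one_le_two
    ).isOpen_inter_preimage hK.isOpen_compl isOpen_compl_singleton
  have hU0 : volume Uᶜ = 0 := by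
    refine measure_mono_null (fun x hx => ?_) (measure_union_null hK0 hf')
    by_cases hxK : x ∈ K
    · exact Or.inl hxK
    · refine Or.inr ⟨hxK, ?_⟩
      by_contra h
      exact hx ⟨hxK, fun h' => h (by exact_mod_cast (hder x hxK).symm.trans h')⟩
  have hred : reducedPart A (acSubspace A) =
      (P.restrict (acSubspace A) (proj_mem_acSubspace A)).operator fun x => (x : ℂ) := by
    rw [← P.reducedPart_operator, ← hAP]
  rw [hred] at hT
  obtain ⟨D, α, t, hD, hα, ht, hccr⟩ :=
    ProjectionValuedMeasure.exists_form_of_strongTimeOperator hT hUo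
      (fun ψ => acSubspace_diagMeasure A ψ hUo.measurableSet.compl hU0) hgm
      (hgK.mono Set.inter_subset_left) (by ext x; simp [hg]) fun x hx => hx.2
  have hfin : ∀ n, FiniteDimensional ℂ (eigenspace A (E n)) := fun n => by
    have : E n ∈ discreteSpectrum A := hdisc ▸ Set.mem_range_self n
    exact this.2.1
  set b := fun n => stdOrthonormalBasis ℂ (eigenspace A (E n)) with hb
  set e : (Σ n, Fin (Module.finrank ℂ (eigenspace A (E n)))) → 𝓗 := fun a => (b a.1 a.2 : 𝓗) with he
  have hfam : OrthogonalFamily ℂ (fun n => eigenspace A (E n))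
      fun n => (eigenspace A (E n)).subtypeₗᵢ := fun m n hmn v w =>
    inner_eigenspace_eigenspace hA.selfAdjoint (hE.injective.ne hmn) v.2 w.2
  have heo : Orthonormal ℂ e := hfam.orthonormal_sigma_orthonormal fun n => (b n).orthonormal
  have hrange : Set.range (fun a : Σ n, Fin (Module.finrank ℂ (eigenspace A (E n))) => f (E a.1)) =
      f '' discreteSpectrum A := by
    rw [hdisc, ← Set.range_comp]
    refine subset_antisymm ?_ ?_
    · rintro _ ⟨a, rfl⟩
      exact ⟨a.1, rfl⟩
    · rintro _ ⟨n, rfl⟩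
      have h1 : eigenspace A (E n) ≠ ⊥ := by
        have : E n ∈ pointSpectrum A := hpoint ▸ Set.mem_range_self n
        exact this
      -- Every eigenspace contributes at least one basis vector, so no value `f (E n)` is lost.
      exact ⟨⟨n, 0, Nat.pos_of_ne_zero fun h => h1 (Submodule.finrank_eq_zero.1 h)⟩, rfl⟩
  have hnt : Nontrivial 𝓗 := by
    rw [← hrange] at hinf
    obtain ⟨_, a, -⟩ := hinf.nonempty
    exact nontrivial_of_ne (e a) 0 (heo.ne_zero a)
  refine hasDenselyUltraWeakTimeOperator_of_sum (P.isSelfAdjoint_ofReal hf) hD α t (fun φ => ?_) ht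
    hccr heo (fun a => f (E a.1)) (hrange ▸ hinf) (fun a => ?_) (fun a ψ hψ => ?_)
    fun ξ h1 h2 => ?_
  · obtain ⟨h1, h2⟩ := hα φ
    rw [P.diagMeasure_restrict] at h1
    refine ⟨h1, ?_⟩
    rw [h2, P.coe_int_restrict _ h1]
    rfl
  · have h1 : ∀ {x v}, v ∈ eigenspace A x → v ∈ eigenspace (P.operator fun x => (x : ℂ)) x :=
      fun h => by rwa [← hAP]
    obtain ⟨h2, h3⟩ := P.int_of_mem_eigenspace (h1 (b a.1 a.2).2) g
    exact ⟨h2, h3⟩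
  · exact inner_acSubspace_eigenspace hA.selfAdjoint (b a.1 a.2).2 hψ
  -- A vector orthogonal to both summands lies in the singular continuous subspace, which is zero as
  -- its part of `A` has empty spectrum.
  · refine eq_zero_of_mem_scSubspace hA.selfAdjoint hA.sc ((mem_scSubspace_iff A).2 ⟨h1, ?_⟩)
    intro x v hv
    by_cases hx : eigenspace A x = ⊥
    · rw [hx, Submodule.mem_bot] at hv
      rw [hv, inner_zero_left]
    · have h3 : x ∈ pointSpectrum A := hx
      rw [hpoint] at h3
      obtain ⟨n, rfl⟩ := h3
      have h4 := congrArg Subtype.val ((b n).sum_repr ⟨v, hv⟩)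
      simp only [Submodule.coe_sum, Submodule.coe_smul] at h4
      rw [← h4, sum_inner]
      exact Finset.sum_eq_zero fun j _ => by rw [inner_smul_left, h2 ⟨n, j⟩, mul_zero]

end TimeOp

end

/-! ### Exponentials, polynomials and sines. -/

section

namespace TimeOp

variable {𝓗 : Type*} [NormedAddCommGroup 𝓗] [InnerProductSpace ℂ 𝓗] [CompleteSpace 𝓗]

theorem ClassS₁.neg_of_mem_discreteSpectrum {A : 𝓗 →ₗ.[ℂ] 𝓗} (hA : ClassS₁ A) {x : ℝ}
    (hx : x ∈ discreteSpectrum A) : x < 0 := by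
  obtain ⟨E, -, hneg, -, hdisc, -⟩ := hA.disc
  rw [hdisc] at hx
  obtain ⟨n, rfl⟩ := hx
  exact hneg n

/-- A finite image would be closed and hence contain `f 0`, the limit of `f (E n)`. -/
theorem ClassS₁.infinite_image_discreteSpectrum {A : 𝓗 →ₗ.[ℂ] 𝓗} (hA : ClassS₁ A) {f : ℝ → ℝ}
    (hf : ContinuousAt f 0) (h0 : ∀ x ∈ discreteSpectrum A, f x ≠ f 0) :
    (f '' discreteSpectrum A).Infinite := fun hfin => by
  obtain ⟨E, -, -, hlim, hdisc, -⟩ := hA.disc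
  obtain ⟨x, hx, h1⟩ := hfin.isClosed.mem_of_tendsto (hf.tendsto.comp hlim)
    (Eventually.of_forall fun n => ⟨E n, hdisc ▸ Set.mem_range_self n, rfl⟩)
  exact h0 x hx h1

theorem ClassS₁.hasDenselyUltraWeakTimeOperator_of_contDiff {A : 𝓗 →ₗ.[ℂ] 𝓗} (hA : ClassS₁ A)
    {f : ℝ → ℝ} (hf : ContDiff ℝ 2 f) (hf' : {x | deriv f x = 0}.Countable)
    (h0 : ∀ x ∈ discreteSpectrum A, f x ≠ f 0) :
    HasDenselyUltraWeakTimeOperator (borelCalculus f A) :=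
  hA.hasDenselyUltraWeakTimeOperator hf.continuous.measurable isClosed_empty measure_empty
    hf.contDiffOn (measure_mono_null (fun _ hx => hx.2) (hf'.measure_zero volume))
    (hA.infinite_image_discreteSpectrum hf.continuous.continuousAt h0)

theorem ClassS₁.exp {A : 𝓗 →ₗ.[ℂ] 𝓗} (hA : ClassS₁ A) {β : ℝ} (hβ : β ≠ 0) :
    HasDenselyUltraWeakTimeOperator (borelCalculus (fun x => Real.exp (-β * x)) A) := by
  refine hA.hasDenselyUltraWeakTimeOperator_of_contDiff (by fun_prop) ?_ fun x hx h => ?_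
  · convert Set.countable_empty
    refine Set.eq_empty_of_forall_notMem fun x hx => ?_
    have h1 : HasDerivAt (fun x => Real.exp (-β * x)) (Real.exp (-β * x) * (-β * 1)) x :=
      ((hasDerivAt_id x).const_mul (-β)).exp
    rw [Set.mem_ofPred_eq, h1.deriv] at hx
    simp [hβ] at hx
  · have := Real.exp_injective h
    simp [hβ, (hA.neg_of_mem_discreteSpectrum hx).ne] at this

theorem ClassS₁.polynomial {A : 𝓗 →ₗ.[ℂ] 𝓗} (hA : ClassS₁ A) {p : Polynomial ℝ}
    (hp : 0 < p.natDegree) (h0 : ∀ x ∈ discreteSpectrum A, p.eval x ≠ p.eval 0) :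
    HasDenselyUltraWeakTimeOperator (borelCalculus (fun x => p.eval x) A) := by
  refine hA.hasDenselyUltraWeakTimeOperator_of_contDiff (by simpa using p.contDiff_aeval (𝕜 := ℝ) 2) ?_ h0
  have h1 : p.derivative ≠ 0 := fun h =>
    hp.ne' (Polynomial.derivative_eq_zero.1 h)
  refine (p.derivative.rootSet_finite ℝ).countable.mono fun x hx => ?_
  rw [Set.mem_ofPred_eq, Polynomial.deriv] at hx
  rw [Polynomial.mem_rootSet]
  exact ⟨h1, by simpa using hx⟩

theorem ClassS₁.sin {A : 𝓗 →ₗ.[ℂ] 𝓗} (hA : ClassS₁ A) {β : ℝ} (hβ : β ≠ 0)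
    (h0 : ∀ x ∈ discreteSpectrum A, ∀ k : ℤ, β ≠ k / (2 * x)) :
    HasDenselyUltraWeakTimeOperator (borelCalculus (fun x => Real.sin (2 * Real.pi * β * x)) A) := by
  have hc : 2 * Real.pi * β ≠ 0 := by positivity
  refine hA.hasDenselyUltraWeakTimeOperator_of_contDiff (by fun_prop) ?_ fun x hx h => ?_
  · refine (Set.countable_range fun k : ℤ => (2 * k + 1) * Real.pi / 2 / (2 * Real.pi * β)).mono
      fun x hx => ?_
    have h1 : HasDerivAt (fun x => Real.sin (2 * Real.pi * β * x))
        (Real.cos (2 * Real.pi * β * x) * (2 * Real.pi * β * 1)) x :=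
      ((hasDerivAt_id x).const_mul (2 * Real.pi * β)).sin
    rw [Set.mem_ofPred_eq, h1.deriv, mul_one, mul_eq_zero, or_iff_left hc,
      Real.cos_eq_zero_iff] at hx
    obtain ⟨k, hk⟩ := hx
    exact ⟨k, by simp only [← hk, mul_div_cancel_left₀ _ hc]⟩
  -- A zero of `sin (2πβx)` means `2βx = k` for an integer `k`, an excluded value of `β`.
  · simp only [mul_zero, Real.sin_zero, Real.sin_eq_zero_iff] at h
    obtain ⟨k, hk⟩ := h
    have hx0 := (hA.neg_of_mem_discreteSpectrum hx).ne
    refine h0 x hx k ?_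
    rw [eq_div_iff (mul_ne_zero two_ne_zero hx0)]
    refine mul_right_cancel₀ Real.pi_ne_zero ?_
    rw [hk]
    ring

end TimeOp

end

end

theorem theorem6 (d : ℕ) (m : ℝ) (hm : 0 < m)
    (V : EuclideanSpace ℝ (Fin d) → ℝ) (hV : Measurable V)
    (hH : TimeOp.ClassS₁ (TimeOp.schrodinger m V)) :
    (∀ f : ℝ → ℝ, Measurable f →
      (∃ K : Set ℝ, IsClosed K ∧ volume K = 0 ∧ ContDiffOn ℝ 2 f Kᶜ ∧
        volume {x : ℝ | x ∈ Kᶜ ∧ deriv f x = 0} = 0) →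
      ContinuousAt f 0 →
      (f '' TimeOp.discreteSpectrum (TimeOp.schrodinger m V)).Infinite →
      (∀ y ∈ f '' TimeOp.discreteSpectrum (TimeOp.schrodinger m V),
        FiniteDimensional ℂ
          (TimeOp.eigenspace (TimeOp.borelCalculus f (TimeOp.schrodinger m V)) y)) →
      (∀ x ∈ TimeOp.discreteSpectrum (TimeOp.schrodinger m V), f x ≠ f 0) →
      (∀ᵐ x ∂(volume.restrict (Set.Ici (0 : ℝ))), f x ≠ f 0) →
      TimeOp.HasDenselyUltraWeakTimeOperator
        (TimeOp.borelCalculus f (TimeOp.schrodinger m V))) ∧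
    (∀ β : ℝ, β ≠ 0 →
      TimeOp.HasDenselyUltraWeakTimeOperator
        (TimeOp.borelCalculus (fun x => Real.exp (-β * x)) (TimeOp.schrodinger m V))) ∧
    (∀ p : Polynomial ℝ, 0 < p.natDegree →
      (∀ x ∈ TimeOp.discreteSpectrum (TimeOp.schrodinger m V), p.eval x ≠ p.eval 0) →
      TimeOp.HasDenselyUltraWeakTimeOperator
        (TimeOp.borelCalculus (fun x => p.eval x) (TimeOp.schrodinger m V))) ∧
    (∀ β : ℝ, β ≠ 0 →
      (∀ x ∈ TimeOp.discreteSpectrum (TimeOp.schrodinger m V), ∀ k : ℤ, β ≠ k / (2 * x)) →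
      TimeOp.HasDenselyUltraWeakTimeOperator
        (TimeOp.borelCalculus (fun x => Real.sin (2 * Real.pi * β * x))
          (TimeOp.schrodinger m V))) := by
  exact ⟨fun f hf ⟨_, hK, hK0, hfK, hf'⟩ _ hinf _ _ _ =>
      hH.hasDenselyUltraWeakTimeOperator hf hK hK0 hfK hf' hinf,
    fun _ hβ => hH.exp hβ, fun _ hp h0 => hH.polynomial hp h0, fun _ hβ h0 => hH.sin hβ h0⟩
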